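/- **Model.** Products are the points of $[0,1]$. Fix a capacity $c\in(0,1)$ and let $\mathcal S$ be the set of Borel sets $S\subseteq[0,1]$ with $\mathrm{vol}(S)\le c$ (assortments). Let $w:[0,1]\to[0,1]$ be continuous, and continuously differentiable on $(0,1)$ with $\inf_{(0,1)}w'>0$. A customer with preference function $v:[0,1]\to[0,\infty)$ who is offered $S$ makes a choice $X^S\in[0,1]\cup\{\emptyset\}$ with $P(X^S\in A)=\int_A v\,dx/(1+\int_S v\,dx)$ for Borel $A\subseteq S$ and $P(X^S=\emptyset)=1/(1+\int_S v\,dx)$. For integrable $u$ put $r(S,u)=\int_S u\,w\,dx/(1+\int_S u\,dx)$; for $u=v$ this is the expected revenue. A policy $\pi$ selects $S_t\in\mathcal S$ in period $t$ as a (measurable) function of $S_1,X_1,\dots,S_{t-1},X_{t-1}$, where, given the past, $X_t$ is distributed as $X^{S_t}$. Its regret is $\Delta_\pi(T,v)=\sum_{t=1}^T \mathbb E_\pi[\max_{S\in\mathcal S}r(S,v)-r(S_t,v)]$. **Assumptions.** $\mathcal V$ is a class of preference functions such that (i) there are $\overline v>\underline v>0$ with $\overline v>w(0)/\int_0^1(w(x)-w(0))\,dx$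 and $\underline v\le v(y)\le\overline v$ for all $v\in\mathcal V$, $y\in[0,1]$; (ii) all $v\in\mathcal V$ are differentiable on $(0,1)$ and $\sup_{v\in\mathcal V,\,y\in(0,1)}|v'(y)|<\infty$. A function $v$ is called strongly smooth if it is infinitely differentiable on $(0,1)$ and there is a $C>0$ with $|v^{(\ell)}(y)/(\ell+1)!|<C$ for all $y\in(0,1)$ and all integers $\ell\ge1$. **The policy KDEP.** Let $N=\lceil 1/c\rceil$ and, for $i=1,\dots,N$, $S^i=[a_i,b_i]$ with $a_i=\frac{i-1}{N-1}(1-c)$, $b_i=a_i+c$. Given an integer $M\ge 0$, KDEP with parameter $M$ offers $S^i$ in the periods $(i-1)M+1,\dots,iM$, for $i=1,\dots,N$. Let $E_i$ be the number of no-purchases and $A_i$ the number of purchases in these periods, and $X_{i,1},\dots,X_{i,A_i}$ the purchased products. Let $h=\min\{c/2,1/e\}$, and let $\ell_i$ be the integer nearest to $\frac12\log(-2A_i\log h)-\frac12$ (irrelevant if $A_i=0$). Let $\varphi_j(x)=\sqrt{\tfrac{2j+1}{2}}\,\frac{1}{2^jj!}\frac{d^j}{dx^j}(x^2-1)^j$.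 For $x\in S^i$ let $(\gamma,\zeta)$ be $\big(\frac{2h}{h+x-a_i},-\frac{h-(x-a_i)}{h+x-a_i}\big)$ if $x<a_i+h$, $(1,0)$ if $a_i+h\le x\le b_i-h$, and $\big(\frac{2h}{h+b_i-x},\frac{h-(b_i-x)}{h+b_i-x}\big)$ if $x>b_i-h$; let $K^i_x(u)=\gamma\sum_{j=0}^{\ell_i}\varphi_j(\zeta)\varphi_j(\gamma u+\zeta)$ for $-\min\{1,\frac{x-a_i}{h}\}\le u\le\min\{1,\frac{b_i-x}{h}\}$, and $K^i_x(u)=0$ otherwise. Put $$\hat v_i(x)=\frac{1}{(E_i+1)h}\sum_{m=1}^{A_i}K^i_x\Big(\frac{X_{i,m}-x}{h}\Big)\ \ (x\in S^i),\qquad \hat v_i(x)=0\ \ (x\notin S^i),\qquad \hat v(x)=\frac{1}{\#\{i:x\in S^i\}}\sum_{i=1}^N\hat v_i(x).$$ In all periods after the first $MN$, KDEP offers one assortment $\hat S$, a (measurable) function of the outcomes of the first $MN$ periods, with $\hat S\in\arg\max_{S\in\mathcal S}r(S,\hat v)$ whenever $1+\int_S\hat v\,dx>0$ for all $S\in\mathcal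 S$ ($\hat v$ may take negative values; if the condition fails, $\hat S\in\mathcal S$ is arbitrary). **Theorem.** For every integer $T\ge2$ let $\pi=\pi_T$ be KDEP with $M=\lfloor T^{2/3}/N\rfloor$. Then, for every strongly smooth $v\in\mathcal V$, there is a $\overline C>0$ such that $$\Delta_\pi(T,v)\le\overline C\,T^{2/3}(\log T)^{1/2}\qquad\text{for all integers }T\ge2 .$$ -/

import Mathlib

noncomputable section

namespace ContAssort

open MeasureTheory

/-! ### The choice model -/

/-- Products are the points of the unit interval. A feasible assortment for the capacity `c` is a
Borel set of products of volume at most `c`. -/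
structure Assortment (c : ℝ) : Type where
  carrier : Set unitInterval
  measurableSet : MeasurableSet carrier
  volume_le : volume carrier ≤ ENNReal.ofReal c

/-- The outcome of one customer visit: a purchased product (`Sum.inl x`), or no purchase
(`Sum.inr ()`). -/
abbrev Outcome : Type := unitInterval ⊕ Unit

/-- The σ-algebra on assortments generated by the maps `S ↦ vol (S ∩ B)`, `B` Borel. -/
instance (c : ℝ) : MeasurableSpace (Assortment c) :=
  ⨆ B : {B : Set unitInterval // MeasurableSet B},
    MeasurableSpace.comap (fun S : Assortment c => volume (S.carrier ∩ B.1)) inferInstance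

/-- The total preference `∫_S v(x) dx` of a set of products. -/
def mass (v : ℝ → ℝ) (S : Set unitInterval) : ℝ := ∫ x : unitInterval in S, v x

/-- Expected revenue `r(S, v) = ∫_S v w / (1 + ∫_S v)`. -/
def revenue (w v : ℝ → ℝ) (S : Set unitInterval) : ℝ :=
  (∫ x : unitInterval in S, v x * w x) / (1 + mass v S)

/-- The law of the choice `X^S` of a customer who is offered `S`:
`P(X^S ∈ A) = ∫_A v / (1 + ∫_S v)` for `A ⊆ S`, and `P(X^S = ∅) = 1 / (1 + ∫_S v)`. -/
def choiceLaw (v : ℝ → ℝ) (S : Set unitInterval) : Measure Outcome :=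
  ENNReal.ofReal (1 / (1 + mass v S)) •
    (((volume.restrict S).withDensity (fun x : unitInterval => ENNReal.ofReal (v x))).map Sum.inl
      + Measure.dirac (Sum.inr ()))

/-! ### Policies and regret -/

/-- The sales data of the first `t` periods: the offered assortments and the (no-)purchases. -/
abbrev History (c : ℝ) (t : ℕ) : Type := Fin t → Assortment c × Outcome

/-- A policy: `act t` maps the data of the first `t` periods to the assortment offered in
period `t + 1`. -/
structure Policy (c : ℝ) where
  act : (t : ℕ) → History c t → Assortment c
  measurable_act : ∀ t, Measurable (act t)

/-- The law of the sales data of the first `t` periods when the policy `π` is used and the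
preference function is `v`: given the data so far, the assortment is the one that `π` prescribes,
and the customer chooses from it according to `choiceLaw`. -/
def historyLaw {c : ℝ} (v : ℝ → ℝ) (π : Policy c) : (t : ℕ) → Measure (History c t)
  | 0 => Measure.dirac Fin.elim0
  | t + 1 => (historyLaw v π t).bind fun h =>
      (choiceLaw v (π.act t h).carrier).map fun x =>
        Fin.snoc (α := fun _ => Assortment c × Outcome) h (π.act t h, x)

/-- The regret `∑_{t=1}^T E_π[max_S r(S, v) - r(S_t, v)]`. -/
def regret {c : ℝ} (w v : ℝ → ℝ) (π : Policy c) (T : ℕ) : ℝ :=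
  ∑ t ∈ Finset.range T,
    ∫ h, ((⨆ S : Assortment c, revenue w v S.carrier) - revenue w v (π.act t h).carrier)
      ∂(historyLaw v π t)

/-! ### Standing assumptions -/

/-- The marginal revenue function: continuous on `[0,1]` with values in `[0,1]`, and continuously
differentiable on `(0,1)` with `inf w' > 0`. -/
structure IsMarginalRevenue (w : ℝ → ℝ) : Prop where
  continuousOn : ContinuousOn w (Set.Icc 0 1)
  mem_Icc : ∀ x ∈ Set.Icc (0 : ℝ) 1, w x ∈ Set.Icc (0 : ℝ) 1
  contDiffOn : ContDiffOn ℝ 1 w (Set.Ioo 0 1)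
  deriv_pos : ∃ k > 0, ∀ x ∈ Set.Ioo (0 : ℝ) 1, k ≤ deriv w x

/-- The standing assumption on the class `V` of preference functions: common bounds `lo`, `hi` on
`[0,1]` with `0 < lo < hi` and `hi > w(0) / ∫ (w - w(0))`, and differentiability on `(0,1)` with a
common bound on the derivatives. -/
structure IsPreferenceClass (w : ℝ → ℝ) (V : Set (ℝ → ℝ)) : Prop where
  bounded : ∃ lo hi : ℝ, 0 < lo ∧ lo < hi ∧ w 0 / (∫ x in (0 : ℝ)..1, (w x - w 0)) < hi ∧
    ∀ v ∈ V, ∀ y ∈ Set.Icc (0 : ℝ) 1, lo ≤ v y ∧ v y ≤ hi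
  differentiableOn : ∀ v ∈ V, DifferentiableOn ℝ v (Set.Ioo 0 1)
  deriv_bounded : ∃ L : ℝ, ∀ v ∈ V, ∀ y ∈ Set.Ioo (0 : ℝ) 1, |deriv v y| ≤ L

/-- The strong smoothness assumption: `v` is smooth on `(0,1)` and `|v^(ℓ)(y) / (ℓ+1)!| < C` for
all `y ∈ (0,1)` and `ℓ ≥ 1`. -/
def IsStronglySmooth (v : ℝ → ℝ) : Prop :=
  ContDiffOn ℝ (⊤ : ℕ∞) v (Set.Ioo 0 1) ∧
    ∃ C > 0, ∀ y ∈ Set.Ioo (0 : ℝ) 1, ∀ l : ℕ, 1 ≤ l →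
      |iteratedDeriv l v y / (Nat.factorial (l + 1) : ℝ)| < C

/-! ### Legendre kernels -/

/-- The orthonormal Legendre polynomials on `[-1,1]`. -/
def legendre (j : ℕ) (x : ℝ) : ℝ :=
  Real.sqrt ((2 * j + 1) / 2) * (1 / (2 ^ j * (Nat.factorial j : ℝ))) *
    iteratedDeriv j (fun y : ℝ => (y ^ 2 - 1) ^ j) x

/-- The scale coefficient `γ_x` for the interval `[a,b]` and bandwidth `h`. -/
def shiftScale (a b h x : ℝ) : ℝ :=
  if x < a + h then 2 * h / (h + x - a)
  else if x ≤ b - h then 1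
  else 2 * h / (h + b - x)

/-- The shift coefficient `ζ_x` for the interval `[a,b]` and bandwidth `h`. -/
def shiftCenter (a b h x : ℝ) : ℝ :=
  if x < a + h then -((h - (x - a)) / (h + x - a))
  else if x ≤ b - h then 0
  else (h - (b - x)) / (h + b - x)

/-- The shifted support `I_x` for the interval `[a,b]` and bandwidth `h`. -/
def shiftedSupport (a b h x : ℝ) : Set ℝ :=
  Set.Icc (-(min 1 ((x - a) / h))) (min 1 ((b - x) / h))

open Classical in
/-- The Legendre kernel `K_x(u)` of order `l` for the interval `[a,b]` and bandwidth `h`. -/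
def legendreKernel (a b h : ℝ) (l : ℕ) (x u : ℝ) : ℝ :=
  if u ∈ shiftedSupport a b h x then
    shiftScale a b h x * ∑ j ∈ Finset.range (l + 1),
      legendre j (shiftCenter a b h x) *
        legendre j (shiftScale a b h x * u + shiftCenter a b h x)
  else 0

/-! ### The kernel density estimation policy

The test assortments and the blocks of the exploration phase are numbered from `0` to `N - 1`. -/

/-- The number `N = ⌈1/c⌉` of test assortments. -/
def numTests (c : ℝ) : ℕ := ⌈1 / c⌉₊

/-- The left end point of the `i`-th test assortment. -/
def testLeft (c : ℝ) (i : ℕ) : ℝ := (i : ℝ) / ((numTests c : ℝ) - 1) * (1 - c)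

/-- The right end point of the `i`-th test assortment. -/
def testRight (c : ℝ) (i : ℕ) : ℝ := testLeft c i + c

/-- The `i`-th test assortment. -/
def testSet (c : ℝ) (i : ℕ) : Set unitInterval :=
  {x | (x : ℝ) ∈ Set.Icc (testLeft c i) (testRight c i)}

/-- The bandwidth `h = min {c/2, 1/e}`. -/
def bandwidth (c : ℝ) : ℝ := min (c / 2) (1 / Real.exp 1)

/-- The kernel order for `n` observed purchases: the integer nearest to
`β = (1/2) log (-2 n log h) - 1/2`. -/
def kernelOrder (c : ℝ) (n : ℕ) : ℕ :=
  (round (1 / 2 * Real.log (-2 * n * Real.log (bandwidth c)) - 1 / 2)).toNat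

/-- The periods of the exploration phase in which the `i`-th test assortment is offered. -/
def block {n : ℕ} (M i : ℕ) : Finset (Fin n) := {s | s.1 / M = i}

/-- The number of no-purchases in block `i`. -/
def numNoPurchases {n : ℕ} (M : ℕ) (X : Fin n → Outcome) (i : ℕ) : ℕ :=
  ((block M i).filter fun s => (X s).isRight).card

/-- The number of purchases in block `i`. -/
def numPurchases {n : ℕ} (M : ℕ) (X : Fin n → Outcome) (i : ℕ) : ℕ :=
  ((block M i).filter fun s => (X s).isLeft).card

open Classical in
/-- The estimate of `v · 1_{S^i}` from the observations in block `i`. -/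
def blockEstimate (c : ℝ) {n : ℕ} (M : ℕ) (X : Fin n → Outcome) (i : ℕ) (x : ℝ) : ℝ :=
  if x ∈ Set.Icc (testLeft c i) (testRight c i) then
    1 / (((numNoPurchases M X i : ℝ) + 1) * bandwidth c) *
      ∑ s ∈ block M i,
        Sum.elim
          (fun y : unitInterval =>
            legendreKernel (testLeft c i) (testRight c i) (bandwidth c)
              (kernelOrder c (numPurchases M X i)) x (((y : ℝ) - x) / bandwidth c))
          (fun _ => 0) (X s)
  else 0

open Classical in
/-- The number of test assortments that contain `x`. -/
def coverCount (c x : ℝ) : ℕ :=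
  ((Finset.range (numTests c)).filter fun i =>
    x ∈ Set.Icc (testLeft c i) (testRight c i)).card

/-- The estimate of the preference function from the data of the exploration phase. -/
def estimate (c : ℝ) {n : ℕ} (M : ℕ) (X : Fin n → Outcome) (x : ℝ) : ℝ :=
  1 / (coverCount c x : ℝ) * ∑ i ∈ Finset.range (numTests c), blockEstimate c M X i x

/-- `π` is the kernel density estimation policy with horizon `T` and parameter `M`: it offers each
test assortment for `M` periods, and from then on an assortment `Sel X`, chosen as a function of
the outcomes `X` of the exploration phase, that maximizes the revenue for the estimated preference
function. The estimate may take negative values. If they are so large that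
`1 + ∫_S estimate` is not positive for all assortments, then `Sel X` is arbitrary. -/
def IsKDEP {c : ℝ} (w : ℝ → ℝ) (T M : ℕ) (π : Policy c) : Prop :=
  (∀ t < M * numTests c, ∀ h : History c t, (π.act t h).carrier = testSet c (t / M)) ∧
  ∃ Sel : (Fin (M * numTests c) → Outcome) → Assortment c,
    (∀ X, (∀ S : Assortment c, 0 < 1 + mass (estimate c M X) S.carrier) →
      ∀ S : Assortment c,
        revenue w (estimate c M X) S.carrier ≤ revenue w (estimate c M X) (Sel X).carrier) ∧
    ∀ t (ht : M * numTests c ≤ t), t < T → ∀ h : History c t,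
      π.act t h = Sel fun s => (h (Fin.castLE ht s)).2

end ContAssort

end

/-! ### Orthonormal Legendre polynomials on `[-1,1]`. -/

namespace ContAssort

open MeasureTheory Polynomial

/-! The regret splits into exploration and exploitation. Exploration takes at most `T^(2/3)`
periods, each losing at most 1. For exploitation, the revenue is Lipschitz in the preference
function for the `L¹` distance, uniformly over assortments, so optimizing for the estimate loses at
most 8 times its `L¹` error (`IsMarginalRevenue.ofReal_gap_le`). It remains to show that each block
has expected `L¹` error of order `√(log M / M)` (`exists_lintegral_blockEstimate_le`); with `M`
about `T^(2/3) / N`, multiplication by `T` gives the rate.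

The bandwidth is fixed, and accuracy comes from the order `l` of the kernel. In the affine
coordinate that maps the window of the kernel to `[-1,1]`, smoothing is the Legendre projection onto
polynomials of degree at most `l`. Strong smoothness bounds the `k`-th Taylor coefficient on a
window by `C (k+1) h^k` with `h ≤ 1/e`, and the projection reproduces the terms with `k ≤ l`, so the
integrated bias is of order `√l e^(-l)` (`lintegral_abs_kernelBias_le`). By orthonormality, the
second moment of the kernel at `x` is controlled by `∑ φ_j(ζ_x)²` over `j ≤ l`. At the ends of a
test interval `ζ_x = ±1` and this sum is of order `l²`, but its integral over `x` is only `O(l)`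
(`setIntegral_legendre_shiftCenter_sq_le`); this is the gain from working in `L¹`. An order of about
half the logarithm of the number of purchases balances bias and noise.

The order and the normalization of the estimate are random, but they depend only on the number of
purchases. Expectations are therefore split according to the exact set of periods with a purchase
(`sum_patternInd`). Given this set, the purchased positions are independent with density `v / V`,
where `V` is the mass of the test set, and sums of centred kernels have no cross terms
(`integral_patternInd_mul_sq`). Finally, the number `k` of purchases is binomial with odds `V`, so
`k / (E + 1)` estimates `V` with relative error `O(M^(-1/2))` (`sum_binomial_abs_sub_le`). -/

/-- The orthonormal Legendre polynomial of degree `j`, as a polynomial. -/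
noncomputable def legendrePoly (j : ℕ) : ℝ[X] :=
  C (Real.sqrt ((2 * j + 1) / 2) * (1 / (2 ^ j * (Nat.factorial j : ℝ)))) *
    derivative^[j] ((X ^ 2 - 1) ^ j)

theorem iteratedDeriv_eval (p : ℝ[X]) (j : ℕ) :
    iteratedDeriv j (fun y => p.eval y) = fun y => (derivative^[j] p).eval y := by
  induction j with
  | zero => simp
  | succ j ih =>
    rw [iteratedDeriv_succ, ih, Function.iterate_succ_apply']
    ext y
    simp

theorem legendre_eq_eval (j : ℕ) (x : ℝ) : legendre j x = (legendrePoly j).eval x := by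
  have h : (fun y : ℝ => (y ^ 2 - 1) ^ j) = fun y => ((X ^ 2 - 1 : ℝ[X]) ^ j).eval y := by
    ext y; simp
  rw [legendre, h, iteratedDeriv_eval, legendrePoly, eval_mul, eval_C]

theorem legendre_eq_eval_fun (j : ℕ) : legendre j = fun x => (legendrePoly j).eval x :=
  funext (legendre_eq_eval j)

@[fun_prop]
theorem continuous_legendre (j : ℕ) : Continuous (legendre j) := by
  rw [legendre_eq_eval_fun]; fun_prop

theorem intervalIntegrable_eval (p : ℝ[X]) (a b : ℝ) :
    IntervalIntegrable (fun x => p.eval x) volume a b :=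
  (by fun_prop : Continuous fun x => p.eval x).intervalIntegrable a b

theorem integral_eval_mul_derivative (p q : ℝ[X]) (a b : ℝ) :
    ∫ x in a..b, p.eval x * (derivative q).eval x =
      p.eval b * q.eval b - p.eval a * q.eval a -
        ∫ x in a..b, (derivative p).eval x * q.eval x :=
  intervalIntegral.integral_mul_deriv_eq_deriv_mul (fun x _ => p.hasDerivAt x)
    (fun x _ => q.hasDerivAt x) (intervalIntegrable_eval _ _ _) (intervalIntegrable_eval _ _ _)

theorem eval_iterate_derivative_eq_zero {x : ℝ} (hx : x ^ 2 = 1) {i j : ℕ} (hij : i < j) :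
    (derivative^[i] ((X ^ 2 - 1 : ℝ[X]) ^ j)).eval x = 0 := by
  obtain ⟨r, hr⟩ := pow_sub_dvd_iterate_derivative_pow (X ^ 2 - 1 : ℝ[X]) j i
  rw [hr, eval_mul, eval_pow]
  simp [hx, Nat.sub_ne_zero_of_lt hij]

/-- Repeated integration by parts. All boundary terms vanish because `(X² - 1)^j` has zeros of order
`j` at `±1` and at most `j - 1` derivatives remain on it when a boundary term is evaluated. -/
theorem integral_mul_iterate_derivative (q : ℝ[X]) {k j : ℕ} (hk : k ≤ j) :
    ∫ x in (-1 : ℝ)..1, q.eval x * (derivative^[k] ((X ^ 2 - 1 : ℝ[X]) ^ j)).eval x =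
      (-1) ^ k * ∫ x in (-1 : ℝ)..1, (derivative^[k] q).eval x *
        ((X ^ 2 - 1 : ℝ[X]) ^ j).eval x := by
  induction k generalizing q with
  | zero => simp
  | succ k ih =>
    rw [Function.iterate_succ_apply', integral_eval_mul_derivative,
      eval_iterate_derivative_eq_zero (by norm_num) (by omega),
      eval_iterate_derivative_eq_zero (by norm_num) (by omega), ih _ (by omega),
      Function.iterate_succ_apply]
    ring

/-- The derivative of `x (x² - 1)^(j+1)` is the combination of the two integrands, and this function
vanishes at both ends. -/
theorem integral_sq_sub_one_pow_succ (j : ℕ) :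
    (2 * (j : ℝ) + 3) * ∫ x in (-1 : ℝ)..1, (x ^ 2 - 1) ^ (j + 1) =
      -(2 * (j + 1)) * ∫ x in (-1 : ℝ)..1, (x ^ 2 - 1) ^ j := by
  have h : ∫ x in (-1 : ℝ)..1, ((2 * (j : ℝ) + 3) * (x ^ 2 - 1) ^ (j + 1) +
      2 * (j + 1) * (x ^ 2 - 1) ^ j) = 0 := by
    have := intervalIntegral.integral_eq_sub_of_hasDerivAt (a := -1) (b := 1)
      (f := fun x : ℝ => x * (x ^ 2 - 1) ^ (j + 1))
      (f' := fun x => (2 * (j : ℝ) + 3) * (x ^ 2 - 1) ^ (j + 1) +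
        2 * (j + 1) * (x ^ 2 - 1) ^ j)
      (fun x _ => by
        have h1 : HasDerivAt (fun x : ℝ => (x ^ 2 - 1)) (2 * x) x := by
          simpa using (hasDerivAt_pow 2 x).sub_const 1
        refine ((hasDerivAt_id' x).mul (h1.fun_pow (j + 1))).congr_deriv ?_
        rw [Nat.add_sub_cancel]
        push_cast
        ring)
      (Continuous.intervalIntegrable (by fun_prop) _ _)
    rw [this]; norm_num
  rw [intervalIntegral.integral_add (Continuous.intervalIntegrable (by fun_prop) _ _)
    (Continuous.intervalIntegrable (by fun_prop) _ _), intervalIntegral.integral_const_mul,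
    intervalIntegral.integral_const_mul] at h
  linarith

theorem integral_sq_sub_one_pow (j : ℕ) :
    ∫ x in (-1 : ℝ)..1, (x ^ 2 - 1) ^ j =
      (-1) ^ j * (2 ^ (2 * j + 1) * (j.factorial : ℝ) ^ 2 / ((2 * j + 1).factorial : ℝ)) := by
  induction j with
  | zero => norm_num
  | succ j ih =>
    have h := integral_sq_sub_one_pow_succ j
    rw [ih] at h
    have h3 : (2 * (j : ℝ) + 3) ≠ 0 := by positivity
    have e : (2 * (j + 1) + 1).factorial = (2 * j + 3) * ((2 * j + 2) * (2 * j + 1).factorial) := by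
      rw [show 2 * (j + 1) + 1 = 2 * j + 1 + 1 + 1 by ring, Nat.factorial_succ, Nat.factorial_succ]
    have hne : ((2 * j + 1).factorial : ℝ) ≠ 0 := by positivity
    apply mul_left_cancel₀ h3
    rw [h, e, Nat.factorial_succ j]
    push_cast
    field_simp
    ring

theorem natDegree_sq_sub_one_pow (j : ℕ) : ((X ^ 2 - 1 : ℝ[X]) ^ j).natDegree = 2 * j := by
  have : (X ^ 2 - 1 : ℝ[X]) = X ^ 2 - C 1 := by simp
  rw [natDegree_pow, this, natDegree_X_pow_sub_C]; ring

theorem monic_sq_sub_one_pow (j : ℕ) : ((X ^ 2 - 1 : ℝ[X]) ^ j).Monic := by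
  have : (X ^ 2 - 1 : ℝ[X]) = X ^ 2 - C 1 := by simp
  rw [this]; exact (monic_X_pow_sub_C 1 (by norm_num)).pow j

theorem natDegree_legendrePoly_le (j : ℕ) : (legendrePoly j).natDegree ≤ j := by
  refine (natDegree_C_mul_le _ _).trans ((natDegree_iterate_derivative _ _).trans ?_)
  rw [natDegree_sq_sub_one_pow]; omega

theorem coeff_sq_sub_one_pow_two_mul (j : ℕ) : ((X ^ 2 - 1 : ℝ[X]) ^ j).coeff (2 * j) = 1 := by
  have := (monic_sq_sub_one_pow j).coeff_natDegree
  rwa [natDegree_sq_sub_one_pow] at this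

/-- The degree is exactly `j`, which is what allows leading terms to be stripped off in
`exists_eval_eq_sum_legendre`. -/
theorem coeff_legendrePoly_ne_zero (j : ℕ) : (legendrePoly j).coeff j ≠ 0 := by
  rw [legendrePoly, coeff_C_mul, coeff_iterate_derivative, ← two_mul,
    coeff_sq_sub_one_pow_two_mul]
  have h1 : Real.sqrt ((2 * (j : ℝ) + 1) / 2) ≠ 0 := (Real.sqrt_pos.mpr (by positivity)).ne'
  have h2 : ((2 * j).descFactorial j : ℝ) ≠ 0 := by
    exact_mod_cast (Nat.descFactorial_pos.mpr (by omega)).ne'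
  have h3 : (1 / (2 ^ j * (Nat.factorial j : ℝ))) ≠ 0 := by positivity
  simp only [nsmul_eq_mul, mul_one]
  exact mul_ne_zero (mul_ne_zero h1 h3) h2

theorem integral_mul_legendre_of_natDegree_lt (q : ℝ[X]) {j : ℕ} (hq : q.natDegree < j) :
    ∫ x in (-1 : ℝ)..1, q.eval x * legendre j x = 0 := by
  have h : ∀ x, q.eval x * legendre j x =
      Real.sqrt ((2 * j + 1) / 2) * (1 / (2 ^ j * (Nat.factorial j : ℝ))) *
        (q.eval x * (derivative^[j] ((X ^ 2 - 1 : ℝ[X]) ^ j)).eval x) := fun x => by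
    rw [legendre_eq_eval, legendrePoly, eval_mul, eval_C]; ring
  simp_rw [h]
  rw [intervalIntegral.integral_const_mul, integral_mul_iterate_derivative q le_rfl,
    iterate_derivative_eq_zero hq]
  simp

/-- The Rodrigues formula is inserted for one factor only. Moving its `j` derivatives to the other
factor leaves a constant, the leading coefficient times `j!`, and the integral of `(x² - 1)^j`. -/
theorem integral_legendre_sq (j : ℕ) : ∫ x in (-1 : ℝ)..1, legendre j x * legendre j x = 1 := by
  have hD : derivative^[j] (legendrePoly j) =
      C (Real.sqrt ((2 * j + 1) / 2) * (1 / (2 ^ j * (Nat.factorial j : ℝ))) *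
        ((2 * j).factorial : ℝ)) := by
    rw [legendrePoly, iterate_derivative_C_mul, ← Function.iterate_add_apply, ← two_mul, C_mul]
    rw [eq_C_of_natDegree_le_zero (p := derivative^[2 * j] ((X ^ 2 - 1 : ℝ[X]) ^ j))
      ((natDegree_iterate_derivative _ _).trans (by rw [natDegree_sq_sub_one_pow]; omega)),
      coeff_iterate_derivative, zero_add, coeff_sq_sub_one_pow_two_mul, Nat.descFactorial_self]
    simp
  have h : ∫ x in (-1 : ℝ)..1, legendre j x * legendre j x =
      Real.sqrt ((2 * j + 1) / 2) * (1 / (2 ^ j * (Nat.factorial j : ℝ))) *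
      ∫ x in (-1 : ℝ)..1, (legendrePoly j).eval x *
        (derivative^[j] ((X ^ 2 - 1 : ℝ[X]) ^ j)).eval x := by
    rw [← intervalIntegral.integral_const_mul]
    congr 1
    ext x
    rw [legendre_eq_eval]
    nth_rw 2 [legendrePoly]
    rw [eval_mul, eval_C]; ring
  rw [h, integral_mul_iterate_derivative _ le_rfl, hD]
  have he : ∀ x : ℝ, eval x ((X ^ 2 - 1 : ℝ[X]) ^ j) = (x ^ 2 - 1) ^ j := fun x => by simp
  simp only [eval_C, he]
  rw [intervalIntegral.integral_const_mul, integral_sq_sub_one_pow]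
  have hs : Real.sqrt ((2 * (j : ℝ) + 1) / 2) * Real.sqrt ((2 * (j : ℝ) + 1) / 2) =
      (2 * j + 1) / 2 := Real.mul_self_sqrt (by positivity)
  have hm : ((-1 : ℝ) ^ j) * (-1) ^ j = 1 := by rw [← mul_pow]; norm_num
  rw [Nat.factorial_succ]
  set s := Real.sqrt ((2 * (j : ℝ) + 1) / 2)
  have hne : ((2 * j).factorial : ℝ) ≠ 0 := by positivity
  have hne' : (j.factorial : ℝ) ≠ 0 := by positivity
  calc _ = (s * s) * (((-1 : ℝ) ^ j) * (-1) ^ j) * ((1 / (2 ^ j * (Nat.factorial j : ℝ))) ^ 2 *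
        ((2 * j).factorial : ℝ) *
        (2 ^ (2 * j + 1) * (j.factorial : ℝ) ^ 2 / (((2 * j + 1) * (2 * j).factorial : ℕ) : ℝ))) := by
        ring
    _ = 1 := by
        rw [hs, hm]
        push_cast
        field_simp
        ring

theorem integral_legendre_mul_legendre (i j : ℕ) :
    ∫ x in (-1 : ℝ)..1, legendre i x * legendre j x = if i = j then 1 else 0 := by
  rcases lt_trichotomy i j with h | rfl | h
  · simp_rw [legendre_eq_eval i]
    rw [if_neg h.ne, integral_mul_legendre_of_natDegree_lt]
    exact (natDegree_legendrePoly_le i).trans_lt h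
  · rw [if_pos rfl, integral_legendre_sq]
  · simp_rw [mul_comm (legendre i _), legendre_eq_eval j]
    rw [if_neg h.ne', integral_mul_legendre_of_natDegree_lt]
    exact (natDegree_legendrePoly_le j).trans_lt h

/-- Induction on the degree: the multiple of `legendrePoly (k + 1)` with the same top coefficient is
subtracted. Only monomials are expanded later. -/
theorem exists_eval_eq_sum_legendre (k : ℕ) :
    ∀ q : ℝ[X], q.natDegree ≤ k →
      ∃ α : ℕ → ℝ, ∀ x, q.eval x = ∑ j ∈ Finset.range (k + 1), α j * legendre j x := by
  induction k with
  | zero =>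
    intro q hq
    have h0 := coeff_legendrePoly_ne_zero 0
    refine ⟨fun _ => q.coeff 0 / (legendrePoly 0).coeff 0, fun x => ?_⟩
    simp only [zero_add, Finset.sum_range_one]
    rw [legendre_eq_eval, eq_C_of_natDegree_le_zero hq, eq_C_of_natDegree_le_zero (natDegree_legendrePoly_le 0)]
    simp only [eval_C, coeff_C_zero]
    field_simp
  | succ k ih =>
    intro q hq
    have h0 := coeff_legendrePoly_ne_zero (k + 1)
    set β := q.coeff (k + 1) / (legendrePoly (k + 1)).coeff (k + 1)
    obtain ⟨α, hα⟩ := ih (q - C β * legendrePoly (k + 1)) (by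
      have h1 : (q - C β * legendrePoly (k + 1)).natDegree ≤ k + 1 :=
        (natDegree_sub_le_of_le hq ((natDegree_C_mul_le _ _).trans
          (natDegree_legendrePoly_le (k + 1)))).trans_eq (max_self _)
      refine natDegree_le_pred h1 ?_
      rw [coeff_sub, coeff_C_mul, div_mul_cancel₀ _ h0, sub_self])
    refine ⟨fun j => if j = k + 1 then β else α j, fun x => ?_⟩
    have h2 := hα x
    rw [eval_sub, eval_mul, eval_C, ← legendre_eq_eval] at h2
    simp only [Finset.sum_range_succ _ (k + 1), if_pos]
    rw [← sub_eq_iff_eq_add, h2]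
    refine Finset.sum_congr rfl fun j hj => ?_
    rw [if_neg (Finset.mem_range.mp hj).ne]

theorem integral_sum_legendre_mul_legendre (α : ℕ → ℝ) (n j : ℕ) :
    ∫ x in (-1 : ℝ)..1, (∑ i ∈ Finset.range n, α i * legendre i x) * legendre j x =
      if j < n then α j else 0 := by
  simp_rw [Finset.sum_mul, mul_assoc]
  rw [intervalIntegral.integral_finsetSum
    (fun i _ => Continuous.intervalIntegrable (by fun_prop) _ _)]
  simp_rw [intervalIntegral.integral_const_mul, integral_legendre_mul_legendre]
  simp

/-- The sum of the squares of the Legendre coefficients of a finite Legendre sum. -/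
theorem integral_sum_legendre_sq (α : ℕ → ℝ) (n : ℕ) :
    ∫ x in (-1 : ℝ)..1, (∑ i ∈ Finset.range n, α i * legendre i x) ^ 2 =
      ∑ i ∈ Finset.range n, α i ^ 2 := by
  have h : ∀ x, (∑ i ∈ Finset.range n, α i * legendre i x) ^ 2 =
      ∑ j ∈ Finset.range n, α j *
        ((∑ i ∈ Finset.range n, α i * legendre i x) * legendre j x) := by
    intro x
    rw [sq, Finset.mul_sum]
    exact Finset.sum_congr rfl fun j _ => by ring
  simp_rw [h]
  rw [intervalIntegral.integral_finsetSum
    (fun i _ => Continuous.intervalIntegrable (by fun_prop) _ _)]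
  simp_rw [intervalIntegral.integral_const_mul, integral_sum_legendre_mul_legendre]
  refine Finset.sum_congr rfl fun j hj => ?_
  rw [if_pos (Finset.mem_range.mp hj)]; ring

theorem integral_pow_two_mul (k : ℕ) : ∫ x in (-1 : ℝ)..1, (x ^ k) ^ 2 = 2 / (2 * k + 1) := by
  simp_rw [← pow_mul]
  rw [integral_pow]
  have : Odd (k * 2 + 1) := ⟨k, by ring⟩
  rw [one_pow, this.neg_one_pow]
  push_cast
  ring

/-- A Wallis-type bound. The induction step reduces to `(2k+1)(2k+3) ≤ 4(k+1)²`. -/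
theorem two_mul_add_one_mul_centralBinom_sq_le (k : ℕ) :
    (2 * (k : ℝ) + 1) * (k.centralBinom : ℝ) ^ 2 ≤ 16 ^ k := by
  induction k with
  | zero => simp
  | succ k ih =>
    have h : ((k : ℝ) + 1) * ((k + 1).centralBinom : ℝ) = 2 * (2 * k + 1) * k.centralBinom := by
      exact_mod_cast Nat.succ_mul_centralBinom_succ k
    have h2 : (((k : ℝ) + 1) * ((k + 1).centralBinom : ℝ)) ^ 2 =
      (2 * (2 * k + 1) * k.centralBinom) ^ 2 := by rw [h]
    have h1 : (0 : ℝ) < ((k : ℝ) + 1) ^ 2 := by positivity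
    refine le_of_mul_le_mul_left ?_ h1
    push_cast
    calc ((k : ℝ) + 1) ^ 2 * ((2 * ((k : ℝ) + 1) + 1) * ((k + 1).centralBinom : ℝ) ^ 2)
        = (2 * k + 3) * (((k : ℝ) + 1) * ((k + 1).centralBinom : ℝ)) ^ 2 := by ring
      _ = 4 * ((2 * k + 3) * (2 * k + 1)) * ((2 * (k : ℝ) + 1) * (k.centralBinom : ℝ) ^ 2) := by
          rw [h2]; ring
      _ ≤ 4 * ((2 * k + 3) * (2 * k + 1)) * 16 ^ k := by gcongr
      _ ≤ ((k : ℝ) + 1) ^ 2 * 16 ^ (k + 1) := by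
          rw [pow_succ (16 : ℝ) k]
          have : (0 : ℝ) < 16 ^ k := by positivity
          nlinarith

/-- Up to normalization, the value at 0 is the coefficient of `X^j` in `(X² - 1)^j`: zero for odd
`j`, a signed central binomial coefficient for even `j`. Away from the ends of a test interval the
kernel is centred, so this bound controls its second moment there. -/
theorem legendre_zero_sq_le_one (j : ℕ) : legendre j 0 ^ 2 ≤ 1 := by
  have hco : (X ^ 2 - 1 : ℝ[X]) ^ j = expand ℝ 2 ((X - C 1) ^ j) := by simp
  rw [legendre_eq_eval, legendrePoly, eval_mul, eval_C, ← coeff_zero_eq_eval_zero,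
    coeff_iterate_derivative, zero_add, Nat.descFactorial_self, hco, coeff_expand (by norm_num)]
  split_ifs with hd
  · obtain ⟨k, rfl⟩ := hd
    rw [Nat.mul_div_cancel_left _ (by norm_num), sub_eq_add_neg, ← C_neg,
      coeff_X_add_C_pow]
    have hs : Real.sqrt ((2 * ((2 * k : ℕ) : ℝ) + 1) / 2) ^ 2 = (2 * ((2 * k : ℕ) : ℝ) + 1) / 2 :=
      Real.sq_sqrt (by positivity)
    have hm : ((-1 : ℝ) ^ (2 * k - k)) ^ 2 = 1 := by rw [← pow_mul, pow_mul']; norm_num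
    have hf : ((2 * k).factorial : ℝ) ≠ 0 := by positivity
    have h16 := two_mul_add_one_mul_centralBinom_sq_le k
    rw [Nat.centralBinom_eq_two_mul_choose] at h16
    have h2 : ((2 : ℝ) ^ (2 * k)) ^ 2 = 16 ^ k := by
      rw [← pow_mul, show 2 * k * 2 = 4 * k by ring, pow_mul]; norm_num
    rw [nsmul_eq_mul]
    set s := Real.sqrt ((2 * ((2 * k : ℕ) : ℝ) + 1) / 2)
    set c : ℝ := ((2 * k).choose k : ℝ)
    calc _ = s ^ 2 * ((-1 : ℝ) ^ (2 * k - k)) ^ 2 * (c ^ 2 / ((2 : ℝ) ^ (2 * k)) ^ 2) := by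
          field_simp
      _ = (4 * k + 1) / 2 * (c ^ 2 / 16 ^ k) := by
          rw [hs, hm, h2]; push_cast; ring
      _ ≤ (2 * k + 1) * (c ^ 2 / 16 ^ k) := by
          gcongr
          linarith
      _ ≤ 1 := by
          rw [← mul_div_assoc, div_le_one (by positivity)]
          exact h16
  · simp

end ContAssort

/-! ### The window of the kernel, and Legendre moments averaged over a test interval. -/

namespace ContAssort

open MeasureTheory Set

/-- The half-width of the window of the kernel at `x`. -/
noncomputable def windowRadius (a b h x : ℝ) : ℝ := h / shiftScale a b h x

/-- The centre of the window of the kernel at `x`. -/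
noncomputable def windowCenter (a b h x : ℝ) : ℝ := x - windowRadius a b h x * shiftCenter a b h x

section Window

variable {a b h x : ℝ}

theorem shiftScale_mem (hh : 0 < h) (hx : x ∈ Icc a b) :
    shiftScale a b h x ∈ Icc (1 : ℝ) 2 := by
  obtain ⟨h1, h2⟩ := hx
  unfold shiftScale
  split_ifs with h3 h4
  · rw [mem_Icc, le_div_iff₀ (by linarith), div_le_iff₀ (by linarith)]; constructor <;> linarith
  · norm_num
  · rw [mem_Icc, le_div_iff₀ (by linarith), div_le_iff₀ (by linarith)]; constructor <;> linarith

theorem shiftCenter_mem (hh : 0 < h) (hx : x ∈ Icc a b) :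
    shiftCenter a b h x ∈ Icc (-1 : ℝ) 1 := by
  obtain ⟨h1, h2⟩ := hx
  unfold shiftCenter
  split_ifs with h3 h4
  · rw [mem_Icc, neg_le_neg_iff, neg_le, le_div_iff₀ (by linarith), div_le_iff₀ (by linarith)]
    constructor <;> linarith
  · norm_num
  · rw [mem_Icc, le_div_iff₀ (by linarith), div_le_iff₀ (by linarith)]; constructor <;> linarith

theorem windowRadius_pos (hh : 0 < h) (hx : x ∈ Icc a b) :
    0 < windowRadius a b h x :=
  div_pos hh (zero_lt_one.trans_le (shiftScale_mem hh hx).1)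

theorem windowRadius_le (hh : 0 < h) (hx : x ∈ Icc a b) :
    windowRadius a b h x ≤ h :=
  div_le_self hh.le (shiftScale_mem hh hx).1

theorem shiftScale_mul_windowRadius (hh : 0 < h) (hx : x ∈ Icc a b) :
    shiftScale a b h x * windowRadius a b h x = h :=
  mul_div_cancel₀ _ (zero_lt_one.trans_le (shiftScale_mem hh hx).1).ne'

theorem windowCenter_add (a b h x : ℝ) :
    windowCenter a b h x + windowRadius a b h x * shiftCenter a b h x = x := by
  rw [windowCenter]; ring

/-- The window is exactly `[x - h, x + h] ∩ [a, b]`. The condition `2 * h ≤ b - a` ensures that at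
most one side is cut off, which matches the three cases of the scale and the shift. -/
theorem windowRadius_windowCenter (hh : 0 < h) (hab : 2 * h ≤ b - a) (hx : x ∈ Icc a b) :
    a ≤ windowCenter a b h x - windowRadius a b h x ∧
    windowCenter a b h x + windowRadius a b h x ≤ b ∧
    ∀ y, (y - x) / h ∈ shiftedSupport a b h x ↔
      |y - windowCenter a b h x| ≤ windowRadius a b h x := by
  obtain ⟨h1, h2⟩ := hx
  have key : ∀ y, (y - x) / h ∈ shiftedSupport a b h x ↔
      max a (x - h) ≤ y ∧ y ≤ min b (x + h) := by
    intro y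
    rw [shiftedSupport, mem_Icc, neg_le, le_min_iff, le_min_iff, max_le_iff, le_min_iff,
      ← neg_div, div_le_div_iff_of_pos_right hh, div_le_div_iff_of_pos_right hh,
      div_le_one hh, div_le_one hh]
    constructor
    · rintro ⟨⟨h3, h4⟩, h5, h6⟩; refine ⟨⟨?_, ?_⟩, ?_, ?_⟩ <;> linarith
    · rintro ⟨⟨h3, h4⟩, h5, h6⟩; refine ⟨⟨?_, ?_⟩, ?_, ?_⟩ <;> linarith
  suffices windowCenter a b h x - windowRadius a b h x = max a (x - h) ∧
      windowCenter a b h x + windowRadius a b h x = min b (x + h) by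
    obtain ⟨e1, e2⟩ := this
    refine ⟨e1 ▸ le_max_left _ _, e2 ▸ min_le_left _ _, fun y => ?_⟩
    rw [key, ← e1, ← e2, abs_le]
    constructor <;> rintro ⟨h3, h4⟩ <;> constructor <;> linarith
  unfold windowCenter windowRadius shiftScale shiftCenter
  split_ifs with h3 h4
  · rw [max_eq_left (by linarith), min_eq_right (by linarith)]
    have : h + x - a ≠ 0 := by linarith
    constructor <;> field_simp <;> ring
  · rw [max_eq_right (by linarith), min_eq_right (by linarith)]
    constructor <;> ring
  · rw [max_eq_right (by linarith), min_eq_left (by linarith)]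
    have : h + b - x ≠ 0 := by linarith
    constructor <;> field_simp <;> ring

/-- The affine map of the window onto `[-1,1]` sends `x` to its shift coefficient. In this
coordinate the kernel is, up to scale, the reproducing kernel of the polynomials of degree at most
`l`. -/
theorem legendreKernel_eq (hh : 0 < h) (hab : 2 * h ≤ b - a) (hx : x ∈ Icc a b) (l : ℕ) (y : ℝ) :
    legendreKernel a b h l x ((y - x) / h) =
      if |y - windowCenter a b h x| ≤ windowRadius a b h x then
        shiftScale a b h x * ∑ j ∈ Finset.range (l + 1), legendre j (shiftCenter a b h x) *
          legendre j ((y - windowCenter a b h x) / windowRadius a b h x)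
      else 0 := by
  classical
  unfold legendreKernel
  rw [if_congr ((windowRadius_windowCenter hh hab hx).2.2 y) rfl rfl]
  have hr := (windowRadius_pos hh hx).ne'
  have hs := shiftScale_mul_windowRadius hh hx
  have : shiftScale a b h x * ((y - x) / h) + shiftCenter a b h x =
      (y - windowCenter a b h x) / windowRadius a b h x := by
    rw [eq_div_iff hr, windowCenter]
    have : shiftScale a b h x * ((y - x) / h) * windowRadius a b h x = y - x := by
      rw [mul_right_comm, hs]; field_simp
    linear_combination this
  rw [this]

theorem setIntegral_window (hh : 0 < h) (hab : 2 * h ≤ b - a) (hx : x ∈ Icc a b) (G : ℝ → ℝ) :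
    ∫ y in Icc a b, (if |y - windowCenter a b h x| ≤ windowRadius a b h x then G y else 0) =
      windowRadius a b h x * ∫ z in (-1 : ℝ)..1,
        G (windowCenter a b h x + windowRadius a b h x * z) := by
  have hr := windowRadius_pos hh hx
  obtain ⟨h1, h2, -⟩ := windowRadius_windowCenter hh hab hx
  set m := windowCenter a b h x
  set r := windowRadius a b h x
  have hi : (fun y => if |y - m| ≤ r then G y else 0) = (Icc (m - r) (m + r)).indicator G := by
    ext y
    rw [indicator_apply]
    refine if_congr ?_ rfl rfl
    rw [abs_le, mem_Icc]
    constructor <;> rintro ⟨h3, h4⟩ <;> constructor <;> linarith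
  rw [hi, setIntegral_indicator measurableSet_Icc, inter_eq_right.mpr (Icc_subset_Icc h1 h2),
    integral_Icc_eq_integral_Ioc, ← intervalIntegral.integral_of_le (by linarith),
    intervalIntegral.mul_integral_comp_add_mul]
  congr 1 <;> ring

theorem setIntegral_legendreKernel_mul (hh : 0 < h) (hab : 2 * h ≤ b - a) (hx : x ∈ Icc a b)
    (l : ℕ) (v : ℝ → ℝ) :
    ∫ y in Icc a b, legendreKernel a b h l x ((y - x) / h) * v y =
      h * ∫ z in (-1 : ℝ)..1, (∑ j ∈ Finset.range (l + 1), legendre j (shiftCenter a b h x) *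
          legendre j z) * v (windowCenter a b h x + windowRadius a b h x * z) := by
  simp_rw [legendreKernel_eq hh hab hx, ite_mul, zero_mul]
  rw [setIntegral_window hh hab hx]
  have hr := (windowRadius_pos hh hx).ne'
  simp_rw [add_sub_cancel_left, mul_div_cancel_left₀ _ hr, mul_assoc]
  rw [intervalIntegral.integral_const_mul, ← mul_assoc, mul_comm (windowRadius a b h x),
    shiftScale_mul_windowRadius hh hx]

/-- Parseval in the second variable. The factor is `r γ² = h γ ≤ 2 h` for the radius `r` and the
scale `γ ≤ 2`. -/
theorem setIntegral_legendreKernel_sq_le (hh : 0 < h) (hab : 2 * h ≤ b - a) (hx : x ∈ Icc a b)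
    (l : ℕ) :
    ∫ y in Icc a b, legendreKernel a b h l x ((y - x) / h) ^ 2 ≤
      2 * h * ∑ j ∈ Finset.range (l + 1), legendre j (shiftCenter a b h x) ^ 2 := by
  simp_rw [legendreKernel_eq hh hab hx, ite_pow, zero_pow two_ne_zero]
  rw [setIntegral_window hh hab hx]
  have hr := (windowRadius_pos hh hx).ne'
  simp_rw [add_sub_cancel_left, mul_div_cancel_left₀ _ hr, mul_pow]
  rw [intervalIntegral.integral_const_mul, integral_sum_legendre_sq, ← mul_assoc]
  refine mul_le_mul_of_nonneg_right ?_ (Finset.sum_nonneg fun j _ => sq_nonneg _)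
  calc windowRadius a b h x * shiftScale a b h x ^ 2
      = (shiftScale a b h x * windowRadius a b h x) * shiftScale a b h x := by ring
    _ = h * shiftScale a b h x := by rw [shiftScale_mul_windowRadius hh hx]
    _ ≤ h * 2 := by gcongr; exact (shiftScale_mem hh hx).2
    _ = 2 * h := by ring

@[fun_prop]
theorem measurable_shiftScale (a b h : ℝ) : Measurable (shiftScale a b h) := by
  unfold shiftScale
  refine Measurable.ite measurableSet_Iio (by fun_prop) (Measurable.ite measurableSet_Iic ?_ ?_)
  · fun_prop
  · fun_prop

@[fun_prop]
theorem measurable_shiftCenter (a b h : ℝ) : Measurable (shiftCenter a b h) := by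
  unfold shiftCenter
  refine Measurable.ite measurableSet_Iio (by fun_prop) (Measurable.ite measurableSet_Iic ?_ ?_)
  · fun_prop
  · fun_prop

@[fun_prop]
theorem measurable_legendreKernel (a b h : ℝ) (l : ℕ) :
    Measurable fun p : ℝ × ℝ => legendreKernel a b h l p.1 p.2 := by
  unfold legendreKernel
  refine Measurable.ite ?_ ?_ measurable_const
  · have h1 : Measurable fun p : ℝ × ℝ => -min 1 ((p.1 - a) / h) := by fun_prop
    have h2 : Measurable fun p : ℝ × ℝ => min 1 ((b - p.1) / h) := by fun_prop
    exact (measurableSet_le h1 measurable_snd).inter (measurableSet_le measurable_snd h2)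
  · refine Measurable.mul (by fun_prop) (Finset.measurable_sum _ fun j _ => ?_)
    exact ((continuous_legendre j).measurable.comp (by fun_prop)).mul
      ((continuous_legendre j).measurable.comp (by fun_prop))

theorem exists_abs_legendre_le (j : ℕ) : ∃ B, ∀ z ∈ Icc (-1 : ℝ) 1, |legendre j z| ≤ B := by
  obtain ⟨B, hB⟩ := isCompact_Icc.exists_bound_of_continuousOn
    (continuous_legendre j).continuousOn (s := Icc (-1 : ℝ) 1)
  exact ⟨B, hB⟩

theorem integrableOn_legendre_shiftCenter (hh : 0 < h) (a b : ℝ) (j : ℕ) :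
    IntegrableOn (fun x => legendre j (shiftCenter a b h x)) (Icc a b) := by
  obtain ⟨B, hB⟩ := exists_abs_legendre_le j
  refine Measure.integrableOn_of_bounded (M := B) (by simp)
    ((continuous_legendre j).measurable.comp (by fun_prop)).aestronglyMeasurable ?_
  filter_upwards [ae_restrict_mem measurableSet_Icc] with x hx
  exact hB _ (shiftCenter_mem hh hx)

theorem integrableOn_legendre_shiftCenter_sq (hh : 0 < h) (a b : ℝ) (j : ℕ) :
    IntegrableOn (fun x => legendre j (shiftCenter a b h x) ^ 2) (Icc a b) := by
  obtain ⟨B, hB⟩ := exists_abs_legendre_le j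
  refine Measure.integrableOn_of_bounded (M := B ^ 2) (by simp)
    (((continuous_legendre j).measurable.comp (by fun_prop)).pow_const 2).aestronglyMeasurable ?_
  filter_upwards [ae_restrict_mem measurableSet_Icc] with x hx
  rw [Real.norm_eq_abs, abs_pow]
  have := hB _ (shiftCenter_mem hh hx)
  gcongr

/-- A substitution bound: if `ζ` maps `[c, d]` to `[-1, 1]` with slope at least `1 / (2 h)`, then
`∫ F ∘ ζ ≤ 2 h ∫ F`. -/
theorem integral_comp_le_of_le_deriv {F ζ ζ' : ℝ → ℝ} {c d : ℝ} (hh : 0 < h) (hcd : c ≤ d)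
    (hF : Continuous F) (hF0 : ∀ z, 0 ≤ F z) (hζ : ∀ x ∈ Icc c d, HasDerivAt ζ (ζ' x) x)
    (hζ' : ContinuousOn ζ' (Icc c d)) (hlow : ∀ x ∈ Icc c d, 1 ≤ 2 * h * ζ' x)
    (hc : -1 ≤ ζ c) (hd : ζ d ≤ 1) (hcd' : ζ c ≤ ζ d) :
    ∫ x in c..d, F (ζ x) ≤ 2 * h * ∫ z in (-1 : ℝ)..1, F z := by
  have hcont : ContinuousOn ζ (Icc c d) := fun x hx => (hζ x hx).continuousAt.continuousWithinAt
  have hFζ : ContinuousOn (fun x => F (ζ x)) (Icc c d) := hF.comp_continuousOn hcont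
  rw [← uIcc_of_le hcd] at hζ' hcont hFζ
  calc ∫ x in c..d, F (ζ x)
      ≤ ∫ x in c..d, 2 * h * (F (ζ x) * ζ' x) := by
        refine intervalIntegral.integral_mono_on hcd hFζ.intervalIntegrable
          (continuousOn_const.mul (hFζ.mul hζ')).intervalIntegrable fun x hx => ?_
        have := mul_le_mul_of_nonneg_left (hlow x hx) (hF0 (ζ x))
        linarith
    _ = 2 * h * ∫ z in ζ c..ζ d, F z := by
        rw [intervalIntegral.integral_const_mul]
        congr 1
        exact intervalIntegral.integral_comp_mul_deriv
          (fun x hx => hζ x (by rwa [uIcc_of_le hcd] at hx)) hζ' hF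
    _ ≤ 2 * h * ∫ z in (-1 : ℝ)..1, F z := by
        gcongr
        exact intervalIntegral.integral_mono_interval hc hcd' hd
          (Filter.Eventually.of_forall hF0) (hF.intervalIntegrable _ _)

/-- Within `h` of an end, the shift sweeps half of `[-1,1]` with slope at least `1 / (2h)`, so each
end contributes at most `2h` times the unit norm of the polynomial. In between the shift is 0. The
bound is uniform in `j`, although the integrand equals `(2j+1)/2` at the ends. -/
theorem setIntegral_legendre_shiftCenter_sq_le (hh : 0 < h) (hab : 2 * h ≤ b - a) (j : ℕ) :
    ∫ x in Icc a b, legendre j (shiftCenter a b h x) ^ 2 ≤ 3 * (b - a) := by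
  have hint := integrableOn_legendre_shiftCenter_sq hh a b j
  have hii : ∀ c d, a ≤ c → c ≤ d → d ≤ b → IntervalIntegrable
      (fun x => legendre j (shiftCenter a b h x) ^ 2) volume c d := fun c d h1 h2 h3 => by
    rw [intervalIntegrable_iff_integrableOn_Icc_of_le h2]
    exact hint.mono_set (Icc_subset_Icc h1 h3)
  have hF : Continuous fun z => legendre j z ^ 2 := by fun_prop
  have hF1 : ∫ z in (-1 : ℝ)..1, legendre j z ^ 2 = 1 := by
    simp_rw [sq]; exact integral_legendre_sq j
  have left : ∫ x in a..(a + h), legendre j (shiftCenter a b h x) ^ 2 ≤ 2 * h := by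
    have h1 := integral_comp_le_of_le_deriv (F := fun z => legendre j z ^ 2)
      (ζ := fun x => -((h - (x - a)) / (h + x - a)))
      (ζ' := fun x => 2 * h / (h + x - a) ^ 2) (c := a) (d := a + h) hh (by linarith) hF
      (fun z => sq_nonneg _)
      (fun x hx => by
        have hne : h + x - a ≠ 0 := by linarith [hx.1]
        have h2 : HasDerivAt (fun x => h - (x - a)) (-1) x := by
          simpa using ((hasDerivAt_id x).sub_const a).const_sub h
        have h3 : HasDerivAt (fun x => h + x - a) 1 x := by
          simpa using ((hasDerivAt_id x).const_add h).sub_const a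
        refine (h2.fun_div h3 hne).fun_neg.congr_deriv ?_
        field_simp
        ring)
      (by
        refine continuousOn_const.div (by fun_prop) fun x hx => ?_
        have hne : h + x - a ≠ 0 := by linarith [hx.1]
        positivity)
      (fun x hx => by
        have h1 : 0 < h + x - a := by linarith [hx.1]
        have h2 : h + x - a ≤ 2 * h := by linarith [hx.2]
        rw [← mul_div_assoc, le_div_iff₀ (by positivity)]
        nlinarith)
      (by simp [hh.ne']) (by simp) (by simp [hh.ne'])
    rw [hF1, mul_one] at h1
    refine le_of_eq_of_le (intervalIntegral.integral_congr fun x hx => ?_) h1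
    rw [uIcc_of_le (by linarith)] at hx
    simp only [shiftCenter]
    split_ifs with h2 h3
    · rfl
    -- Only the junction `x = a + h` is left, where both branches of the shift give 0.
    · rw [show h - (x - a) = 0 by linarith [hx.2]]; simp
    · exact absurd hx.2 (by linarith)
  have right : ∫ x in (b - h)..b, legendre j (shiftCenter a b h x) ^ 2 ≤ 2 * h := by
    have h1 := integral_comp_le_of_le_deriv (F := fun z => legendre j z ^ 2)
      (ζ := fun x => (h - (b - x)) / (h + b - x))
      (ζ' := fun x => 2 * h / (h + b - x) ^ 2) (c := b - h) (d := b) hh (by linarith) hF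
      (fun z => sq_nonneg _)
      (fun x hx => by
        have hne : h + b - x ≠ 0 := by linarith [hx.2]
        have h2 : HasDerivAt (fun x => h - (b - x)) 1 x := by
          simpa using ((hasDerivAt_id x).const_sub b).const_sub h
        have h3 : HasDerivAt (fun x => h + b - x) (-1) x := by
          simpa using ((hasDerivAt_id x).const_sub (h + b))
        refine (h2.fun_div h3 hne).congr_deriv ?_
        field_simp
        ring)
      (by
        refine continuousOn_const.div (by fun_prop) fun x hx => ?_
        have hne : h + b - x ≠ 0 := by linarith [hx.2]
        positivity)
      (fun x hx => by
        have h1 : 0 < h + b - x := by linarith [hx.2]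
        have h2 : h + b - x ≤ 2 * h := by linarith [hx.1]
        rw [← mul_div_assoc, le_div_iff₀ (by positivity)]
        nlinarith)
      (by simp) (by simp [hh.ne']) (by simp [hh.ne'])
    rw [hF1, mul_one] at h1
    refine le_of_eq_of_le (intervalIntegral.integral_congr fun x hx => ?_) h1
    rw [uIcc_of_le (by linarith)] at hx
    simp only [shiftCenter]
    split_ifs with h2 h3
    · exact absurd hx.1 (by linarith)
    · rw [show h - (b - x) = 0 by linarith [hx.1]]; simp
    · rfl
  have mid : ∫ x in (a + h)..(b - h), legendre j (shiftCenter a b h x) ^ 2 ≤ b - a - 2 * h := by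
    have : ∫ x in (a + h)..(b - h), legendre j (shiftCenter a b h x) ^ 2 =
        ∫ x in (a + h)..(b - h), legendre j 0 ^ 2 := by
      refine intervalIntegral.integral_congr fun x hx => ?_
      rw [uIcc_of_le (by linarith)] at hx
      simp only [shiftCenter]
      rw [if_neg (not_lt.mpr hx.1), if_pos hx.2]
    rw [this, intervalIntegral.integral_const, smul_eq_mul]
    have := mul_le_mul_of_nonneg_left (legendre_zero_sq_le_one j)
      (show 0 ≤ b - h - (a + h) by linarith)
    linarith
  rw [integral_Icc_eq_integral_Ioc, ← intervalIntegral.integral_of_le (by linarith),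
    ← intervalIntegral.integral_add_adjacent_intervals
      (hii a (a + h) le_rfl (by linarith) (by linarith))
      (hii (a + h) b (by linarith) (by linarith) le_rfl),
    ← intervalIntegral.integral_add_adjacent_intervals
      (hii (a + h) (b - h) (by linarith) (by linarith) (by linarith))
      (hii (b - h) b (by linarith) (by linarith) le_rfl)]
  linarith

/-- From the quadratic bound by `|t| ≤ (t² + 1) / 2`. -/
theorem setIntegral_abs_legendre_shiftCenter_le (hh : 0 < h) (hab : 2 * h ≤ b - a) (j : ℕ) :
    ∫ x in Icc a b, |legendre j (shiftCenter a b h x)| ≤ 2 * (b - a) := by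
  have h1 := setIntegral_legendre_shiftCenter_sq_le hh hab j
  have h2 : ∫ x in Icc a b, |legendre j (shiftCenter a b h x)| ≤
      ∫ x in Icc a b, (1 / 2 * legendre j (shiftCenter a b h x) ^ 2 + 1 / 2) := by
    refine integral_mono (integrableOn_legendre_shiftCenter hh a b j).abs
      (((integrableOn_legendre_shiftCenter_sq hh a b j).const_mul _).add (by simp)) fun x => ?_
    have := sq_nonneg (|legendre j (shiftCenter a b h x)| - 1)
    rw [sub_sq, sq_abs] at this
    simp only
    linarith
  rw [integral_add ((integrableOn_legendre_shiftCenter_sq hh a b j).const_mul _) (by simp),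
    integral_const_mul] at h2
  simp only [integral_const, smul_eq_mul, MeasurableSet.univ, measureReal_restrict_apply,
    univ_inter, Real.volume_real_Icc_of_le (show a ≤ b by linarith)] at h2
  linarith

end Window

end ContAssort

/-! ### Error of Legendre projection, and Taylor expansion. -/

namespace ContAssort

open MeasureTheory Set Polynomial

/-- The error at `ζ` of the Legendre projection of order `l` of the function `g` on `[-1,1]`. -/
noncomputable def projErr (l : ℕ) (ζ : ℝ) (g : ℝ → ℝ) : ℝ :=
  (∫ z in (-1 : ℝ)..1, (∑ j ∈ Finset.range (l + 1), legendre j ζ * legendre j z) * g z) - g ζ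

theorem integral_legendre_sum_mul_pow {k : ℕ} {α : ℕ → ℝ}
    (hα : ∀ x : ℝ, x ^ k = ∑ j ∈ Finset.range (k + 1), α j * legendre j x) (l : ℕ) (ζ : ℝ) :
    ∫ z in (-1 : ℝ)..1, (∑ j ∈ Finset.range (l + 1), legendre j ζ * legendre j z) * z ^ k =
      ∑ j ∈ Finset.range (l + 1), if j < k + 1 then α j * legendre j ζ else 0 := by
  simp_rw [Finset.sum_mul, mul_assoc]
  rw [intervalIntegral.integral_finsetSum
    (fun i _ => Continuous.intervalIntegrable (by fun_prop) _ _)]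
  refine Finset.sum_congr rfl fun j _ => ?_
  rw [intervalIntegral.integral_const_mul]
  simp_rw [hα, mul_comm (legendre j _) (∑ _ ∈ _, _)]
  rw [integral_sum_legendre_mul_legendre]
  split_ifs
  · ring
  · simp

/-- Projection truncates the finite Legendre expansion of `z^k`, so only the orders from `l + 1` to
`k` survive, and none if `k ≤ l`. By Parseval each coefficient is at most the `L²` norm of `z^k`. -/
theorem abs_projErr_pow_le (l k : ℕ) (ζ : ℝ) :
    |projErr l ζ (fun z => z ^ k)| ≤
      Real.sqrt (2 / (2 * k + 1)) * ∑ j ∈ Finset.Ico (l + 1) (k + 1), |legendre j ζ| := by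
  obtain ⟨α, hα⟩ := exists_eval_eq_sum_legendre k (X ^ k) (natDegree_X_pow_le k)
  simp only [eval_pow, eval_X] at hα
  have hsq : ∑ i ∈ Finset.range (k + 1), α i ^ 2 = 2 / (2 * k + 1) := by
    rw [← integral_sum_legendre_sq, ← integral_pow_two_mul]
    simp_rw [hα]
  have hαj : ∀ j ∈ Finset.range (k + 1), |α j| ≤ Real.sqrt (2 / (2 * k + 1)) := fun j hj => by
    rw [← Real.sqrt_sq_eq_abs, ← hsq]
    exact Real.sqrt_le_sqrt
      (Finset.single_le_sum (f := fun i => α i ^ 2) (fun i _ => sq_nonneg _) hj)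
  have hkey : projErr l ζ (fun z => z ^ k) =
      -∑ j ∈ Finset.Ico (l + 1) (k + 1), α j * legendre j ζ := by
    rw [projErr, integral_legendre_sum_mul_pow hα, hα ζ]
    rcases le_total l k with h | h
    · rw [Finset.sum_Ico_eq_sub _ (by omega), neg_sub]
      congr 1
      refine Finset.sum_congr rfl fun j hj => if_pos ?_
      have := Finset.mem_range.mp hj
      omega
    · rw [Finset.Ico_eq_empty_of_le (by omega), Finset.sum_empty, neg_zero, sub_eq_zero,
        ← Finset.sum_filter]
      refine Finset.sum_congr ?_ fun _ _ => rfl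
      ext j
      simp only [Finset.mem_filter, Finset.mem_range]
      omega
  rw [hkey, abs_neg, Finset.mul_sum]
  refine (Finset.abs_sum_le_sum_abs _ _).trans (Finset.sum_le_sum fun j hj => ?_)
  rw [abs_mul]
  gcongr
  exact hαj j (Finset.mem_range.mpr (Finset.mem_Ico.mp hj).2)

theorem integral_abs_legendre_le (j : ℕ) : ∫ z in (-1 : ℝ)..1, |legendre j z| ≤ 2 := by
  have hc : Continuous (legendre j) := by fun_prop
  calc ∫ z in (-1 : ℝ)..1, |legendre j z|
      ≤ ∫ z in (-1 : ℝ)..1, (1 / 2 * (legendre j z * legendre j z) + 1 / 2) := by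
        refine intervalIntegral.integral_mono_on (by norm_num)
          (hc.abs.intervalIntegrable _ _) (Continuous.intervalIntegrable (by fun_prop) _ _)
          fun z _ => ?_
        have := sq_nonneg (|legendre j z| - 1)
        rw [sub_sq, sq_abs] at this
        linarith
    _ = 3 / 2 := by
        rw [intervalIntegral.integral_add (Continuous.intervalIntegrable (by fun_prop) _ _)
          (by simp), intervalIntegral.integral_const_mul, integral_legendre_sq]
        norm_num
    _ ≤ 2 := by norm_num

/-- A crude operator bound that grows with `l`. It is harmless because it is applied to Taylor
remainders, which tend to 0 for fixed `l`. -/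
theorem abs_projErr_le {g : ℝ → ℝ} {ε : ℝ} (l : ℕ) {ζ : ℝ} (hε : 0 ≤ ε)
    (hg : ∀ z ∈ Ioo (-1 : ℝ) 1, |g z| ≤ ε) (hζ : |g ζ| ≤ ε) :
    |projErr l ζ g| ≤ ε * (1 + 2 * ∑ j ∈ Finset.range (l + 1), |legendre j ζ|) := by
  have h1 : |∫ z in (-1 : ℝ)..1,
      (∑ j ∈ Finset.range (l + 1), legendre j ζ * legendre j z) * g z| ≤
      ∫ z in (-1 : ℝ)..1, ε * ∑ j ∈ Finset.range (l + 1), |legendre j ζ| * |legendre j z| := by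
    rw [← Real.norm_eq_abs]
    refine intervalIntegral.norm_integral_le_of_norm_le (by norm_num) ?_
      (Continuous.intervalIntegrable (by fun_prop) _ _)
    -- The interval integral lives on `(-1, 1]`, and the bound on `g` excludes the end point:
    -- windows may touch 0 or 1, where nothing is assumed about derivatives of `v`.
    filter_upwards [compl_mem_ae_iff.mpr (measure_singleton (μ := volume) (1 : ℝ))] with z hz1 hz
    have hz' : z ∈ Ioo (-1 : ℝ) 1 := ⟨hz.1, lt_of_le_of_ne hz.2 hz1⟩
    rw [norm_mul, mul_comm ε]
    refine mul_le_mul ?_ (hg z hz') (norm_nonneg _) (Finset.sum_nonneg fun j _ => by positivity)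
    refine (norm_sum_le _ _).trans_eq (Finset.sum_congr rfl fun j _ => ?_)
    rw [norm_mul, Real.norm_eq_abs, Real.norm_eq_abs]
  rw [intervalIntegral.integral_const_mul, intervalIntegral.integral_finsetSum
    (fun i _ => Continuous.intervalIntegrable (by fun_prop) _ _)] at h1
  simp_rw [intervalIntegral.integral_const_mul] at h1
  calc |projErr l ζ g| ≤ _ + |g ζ| := abs_sub _ _
    _ ≤ ε * ∑ j ∈ Finset.range (l + 1), |legendre j ζ| * 2 + ε := by
        refine add_le_add (h1.trans ?_) hζ
        gcongr
        exact integral_abs_legendre_le _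
    _ = _ := by rw [← Finset.sum_mul]; ring

/-- The projection error of a function that is close to a polynomial. -/
theorem abs_projErr_le_of_taylor {f : ℝ → ℝ} {c : ℕ → ℝ} {D : ℕ} {ε : ℝ} (l : ℕ) {ζ : ℝ}
    (hε : 0 ≤ ε) (hf : IntervalIntegrable f volume (-1) 1)
    (hfc : ∀ z ∈ Ioo (-1 : ℝ) 1, |f z - ∑ k ∈ Finset.range (D + 1), c k * z ^ k| ≤ ε)
    (hζ : |f ζ - ∑ k ∈ Finset.range (D + 1), c k * ζ ^ k| ≤ ε) :
    |projErr l ζ f| ≤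
      ∑ k ∈ Finset.range (D + 1), |c k| * (Real.sqrt (2 / (2 * k + 1)) *
        ∑ j ∈ Finset.Ico (l + 1) (k + 1), |legendre j ζ|) +
      ε * (1 + 2 * ∑ j ∈ Finset.range (l + 1), |legendre j ζ|) := by
  set p : ℝ → ℝ := fun z => ∑ k ∈ Finset.range (D + 1), c k * z ^ k
  set Φ : ℝ → ℝ := fun z => ∑ j ∈ Finset.range (l + 1), legendre j ζ * legendre j z
  have hΦ : Continuous Φ := by fun_prop
  have hp : Continuous p := by fun_prop
  have hsplit : projErr l ζ f =
      ∑ k ∈ Finset.range (D + 1), c k * projErr l ζ (fun z => z ^ k) +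
        projErr l ζ (fun z => f z - p z) := by
    have h1 : ∫ z in (-1 : ℝ)..1, Φ z * (f z - p z) =
        (∫ z in (-1 : ℝ)..1, Φ z * f z) - ∫ z in (-1 : ℝ)..1, Φ z * p z := by
      simp_rw [mul_sub]
      exact intervalIntegral.integral_sub (hf.continuousOn_mul hΦ.continuousOn)
        ((hΦ.mul hp).intervalIntegrable _ _)
    have h2 : ∫ z in (-1 : ℝ)..1, Φ z * p z =
        ∑ k ∈ Finset.range (D + 1), c k * ∫ z in (-1 : ℝ)..1, Φ z * z ^ k := by
      simp_rw [p, Finset.mul_sum, mul_left_comm (Φ _)]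
      rw [intervalIntegral.integral_finsetSum
        (fun i _ => Continuous.intervalIntegrable (by fun_prop) _ _)]
      simp_rw [intervalIntegral.integral_const_mul]
    simp only [projErr, mul_sub, Finset.sum_sub_distrib]
    change (∫ z in (-1 : ℝ)..1, Φ z * f z) - f ζ = _ - p ζ +
      ((∫ z in (-1 : ℝ)..1, Φ z * f z - Φ z * p z) - _)
    simp_rw [← mul_sub]
    rw [h1, h2]
    ring
  rw [hsplit]
  refine (abs_add_le _ _).trans (add_le_add ?_ (abs_projErr_le l hε hfc hζ))
  refine (Finset.abs_sum_le_sum_abs _ _).trans (Finset.sum_le_sum fun k _ => ?_)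
  rw [abs_mul]
  gcongr
  exact abs_projErr_pow_le l k ζ

/-- Lagrange remainder. Strong smoothness divides by `(ℓ + 1)!` instead of `ℓ!`, which produces the
factor `D + 2`. -/
theorem abs_sub_taylor_le {v : ℝ → ℝ} (hv : ContDiffOn ℝ (⊤ : ℕ∞) v (Ioo 0 1)) {C : ℝ}
    (hC : ∀ y ∈ Ioo (0 : ℝ) 1, ∀ l : ℕ, 1 ≤ l →
      |iteratedDeriv l v y / (Nat.factorial (l + 1) : ℝ)| < C)
    {m y : ℝ} (hm : m ∈ Ioo (0 : ℝ) 1) (hy : y ∈ Ioo (0 : ℝ) 1) (D : ℕ) :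
    |v y - ∑ k ∈ Finset.range (D + 1), iteratedDeriv k v m / k.factorial * (y - m) ^ k| ≤
      C * (D + 2) * |y - m| ^ (D + 1) := by
  have hat : ∀ u ∈ Ioo (0 : ℝ) 1, ∀ n : ℕ, ContDiffAt ℝ n v u := fun u hu n =>
    (hv.contDiffAt (Ioo_mem_nhds hu.1 hu.2)).of_le (by exact_mod_cast le_top)
  -- The Lagrange form, and the identification of derivatives within the segment with ordinary ones,
  -- need distinct points.
  rcases eq_or_ne m y with rfl | hne
  · rw [Finset.sum_range_succ']
    simp
  have hsub : uIcc m y ⊆ Ioo 0 1 := (ordConnected_Ioo).uIcc_subset hm hy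
  obtain ⟨t, ht, he⟩ := taylor_mean_remainder_lagrange_iteratedDeriv (f := v) (n := D) hne
    (fun u hu => by exact_mod_cast (hat u (hsub hu) (D + 1)).contDiffWithinAt)
  have hsum : taylorWithinEval v D (uIcc m y) m y =
      ∑ k ∈ Finset.range (D + 1), iteratedDeriv k v m / k.factorial * (y - m) ^ k := by
    rw [taylor_within_apply]
    refine Finset.sum_congr rfl fun k _ => ?_
    rw [iteratedDerivWithin_eq_iteratedDeriv (uniqueDiffOn_uIcc hne) (hat m hm k) left_mem_uIcc,
      smul_eq_mul]
    ring
  rw [← hsum, he]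
  have h1 := (hC t (hsub (uIoo_subset_uIcc_self ht)) (D + 1) (by omega)).le
  rw [abs_div, Nat.abs_cast, div_le_iff₀ (by positivity), Nat.factorial_succ] at h1
  rw [abs_div, abs_mul, abs_pow, Nat.abs_cast, div_le_iff₀ (by positivity)]
  push_cast at h1
  calc |iteratedDeriv (D + 1) v t| * |y - m| ^ (D + 1)
      ≤ (C * ((D + 1 + 1) * (D + 1).factorial)) * |y - m| ^ (D + 1) := by gcongr
    _ = _ := by ring

end ContAssort

/-! ### Integrated bias of the kernel. -/

namespace ContAssort

open MeasureTheory Set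

section Bias

variable {a b h : ℝ}

/-- The bias at `x` of the Legendre kernel smoothing of `v`. -/
noncomputable def kernelBias (a b h : ℝ) (l : ℕ) (v : ℝ → ℝ) (x : ℝ) : ℝ :=
  projErr l (shiftCenter a b h x)
    (fun z => v (windowCenter a b h x + windowRadius a b h x * z))

theorem setIntegral_legendreKernel_mul_eq (hh : 0 < h) (hab : 2 * h ≤ b - a) {x : ℝ}
    (hx : x ∈ Icc a b) (l : ℕ) (v : ℝ → ℝ) :
    ∫ y in Icc a b, legendreKernel a b h l x ((y - x) / h) * v y =
      h * (v x + kernelBias a b h l v x) := by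
  rw [setIntegral_legendreKernel_mul hh hab hx, kernelBias, projErr, windowCenter_add]
  ring

theorem window_mem_Ioo (hh : 0 < h) (hab : 2 * h ≤ b - a) (ha : 0 ≤ a) (hb : b ≤ 1) {x : ℝ}
    (hx : x ∈ Icc a b) {z : ℝ} (hz : z ∈ Ioo (-1 : ℝ) 1) :
    windowCenter a b h x + windowRadius a b h x * z ∈ Ioo (0 : ℝ) 1 := by
  have hr := windowRadius_pos hh hx
  obtain ⟨h1, h2, -⟩ := windowRadius_windowCenter hh hab hx
  constructor
  · nlinarith [hz.1]
  · nlinarith [hz.2]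

theorem intervalIntegrable_window (hh : 0 < h) (hab : 2 * h ≤ b - a) (ha : 0 ≤ a) (hb : b ≤ 1)
    {v : ℝ → ℝ} (hv : ContinuousOn v (Ioo 0 1)) {B : ℝ} (hB : ∀ y ∈ Ioo (0 : ℝ) 1, |v y| ≤ B)
    {x : ℝ} (hx : x ∈ Icc a b) :
    IntervalIntegrable (fun z => v (windowCenter a b h x + windowRadius a b h x * z))
      volume (-1) 1 := by
  rw [intervalIntegrable_iff_integrableOn_Ioo_of_le (by norm_num : (-1 : ℝ) ≤ 1)]
  refine Integrable.of_bound ?_ B ?_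
  · have hc : ContinuousOn (fun z => v (windowCenter a b h x + windowRadius a b h x * z))
        (Ioo (-1) 1) :=
      hv.comp (by fun_prop) fun z hz => window_mem_Ioo hh hab ha hb hx hz
    exact hc.aestronglyMeasurable measurableSet_Ioo
  · filter_upwards [ae_restrict_mem measurableSet_Ioo] with z hz
    exact hB _ (window_mem_Ioo hh hab ha hb hx hz)

/-- Taylor expansion about the window centre. In the window coordinate the `k`-th coefficient picks
up the `k`-th power of the radius, which is at most `h^k`. The degree `D` is independent of the
kernel order `l`. -/
theorem abs_kernelBias_le (hh : 0 < h) (hab : 2 * h ≤ b - a) (ha : 0 ≤ a) (hb : b ≤ 1)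
    {v : ℝ → ℝ} (hv : ContDiffOn ℝ (⊤ : ℕ∞) v (Ioo 0 1)) {C : ℝ} (hC0 : 0 < C)
    (hC : ∀ y ∈ Ioo (0 : ℝ) 1, ∀ l : ℕ, 1 ≤ l →
      |iteratedDeriv l v y / (Nat.factorial (l + 1) : ℝ)| < C)
    {B : ℝ} (hB : ∀ y ∈ Ioo (0 : ℝ) 1, |v y| ≤ B) (l D : ℕ) {x : ℝ} (hx : x ∈ Ioo a b) :
    |kernelBias a b h l v x| ≤
      ∑ k ∈ Finset.range (D + 1), C * (k + 1) * h ^ k * (Real.sqrt (2 / (2 * k + 1)) *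
        ∑ j ∈ Finset.Ico (l + 1) (k + 1), |legendre j (shiftCenter a b h x)|) +
      C * (D + 2) * h ^ (D + 1) *
        (1 + 2 * ∑ j ∈ Finset.range (l + 1), |legendre j (shiftCenter a b h x)|) := by
  have hx' := Ioo_subset_Icc_self hx
  have hr := windowRadius_pos hh hx'
  have hrh := windowRadius_le hh hx'
  have hx01 : x ∈ Ioo (0 : ℝ) 1 := Ioo_subset_Ioo ha hb hx
  set m := windowCenter a b h x
  set r := windowRadius a b h x
  set ζ := shiftCenter a b h x
  have hζ := shiftCenter_mem hh hx'
  have hm : m ∈ Ioo (0 : ℝ) 1 := by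
    simpa using window_mem_Ioo hh hab ha hb hx' (z := 0) (by norm_num)
  have hmζ : m + r * ζ = x := windowCenter_add a b h x
  have htaylor : ∀ z, |z| ≤ 1 → m + r * z ∈ Ioo (0 : ℝ) 1 →
      |v (m + r * z) - ∑ k ∈ Finset.range (D + 1),
        iteratedDeriv k v m / k.factorial * r ^ k * z ^ k| ≤ C * (D + 2) * h ^ (D + 1) := by
    intro z hz hmem
    have h1 := abs_sub_taylor_le hv hC hm hmem D
    simp_rw [add_sub_cancel_left, mul_pow, ← mul_assoc] at h1
    refine h1.trans ?_
    gcongr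
    rw [abs_mul, abs_of_pos hr]
    nlinarith [abs_nonneg z]
  refine (abs_projErr_le_of_taylor (D := D) (c := fun k => iteratedDeriv k v m / k.factorial * r ^ k)
    l (by positivity : 0 ≤ C * (D + 2) * h ^ (D + 1))
    (intervalIntegrable_window hh hab ha hb hv.continuousOn hB hx')
    (fun z hz => htaylor z (abs_le.mpr ⟨hz.1.le, hz.2.le⟩) (window_mem_Ioo hh hab ha hb hx' hz))
    (htaylor ζ (abs_le.mpr hζ) (by rwa [hmζ]))).trans ?_
  refine add_le_add_left (Finset.sum_le_sum fun k _ => ?_) _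
  -- Strong smoothness says nothing about order 0, but constants are reproduced exactly: the sum
  -- over `j` is empty.
  rcases Nat.eq_zero_or_pos k with rfl | hk
  · simp
  refine mul_le_mul_of_nonneg_right ?_ (mul_nonneg (Real.sqrt_nonneg _)
    (Finset.sum_nonneg fun _ _ => abs_nonneg _))
  have h1 := (hC m hm k hk).le
  rw [abs_div, Nat.abs_cast, div_le_iff₀ (by positivity), Nat.factorial_succ] at h1
  push_cast at h1
  rw [abs_mul, abs_div, abs_pow, Nat.abs_cast, abs_of_pos hr]
  gcongr
  rw [div_le_iff₀ (by positivity)]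
  linarith

theorem summable_add_one_sq_mul_exp : Summable fun i : ℕ => ((i : ℝ) + 1) ^ 2 * Real.exp (-1) ^ i := by
  have hr : ‖Real.exp (-1)‖ < 1 := by
    rw [Real.norm_eq_abs, abs_of_pos (Real.exp_pos _)]; exact Real.exp_lt_one_iff.mpr (by norm_num)
  have h2 := summable_pow_mul_geometric_of_norm_lt_one 2 hr
  have h1 := summable_pow_mul_geometric_of_norm_lt_one 1 hr
  have h0 := summable_pow_mul_geometric_of_norm_lt_one 0 hr
  refine ((h2.add (h1.mul_left 2)).add h0).congr fun i => ?_
  ring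

/-- The constant `∑ (i + 1)² e^{-i}`. -/
noncomputable def expSeries : ℝ := ∑' i : ℕ, ((i : ℝ) + 1) ^ 2 * Real.exp (-1) ^ i

theorem expSeries_pos : 0 < expSeries :=
  summable_add_one_sq_mul_exp.tsum_pos (fun i => by positivity) 0 (by positivity)

/-- Terms with `k ≤ l` are empty. Writing `k = l + 1 + i` and using `h ≤ 1/e` extracts `e^(-(l+1))`;
the factor `(k + 1) √(2/(2k+1))` is at most `2 √(l+2) (i+1)`, leaving a convergent series in `i`.
Each summand 2 stands for an integral of some `|φ_j(ζ_x)|`. -/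
theorem sum_bias_terms_le {C : ℝ} (hC0 : 0 < C) (hh : 0 < h) (hh' : h ≤ Real.exp (-1)) (l D : ℕ) :
    ∑ k ∈ Finset.range (D + 1), C * (k + 1) * h ^ k * (Real.sqrt (2 / (2 * k + 1)) *
        ∑ _j ∈ Finset.Ico (l + 1) (k + 1), (2 : ℝ)) ≤
      4 * C * expSeries * Real.sqrt (l + 2) * Real.exp (-1) ^ (l + 1) := by
  calc _ ≤ ∑ k ∈ Finset.range (l + 1 + (D + 1)), C * (k + 1) * h ^ k *
        (Real.sqrt (2 / (2 * k + 1)) * ∑ _j ∈ Finset.Ico (l + 1) (k + 1), (2 : ℝ)) := by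
        refine Finset.sum_le_sum_of_subset_of_nonneg
          (Finset.range_subset_range.mpr (by omega)) fun k _ _ => ?_
        simp only [Finset.sum_const, nsmul_eq_mul]
        positivity
    _ = ∑ i ∈ Finset.range (D + 1), C * ((l + 1 + i : ℕ) + 1) * h ^ (l + 1 + i) *
        (Real.sqrt (2 / (2 * (l + 1 + i : ℕ) + 1)) *
          ∑ _j ∈ Finset.Ico (l + 1) (l + 1 + i + 1), (2 : ℝ)) := by
        rw [Finset.sum_range_add, Finset.sum_eq_zero, zero_add]
        intro k hk
        rw [Finset.Ico_eq_empty_of_le (by have := Finset.mem_range.mp hk; omega)]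
        simp
    _ ≤ ∑ i ∈ Finset.range (D + 1), 4 * C * Real.sqrt (l + 2) * Real.exp (-1) ^ (l + 1) *
          (((i : ℝ) + 1) ^ 2 * Real.exp (-1) ^ i) := by
        refine Finset.sum_le_sum fun i _ => ?_
        have hcard : ∑ _j ∈ Finset.Ico (l + 1) (l + 1 + i + 1), (2 : ℝ) = 2 * (i + 1) := by
          rw [Finset.sum_const, Nat.card_Ico, show l + 1 + i + 1 - (l + 1) = i + 1 by omega]
          simp; ring
        have hs : ((l + 1 + i : ℕ) + 1) * Real.sqrt (2 / (2 * (l + 1 + i : ℕ) + 1)) ≤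
            2 * (Real.sqrt (l + 2) * (i + 1)) := by
          have hr : 0 ≤ 2 * (Real.sqrt ((l : ℝ) + 2) * (i + 1)) := by positivity
          rw [← abs_of_nonneg (Real.sqrt_nonneg (2 / (2 * ((l + 1 + i : ℕ) : ℝ) + 1)))]
          refine le_of_sq_le_sq ?_ hr
          rw [mul_pow, mul_pow, mul_pow, Real.sq_sqrt (by positivity), sq_abs,
            Real.sq_sqrt (by positivity)]
          push_cast
          rw [← mul_div_assoc, div_le_iff₀ (by positivity)]
          have hl : (0 : ℝ) ≤ l := by positivity
          have hi : (0 : ℝ) ≤ i := by positivity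
          have h1 : (l : ℝ) + 1 + i + 1 ≤ (l + 2) * (i + 1) := by nlinarith
          have h2 : (l : ℝ) + 1 + i + 1 ≤ 2 * (l + 1 + i) + 1 := by linarith
          calc ((l : ℝ) + 1 + i + 1) ^ 2 * 2
              ≤ 2 * (((l + 2) * (i + 1)) * (2 * (l + 1 + i) + 1)) := by
                rw [sq, mul_comm _ (2 : ℝ)]; gcongr
            _ ≤ 2 ^ 2 * ((l + 2) * (i + 1) ^ 2) * (2 * (l + 1 + i) + 1) := by
                have : ((l : ℝ) + 2) * (i + 1) ≤ (l + 2) * (i + 1) ^ 2 := by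
                  gcongr; nlinarith
                have h3 : (0 : ℝ) ≤ 2 * (l + 1 + i) + 1 := by positivity
                nlinarith [mul_le_mul_of_nonneg_right this h3, mul_nonneg (by positivity : (0:ℝ) ≤ (l + 2) * (i + 1) ^ 2) h3]
        rw [hcard]
        calc C * ((l + 1 + i : ℕ) + 1) * h ^ (l + 1 + i) *
              (Real.sqrt (2 / (2 * (l + 1 + i : ℕ) + 1)) * (2 * (i + 1)))
            = C * h ^ (l + 1 + i) * (2 * (i + 1)) *
              (((l + 1 + i : ℕ) + 1) * Real.sqrt (2 / (2 * (l + 1 + i : ℕ) + 1))) := by ring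
          _ ≤ C * Real.exp (-1) ^ (l + 1 + i) * (2 * (i + 1)) *
              (2 * (Real.sqrt (l + 2) * (i + 1))) := by gcongr
          _ = _ := by rw [pow_add (Real.exp (-1)) (l + 1) i]; ring
    _ = 4 * C * Real.sqrt (l + 2) * Real.exp (-1) ^ (l + 1) *
          ∑ i ∈ Finset.range (D + 1), (((i : ℝ) + 1) ^ 2 * Real.exp (-1) ^ i) := by
        rw [Finset.mul_sum]
    _ ≤ 4 * C * Real.sqrt (l + 2) * Real.exp (-1) ^ (l + 1) * expSeries := by
        gcongr
        exact summable_add_one_sq_mul_exp.sum_le_tsum _ fun i _ => by positivity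
    _ = _ := by ring

theorem tendsto_add_two_mul_pow (hh : 0 < h) (hh' : h ≤ Real.exp (-1)) (C K : ℝ) :
    Filter.Tendsto (fun D : ℕ => C * (D + 2) * h ^ (D + 1) * K) Filter.atTop (nhds 0) := by
  have h1 : h < 1 := hh'.trans_lt (Real.exp_lt_one_iff.mpr (by norm_num))
  have h2 := tendsto_self_mul_const_pow_of_lt_one hh.le h1
  have h3 := tendsto_pow_atTop_nhds_zero_of_lt_one hh.le h1
  have h4 := ((h2.add (h3.const_mul 2)).const_mul (C * h)).mul_const K
  simp only [mul_zero, add_zero, zero_mul] at h4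
  refine h4.congr fun D => ?_
  ring

/-- The integrated bias of the Legendre kernel of order `l` at a strongly smooth function. -/
theorem lintegral_abs_kernelBias_le (hh : 0 < h) (hh' : h ≤ Real.exp (-1)) (hab : 2 * h ≤ b - a)
    (ha : 0 ≤ a) (hb : b ≤ 1)
    {v : ℝ → ℝ} (hv : ContDiffOn ℝ (⊤ : ℕ∞) v (Ioo 0 1)) {C : ℝ} (hC0 : 0 < C)
    (hC : ∀ y ∈ Ioo (0 : ℝ) 1, ∀ l : ℕ, 1 ≤ l →
      |iteratedDeriv l v y / (Nat.factorial (l + 1) : ℝ)| < C)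
    {B : ℝ} (hB : ∀ y ∈ Ioo (0 : ℝ) 1, |v y| ≤ B) (l : ℕ) :
    ∫⁻ x in Icc a b, ENNReal.ofReal |kernelBias a b h l v x| ≤
      ENNReal.ofReal (4 * C * expSeries * Real.sqrt (l + 2) * Real.exp (-1) ^ (l + 1)) := by
  have hint : ∀ j, IntegrableOn (fun x => |legendre j (shiftCenter a b h x)|) (Icc a b) :=
    fun j => (integrableOn_legendre_shiftCenter hh a b j).abs
  have hle : ∀ j, ∫ x in Icc a b, |legendre j (shiftCenter a b h x)| ≤ 2 := fun j =>
    (setIntegral_abs_legendre_shiftCenter_le hh hab j).trans (by linarith)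
  -- The left side does not depend on the Taylor degree, so with `l` fixed `D` can go to infinity
  -- and the remainder disappears.
  have hD : ∀ D : ℕ, ∫⁻ x in Icc a b, ENNReal.ofReal |kernelBias a b h l v x| ≤
      ENNReal.ofReal (4 * C * expSeries * Real.sqrt (l + 2) * Real.exp (-1) ^ (l + 1) +
        C * (D + 2) * h ^ (D + 1) * (1 + 2 * ∑ _j ∈ Finset.range (l + 1), 2)) := by
    intro D
    have hint1 : ∀ s : Finset ℕ,
        IntegrableOn (fun x => ∑ j ∈ s, |legendre j (shiftCenter a b h x)|) (Icc a b) :=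
      fun s => integrable_finsetSum s fun j _ => hint j
    have hle1 : ∀ s : Finset ℕ,
        ∫ x in Icc a b, ∑ j ∈ s, |legendre j (shiftCenter a b h x)| ≤ ∑ _j ∈ s, (2 : ℝ) := by
      intro s
      rw [integral_finsetSum s fun j _ => hint j]
      exact Finset.sum_le_sum fun j _ => hle j
    have hint2 : IntegrableOn (fun x => ∑ k ∈ Finset.range (D + 1), C * (k + 1) * h ^ k *
        (Real.sqrt (2 / (2 * k + 1)) *
          ∑ j ∈ Finset.Ico (l + 1) (k + 1), |legendre j (shiftCenter a b h x)|)) (Icc a b) :=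
      integrable_finsetSum _ fun k _ => ((hint1 _).const_mul _).const_mul _
    have hint3 : IntegrableOn (fun x => C * (D + 2) * h ^ (D + 1) *
        (1 + 2 * ∑ j ∈ Finset.range (l + 1), |legendre j (shiftCenter a b h x)|)) (Icc a b) :=
      ((integrable_const _).add ((hint1 _).const_mul _)).const_mul _
    calc ∫⁻ x in Icc a b, ENNReal.ofReal |kernelBias a b h l v x|
        ≤ ∫⁻ x in Icc a b, ENNReal.ofReal
          ((∑ k ∈ Finset.range (D + 1), C * (k + 1) * h ^ k * (Real.sqrt (2 / (2 * k + 1)) *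
            ∑ j ∈ Finset.Ico (l + 1) (k + 1), |legendre j (shiftCenter a b h x)|)) +
          C * (D + 2) * h ^ (D + 1) *
            (1 + 2 * ∑ j ∈ Finset.range (l + 1), |legendre j (shiftCenter a b h x)|)) := by
          rw [← restrict_Ioo_eq_restrict_Icc]
          refine setLIntegral_mono_ae' measurableSet_Ioo (ae_of_all _ fun x hx => ?_)
          exact ENNReal.ofReal_le_ofReal (abs_kernelBias_le hh hab ha hb hv hC0 hC hB l D hx)
      _ = ENNReal.ofReal (∫ x in Icc a b,
          ((∑ k ∈ Finset.range (D + 1), C * (k + 1) * h ^ k * (Real.sqrt (2 / (2 * k + 1)) *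
            ∑ j ∈ Finset.Ico (l + 1) (k + 1), |legendre j (shiftCenter a b h x)|)) +
          C * (D + 2) * h ^ (D + 1) *
            (1 + 2 * ∑ j ∈ Finset.range (l + 1), |legendre j (shiftCenter a b h x)|))) := by
          refine (ofReal_integral_eq_lintegral_ofReal (hint2.add hint3)
            (ae_of_all _ fun x => ?_)).symm
          simp only [Pi.zero_apply, Pi.add_apply]
          positivity
      _ ≤ _ := by
          refine ENNReal.ofReal_le_ofReal ?_
          rw [integral_add hint2 hint3]
          refine add_le_add ?_ ?_
          · rw [integral_finsetSum _ fun k _ => ((hint1 _).const_mul _).const_mul _]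
            refine le_trans (Finset.sum_le_sum fun k _ => ?_) (sum_bias_terms_le hC0 hh hh' l D)
            rw [integral_const_mul, integral_const_mul]
            gcongr
            exact hle1 _
          · rw [integral_const_mul, integral_add (integrable_const _) ((hint1 _).const_mul _),
              integral_const_mul]
            gcongr
            · simp only [integral_const, smul_eq_mul, MeasurableSet.univ,
                measureReal_restrict_apply, univ_inter,
                Real.volume_real_Icc_of_le (show a ≤ b by linarith)]
              linarith
            · exact hle1 _
  refine ge_of_tendsto (x := Filter.atTop) ?_ (Filter.Eventually.of_forall hD)
  refine (ENNReal.continuous_ofReal.tendsto _).comp ?_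
  simpa using (tendsto_add_two_mul_pow hh hh' C
    (1 + 2 * ∑ _j ∈ Finset.range (l + 1), 2)).const_add
      (4 * C * expSeries * Real.sqrt (l + 2) * Real.exp (-1) ^ (l + 1))

end Bias

end ContAssort

/-! ### Binomial sums for the number of purchases. -/

namespace ContAssort

open MeasureTheory

section Binomial

variable {p q : ℝ}

/-- The factor `1 / (E + 1)` with `E = M - k` is absorbed into a binomial coefficient for `M + 1`
trials. This is the benefit of the `+ 1` in the normalization of the estimate. -/
theorem choose_div_sub_add_one {M k : ℕ} (hk : k ≤ M) :
    (M.choose k : ℝ) / ((M : ℝ) - k + 1) = ((M + 1).choose k : ℝ) / (M + 1) := by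
  have h := Nat.choose_mul_succ_eq M k
  have h1 : (0 : ℝ) < (M : ℝ) - k + 1 := by
    have : (k : ℝ) ≤ M := by exact_mod_cast hk
    linarith
  have h2 : ((M + 1 - k : ℕ) : ℝ) = (M : ℝ) - k + 1 := by
    rw [Nat.cast_sub (by omega)]; push_cast; ring
  have h3 : (M.choose k : ℝ) * ((M : ℝ) + 1) = (M + 1).choose k * ((M : ℝ) - k + 1) := by
    rw [← h2]; exact_mod_cast h
  rw [div_eq_div_iff h1.ne' (by positivity), h3]

/-- After absorption the sum consists of the binomial weights for `M + 1` trials with the last one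
missing. -/
theorem sum_binomial_div_le (hp : 0 ≤ p) (hq : 0 < q) (hpq : p + q = 1) (M : ℕ) :
    ∑ k ∈ Finset.range (M + 1), (M.choose k : ℝ) * (p ^ k * q ^ (M - k)) / ((M : ℝ) - k + 1) ≤
      1 / (q * (M + 1)) := by
  have h1 : ∑ k ∈ Finset.range (M + 1),
      (M.choose k : ℝ) * (p ^ k * q ^ (M - k)) / ((M : ℝ) - k + 1) =
      (∑ k ∈ Finset.range (M + 1), p ^ k * q ^ (M + 1 - k) * ((M + 1).choose k : ℝ)) /
        (q * (M + 1)) := by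
    rw [Finset.sum_div]
    refine Finset.sum_congr rfl fun k hk => ?_
    have hk' : k ≤ M := by have := Finset.mem_range.mp hk; omega
    rw [mul_div_right_comm, choose_div_sub_add_one hk', Nat.sub_add_comm hk', pow_succ]
    field_simp
  rw [h1]
  gcongr
  have h2 : (p + q) ^ (M + 1) = 1 := by rw [hpq, one_pow]
  rw [add_pow, Finset.sum_range_succ] at h2
  rw [← h2]
  refine le_add_of_nonneg_right ?_
  positivity

/-- One absorption turns the sum into part of that of `sum_binomial_div_le` for `M + 1`. It serves
as a substitute for the second inverse moment of `E + 1`. -/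
theorem sum_binomial_div_mul_le (hp : 0 ≤ p) (hq : 0 < q) (hpq : p + q = 1) (M : ℕ) :
    ∑ k ∈ Finset.range (M + 1), (M.choose k : ℝ) * (p ^ k * q ^ (M - k)) /
      (((M : ℝ) - k + 1) * ((M : ℝ) - k + 2)) ≤ 1 / (q ^ 2 * ((M + 1) * (M + 2))) := by
  calc _ = (∑ k ∈ Finset.range (M + 1), ((M + 1).choose k : ℝ) * (p ^ k * q ^ (M + 1 - k)) /
        (((M + 1 : ℕ) : ℝ) - k + 1)) / (q * (M + 1)) := by
        rw [Finset.sum_div]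
        refine Finset.sum_congr rfl fun k hk => ?_
        have hk' : k ≤ M := by have := Finset.mem_range.mp hk; omega
        have hk'' : (k : ℝ) ≤ M := by exact_mod_cast hk'
        have h1 : (M : ℝ) - k + 1 ≠ 0 := by linarith
        have h2 : (M : ℝ) - k + 2 ≠ 0 := by linarith
        have h3 : (((M + 1 : ℕ) : ℝ) - k + 1) = (M : ℝ) - k + 2 := by push_cast; ring
        have h4 := choose_div_sub_add_one hk'
        rw [div_eq_div_iff h1 (by positivity)] at h4
        rw [h3, Nat.sub_add_comm hk', pow_succ]
        field_simp
        linear_combination (p ^ k) * h4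
    _ ≤ (∑ k ∈ Finset.range (M + 1 + 1), ((M + 1).choose k : ℝ) * (p ^ k * q ^ (M + 1 - k)) /
        (((M + 1 : ℕ) : ℝ) - k + 1)) / (q * (M + 1)) := by
        refine div_le_div_of_nonneg_right (Finset.sum_le_sum_of_subset_of_nonneg
          (Finset.range_subset_range.mpr (Nat.le_succ _)) ?_) (by positivity)
        intro k hk _
        have hk' : (k : ℝ) ≤ ((M + 1 : ℕ) : ℝ) := by
          exact_mod_cast Nat.lt_succ_iff.mp (Finset.mem_range.mp hk)
        have : 0 ≤ ((M + 1 : ℕ) : ℝ) - k + 1 := by linarith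
        positivity
    _ ≤ (1 / (q * ((M + 1 : ℕ) + 1))) / (q * (M + 1)) := by
        gcongr
        exact sum_binomial_div_le hp hq hpq (M + 1)
    _ = _ := by
        push_cast
        rw [div_div]
        congr 1
        ring

theorem sum_binomial_mul_sq (hpq : p + q = 1) (M : ℕ) :
    ∑ k ∈ Finset.range (M + 1), (M.choose k : ℝ) * (p ^ k * q ^ (M - k)) * (M * p - k) ^ 2 =
      M * p * q := by
  have h := congrArg (Polynomial.eval p) (bernsteinPolynomial.variance ℝ M)
  rw [Polynomial.eval_finsetSum] at h
  obtain rfl : q = 1 - p := by linarith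
  simp only [bernsteinPolynomial, Polynomial.eval_mul, Polynomial.eval_pow, Polynomial.eval_sub,
    Polynomial.eval_X, Polynomial.eval_natCast, Polynomial.eval_one,
    nsmul_eq_mul] at h
  rw [← h]
  refine Finset.sum_congr rfl fun k _ => ?_
  ring

end Binomial

/-! ### Independent trials split by the set of successes. -/

section Pattern

variable {Ω ι : Type*} [DecidableEq ι]

open Classical in
/-- The indicator function of the outcomes in the coordinate `t` that are compatible with the
pattern `P`, i.e. with `{t ∈ B | X t ∈ L} = P`. -/
noncomputable def patternFactor (L : Set Ω) (B P : Finset ι) (t : ι) : Ω → ℝ :=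
  if t ∈ P then L.indicator 1 else if t ∈ B then Lᶜ.indicator 1 else 1

variable {L : Set Ω} {B P : Finset ι}

theorem patternFactor_nonneg (t : ι) (y : Ω) : 0 ≤ patternFactor L B P t y := by
  unfold patternFactor
  split_ifs
  · exact Set.indicator_nonneg (fun _ _ => zero_le_one) y
  · exact Set.indicator_nonneg (fun _ _ => zero_le_one) y
  · exact zero_le_one

theorem patternFactor_le_one (t : ι) (y : Ω) : patternFactor L B P t y ≤ 1 := by
  unfold patternFactor
  split_ifs
  · exact Set.indicator_le_self' (fun _ _ => zero_le_one) y
  · exact Set.indicator_le_self' (fun _ _ => zero_le_one) y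
  · exact le_rfl

theorem measurable_patternFactor [MeasurableSpace Ω] (hL : MeasurableSet L) (t : ι) :
    Measurable (patternFactor L B P t) := by
  unfold patternFactor
  split_ifs
  · exact measurable_one.indicator hL
  · exact measurable_one.indicator hL.compl
  · exact measurable_one

theorem integral_patternFactor [MeasurableSpace Ω] {μ : ι → Measure Ω}
    [∀ t, IsProbabilityMeasure (μ t)] {ν : Measure Ω} [IsProbabilityMeasure ν] (hL : MeasurableSet L) (hμ : ∀ t ∈ B, μ t = ν) (hPB : P ⊆ B)
    (t : ι) : ∫ y, patternFactor L B P t y ∂(μ t) =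
      if t ∈ P then ν.real L else if t ∈ B then 1 - ν.real L else 1 := by
  unfold patternFactor
  split_ifs with h1 h2
  · rw [hμ t (hPB h1), integral_indicator_one hL]
  · rw [hμ t h2, integral_indicator_one hL.compl, probReal_compl_eq_one_sub hL]
  · simp

variable [Fintype ι]

/-- The indicator function of the event `{t ∈ B | X t ∈ L} = P`. -/
noncomputable def patternInd (L : Set Ω) (B P : Finset ι) (X : ι → Ω) : ℝ :=
  ∏ t, patternFactor L B P t (X t)

theorem patternInd_nonneg (X : ι → Ω) : 0 ≤ patternInd L B P X :=
  Finset.prod_nonneg fun t _ => patternFactor_nonneg t _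

theorem mem_iff_of_patternInd_ne_zero {X : ι → Ω} (h : patternInd L B P X ≠ 0)
    {t : ι} (ht : t ∈ B) : X t ∈ L ↔ t ∈ P := by
  have h1 := Finset.prod_ne_zero_iff.mp h t (Finset.mem_univ t)
  unfold patternFactor at h1
  split_ifs at h1 with h2
  · simpa [h2] using h1
  · simpa [h2] using h1

-- Exactly one pattern occurs. On it the number of purchases is a constant, so the random kernel
-- order and normalization become deterministic.
open Classical in
theorem sum_patternInd (X : ι → Ω) : ∑ P ∈ B.powerset, patternInd L B P X = 1 := by
  rw [Finset.sum_eq_single_of_mem (B.filter fun t => X t ∈ L)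
    (Finset.mem_powerset.mpr (Finset.filter_subset _ _))]
  · refine Finset.prod_eq_one fun t _ => ?_
    unfold patternFactor
    by_cases h1 : t ∈ B <;> by_cases h2 : X t ∈ L <;> simp [h1, h2]
  · intro P hP hne
    by_contra h
    refine hne ?_
    ext t
    rw [Finset.mem_filter]
    have hPB := Finset.mem_powerset.mp hP
    constructor
    · exact fun ht => ⟨hPB ht, (mem_iff_of_patternInd_ne_zero h (hPB ht)).mpr ht⟩
    · exact fun ht => (mem_iff_of_patternInd_ne_zero h ht.1).mp ht.2

variable [MeasurableSpace Ω]

theorem measurable_patternInd (hL : MeasurableSet L) : Measurable (patternInd L B P) :=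
  Finset.measurable_prod _ fun t _ => (measurable_patternFactor hL t).comp (measurable_pi_apply t)

variable {μ : ι → Measure Ω} [∀ t, IsProbabilityMeasure (μ t)] {ν : Measure Ω}
  [IsProbabilityMeasure ν]

theorem integral_patternInd (hL : MeasurableSet L) (hμ : ∀ t ∈ B, μ t = ν) (hPB : P ⊆ B) :
    ∫ X, patternInd L B P X ∂(Measure.pi μ) =
      ν.real L ^ P.card * (1 - ν.real L) ^ (B.card - P.card) := by
  unfold patternInd
  rw [integral_fintype_prod_eq_prod]
  simp_rw [integral_patternFactor hL hμ hPB]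
  rw [← Finset.prod_subset (Finset.subset_univ B) (fun t _ ht => by
      rw [if_neg (fun h => ht (hPB h)), if_neg ht]), ← Finset.prod_sdiff hPB, mul_comm,
    ← Finset.card_sdiff_of_subset hPB, ← Finset.prod_const, ← Finset.prod_const]
  congr 1
  · exact Finset.prod_congr rfl fun t ht => by rw [if_pos ht]
  · refine Finset.prod_congr rfl fun t ht => ?_
    obtain ⟨h1, h2⟩ := Finset.mem_sdiff.mp ht
    rw [if_neg h2, if_pos h1]

/-- On the event that the pattern is `P`, sums of a function with vanishing mean on `L` over
the coordinates in `P` behave like sums of independent centred variables. -/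
theorem integral_patternInd_mul_sq (hL : MeasurableSet L) (hμ : ∀ t ∈ B, μ t = ν) (hPB : P ⊆ B)
    (hp : ν.real L ≠ 0) {f : Ω → ℝ} (hf : Measurable f) {K : ℝ} (hK : ∀ y, |f y| ≤ K)
    (h0 : ∫ y in L, f y ∂ν = 0) :
    Integrable (fun X => patternInd L B P X * (∑ s ∈ P, f (X s)) ^ 2) (Measure.pi μ) ∧
    ∫ X, patternInd L B P X * (∑ s ∈ P, f (X s)) ^ 2 ∂(Measure.pi μ) =
      P.card * (∫ y in L, f y ^ 2 ∂ν) / ν.real L * ∫ X, patternInd L B P X ∂(Measure.pi μ) := by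
  -- Writes `f (X s)` as a product over all coordinates, so that every term of the expanded square
  -- is a product and its integral factorizes.
  set e : ι → ι → Ω → ℝ := fun s t => if t = s then f else 1
  have he : ∀ s t, Measurable (e s t) := fun s t => by
    simp only [e]; split_ifs; exacts [hf, measurable_one]
  have hK0 : 1 ≤ max 1 K := le_max_left _ _
  have heK : ∀ s t y, |e s t y| ≤ max 1 K := fun s t y => by
    simp only [e]; split_ifs
    · exact (hK y).trans (le_max_right _ _)
    · simp
  have hprod : ∀ s (X : ι → Ω), f (X s) = ∏ t, e s t (X t) := fun s X => by
    rw [Finset.prod_eq_single_of_mem s (Finset.mem_univ s)]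
    · simp [e]
    · intro t _ hts; simp [e, hts]
  have hexp : ∀ X : ι → Ω, patternInd L B P X * (∑ s ∈ P, f (X s)) ^ 2 =
      ∑ s ∈ P, ∑ s' ∈ P, ∏ t, (patternFactor L B P t (X t) * e s t (X t) * e s' t (X t)) := by
    intro X
    rw [sq, Finset.sum_mul_sum, Finset.mul_sum]
    refine Finset.sum_congr rfl fun s _ => ?_
    rw [Finset.mul_sum]
    refine Finset.sum_congr rfl fun s' _ => ?_
    rw [Finset.prod_mul_distrib, Finset.prod_mul_distrib, ← hprod, ← hprod, patternInd, mul_assoc]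
  have hint1 : ∀ s s' t, Integrable
      (fun y => patternFactor L B P t y * e s t y * e s' t y) (μ t) := by
    intro s s' t
    refine Integrable.of_bound (((measurable_patternFactor hL t).mul (he s t)).mul
      (he s' t)).aestronglyMeasurable (1 * max 1 K * max 1 K) (ae_of_all _ fun y => ?_)
    rw [Real.norm_eq_abs, abs_mul, abs_mul]
    have h1 := heK s t y
    have h2 := heK s' t y
    have h3 : |patternFactor L B P t y| ≤ 1 := by
      rw [abs_of_nonneg (patternFactor_nonneg t y)]; exact patternFactor_le_one t y
    gcongr
  have hint : ∀ s s', Integrable (fun X : ι → Ω =>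
      ∏ t, (patternFactor L B P t (X t) * e s t (X t) * e s' t (X t))) (Measure.pi μ) :=
    fun s s' => Integrable.fintype_prod fun t => hint1 s s' t
  simp_rw [hexp]
  refine ⟨integrable_finsetSum _ fun s _ => integrable_finsetSum _ fun s' _ => hint s s', ?_⟩
  rw [integral_finsetSum _ fun s _ => integrable_finsetSum _ fun s' _ => hint s s']
  have hind : ∀ (s : ι), s ∈ P → ∀ g : Ω → ℝ,
      ∫ y, patternFactor L B P s y * g y ∂(μ s) = ∫ y in L, g y ∂ν := by
    intro s hs g
    rw [hμ s (hPB hs), ← integral_indicator hL]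
    congr 1
    ext y
    simp only [patternFactor, hs, if_true]
    by_cases hy : y ∈ L <;> simp [hy]
  have hmain : ∀ s ∈ P, ∀ s' ∈ P, ∫ X : ι → Ω,
      ∏ t, (patternFactor L B P t (X t) * e s t (X t) * e s' t (X t)) ∂(Measure.pi μ) =
      if s = s' then (∫ y in L, f y ^ 2 ∂ν) / ν.real L *
        ∫ X, patternInd L B P X ∂(Measure.pi μ) else 0 := by
    intro s hs s' hs'
    rw [integral_fintype_prod_eq_prod
      (f := fun t y => patternFactor L B P t y * e s t y * e s' t y)]
    split_ifs with hss
    · subst hss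
      unfold patternInd
      rw [integral_fintype_prod_eq_prod, ← Finset.mul_prod_erase _ _ (Finset.mem_univ s),
        ← Finset.mul_prod_erase Finset.univ (fun t => ∫ y, patternFactor L B P t y ∂(μ t))
          (Finset.mem_univ s), integral_patternFactor hL hμ hPB s, if_pos hs, ← mul_assoc,
        div_mul_cancel₀ _ hp]
      congr 1
      · rw [← hind s hs]
        congr 1
        ext y
        simp [e, sq, mul_assoc]
      · refine Finset.prod_congr rfl fun t ht => ?_
        have : t ≠ s := Finset.ne_of_mem_erase ht
        simp [e, this]
    -- For a cross term, the factor of the coordinate `s` is the integral of `f` over `L`, which is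
    -- 0.
    · refine Finset.prod_eq_zero (Finset.mem_univ s) ?_
      rw [← h0, ← hind s hs]
      congr 1
      ext y
      simp [e, hss]
  have : ∀ s ∈ P, ∫ X : ι → Ω, ∑ s' ∈ P, ∏ t, (patternFactor L B P t (X t) * e s t (X t) *
      e s' t (X t)) ∂(Measure.pi μ) = (∫ y in L, f y ^ 2 ∂ν) / ν.real L *
        ∫ X, patternInd L B P X ∂(Measure.pi μ) := by
    intro s hs
    rw [integral_finsetSum _ fun s' _ => hint s s', Finset.sum_congr rfl (hmain s hs),
      Finset.sum_ite_eq, if_pos hs]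
  rw [Finset.sum_congr rfl this, Finset.sum_const, nsmul_eq_mul]
  ring

end Pattern

end ContAssort

/-! ### One customer: choice probabilities, kernel of an observation, size of the kernel order. -/

namespace ContAssort

open MeasureTheory Set

/-! ### The choice law -/

/-- The event that a product is purchased. -/
def purchase : Set Outcome := range Sum.inl

theorem measurableSet_purchase : MeasurableSet purchase := measurableSet_range_inl

theorem mem_purchase_iff (o : Outcome) : o ∈ purchase ↔ o.isLeft := by
  cases o <;> simp [purchase]

theorem choiceLaw_restrict_purchase (v : ℝ → ℝ) (S : Set unitInterval) :
    (choiceLaw v S).restrict purchase = ENNReal.ofReal (1 / (1 + mass v S)) •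
      ((volume.restrict S).withDensity (fun x : unitInterval => ENNReal.ofReal (v x))).map
        Sum.inl := by
  have h1 : (Sum.inl ⁻¹' purchase : Set unitInterval) = univ := by
    ext x; simp [purchase]
  have h2 : (Sum.inr () : Outcome) ∉ purchase := by simp [purchase]
  classical
  rw [choiceLaw, Measure.restrict_smul, Measure.restrict_add,
    Measure.restrict_map measurable_inl measurableSet_purchase, h1, Measure.restrict_univ,
    restrict_dirac' measurableSet_purchase, if_neg h2, add_zero]

/-- The standing regularity of a preference function. -/
structure IsRegular (lo hi : ℝ) (v : ℝ → ℝ) : Prop where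
  lo_pos : 0 < lo
  measurable : Measurable fun x : unitInterval => v x
  le : ∀ y ∈ Icc (0 : ℝ) 1, lo ≤ v y
  ge : ∀ y ∈ Icc (0 : ℝ) 1, v y ≤ hi

namespace IsRegular

variable {lo hi : ℝ} {v : ℝ → ℝ}

theorem pos (hv : IsRegular lo hi v) (x : unitInterval) : 0 < v x := hv.lo_pos.trans_le (hv.le x x.2)

theorem abs_le (hv : IsRegular lo hi v) (x : unitInterval) : |v x| ≤ hi := by
  rw [abs_of_pos (hv.pos x)]; exact hv.ge x x.2

theorem hi_pos (hv : IsRegular lo hi v) : 0 < hi := (hv.pos 0).trans_le (hv.ge _ (by simp))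

theorem integrable (hv : IsRegular lo hi v) (S : Set unitInterval) :
    Integrable (fun x : unitInterval => v x) (volume.restrict S) :=
  Integrable.of_bound hv.measurable.aestronglyMeasurable hi (ae_of_all _ fun x => hv.abs_le x)

theorem mass_nonneg (hv : IsRegular lo hi v) (S : Set unitInterval) : 0 ≤ mass v S :=
  integral_nonneg fun x => (hv.pos x).le

theorem ofReal_mass (hv : IsRegular lo hi v) (S : Set unitInterval) :
    ENNReal.ofReal (mass v S) = ∫⁻ x in S, ENNReal.ofReal (v x) :=
  ofReal_integral_eq_lintegral_ofReal (hv.integrable S) (ae_of_all _ fun x => (hv.pos x).le)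

theorem isProbabilityMeasure_choiceLaw (hv : IsRegular lo hi v) (S : Set unitInterval) :
    IsProbabilityMeasure (choiceLaw v S) := by
  have h0 := hv.mass_nonneg S
  constructor
  rw [choiceLaw, Measure.smul_apply, Measure.add_apply,
    Measure.map_apply measurable_inl MeasurableSet.univ, preimage_univ,
    withDensity_apply _ MeasurableSet.univ, Measure.restrict_univ, ← hv.ofReal_mass,
    Measure.dirac_apply_of_mem (mem_univ _), smul_eq_mul, ← ENNReal.ofReal_one,
    ← ENNReal.ofReal_add h0 zero_le_one, ← ENNReal.ofReal_mul (by positivity)]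
  congr 1
  field_simp
  ring

theorem setIntegral_choiceLaw (hv : IsRegular lo hi v) (S : Set unitInterval) (F : Outcome → ℝ) :
    ∫ o in purchase, F o ∂(choiceLaw v S) =
      1 / (1 + mass v S) * ∫ x in S, F (Sum.inl x) * v x := by
  have h0 := hv.mass_nonneg S
  rw [choiceLaw_restrict_purchase, integral_smul_measure,
    MeasurableEmbedding.integral_map
      ⟨Sum.inl_injective, measurable_inl, fun _ hs => hs.inl_image⟩,
    integral_withDensity_eq_integral_toReal_smul hv.measurable.ennreal_ofReal
      (ae_of_all _ fun x => ENNReal.ofReal_lt_top), ENNReal.toReal_ofReal (by positivity),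
    smul_eq_mul]
  congr 1
  refine integral_congr_ae (ae_of_all _ fun x => ?_)
  simp only [smul_eq_mul]
  rw [ENNReal.toReal_ofReal (hv.pos x).le, mul_comm]

/-- The odds of a purchase are therefore the mass of `S`, which is why purchases over no-purchases
estimate this mass. -/
theorem choiceLaw_real_purchase (hv : IsRegular lo hi v) (S : Set unitInterval) :
    (choiceLaw v S).real purchase = mass v S / (1 + mass v S) := by
  have := hv.setIntegral_choiceLaw S (fun _ => 1)
  simp only [one_mul] at this
  rw [setIntegral_const, smul_eq_mul, mul_one] at this
  rw [this, mass]
  ring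

end IsRegular

theorem setIntegral_preimage_unitInterval {a b : ℝ} (ha : 0 ≤ a) (hb : b ≤ 1) (F : ℝ → ℝ) :
    ∫ x in {x : unitInterval | (x : ℝ) ∈ Icc a b}, F x = ∫ y in Icc a b, F y := by
  have h := unitInterval.measurePreserving_coe.setIntegral_preimage_emb
    unitInterval.measurableEmbedding_coe F (Icc a b)
  rw [Measure.restrict_restrict measurableSet_Icc] at h
  have hs : Icc a b ∩ unitInterval = Icc a b := inter_eq_left.mpr (Icc_subset_Icc ha hb)
  rw [hs] at h
  exact h

theorem setLIntegral_unitInterval (F : ℝ → ENNReal) :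
    ∫⁻ x : unitInterval, F x = ∫⁻ y in Icc 0 1, F y :=
  unitInterval.measurePreserving_coe.lintegral_comp_emb
    unitInterval.measurableEmbedding_coe F

/-! ### The kernel of an observation -/

/-- The position of the purchased product. -/
def outcomePos : Outcome → ℝ := Sum.elim (fun y => (y : ℝ)) fun _ => 0

theorem measurable_outcomePos : Measurable outcomePos :=
  measurable_subtype_coe.sumElim measurable_const

open Classical in
/-- The contribution of an observation to the density estimate at `x`. -/
noncomputable def obsKernel (a b h : ℝ) (l : ℕ) (x : ℝ) (o : Outcome) : ℝ :=
  if o ∈ purchase then legendreKernel a b h l x ((outcomePos o - x) / h) else 0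

theorem obsKernel_inl (a b h : ℝ) (l : ℕ) (x : ℝ) (y : unitInterval) :
    obsKernel a b h l x (Sum.inl y) = legendreKernel a b h l x ((y - x) / h) := by
  simp [obsKernel, purchase, outcomePos]

theorem sumElim_legendreKernel (a b h : ℝ) (l : ℕ) (x : ℝ) (o : Outcome) :
    Sum.elim (fun y : unitInterval => legendreKernel a b h l x (((y : ℝ) - x) / h))
      (fun _ => 0) o = obsKernel a b h l x o := by
  cases o <;> simp [obsKernel, purchase, outcomePos]

theorem measurable_obsKernel (a b h : ℝ) (l : ℕ) :
    Measurable fun p : ℝ × Outcome => obsKernel a b h l p.1 p.2 := by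
  unfold obsKernel
  refine Measurable.ite (measurable_snd measurableSet_purchase) ?_ measurable_const
  refine (measurable_legendreKernel a b h l).comp (measurable_fst.prodMk ?_)
  exact ((measurable_outcomePos.comp measurable_snd).sub measurable_fst).div_const h

/-- Used only for integrability; the size of the constant never enters the rates. -/
theorem exists_abs_obsKernel_le {a b h : ℝ} (hh : 0 < h) (hab : 2 * h ≤ b - a) (l : ℕ) :
    ∃ K, ∀ x ∈ Icc a b, ∀ o, |obsKernel a b h l x o| ≤ K := by
  choose B hB using exists_abs_legendre_le
  have hB0 : ∀ j, 0 ≤ B j := fun j => (abs_nonneg _).trans (hB j 0 (by norm_num))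
  have hK : 0 ≤ 2 * ∑ j ∈ Finset.range (l + 1), B j * B j :=
    mul_nonneg zero_le_two (Finset.sum_nonneg fun j _ => mul_nonneg (hB0 j) (hB0 j))
  refine ⟨2 * ∑ j ∈ Finset.range (l + 1), B j * B j, fun x hx o => ?_⟩
  unfold obsKernel
  split_ifs with h1
  swap
  · simpa using hK
  rw [legendreKernel_eq hh hab hx]
  split_ifs with h2
  swap
  · simpa using hK
  have hs := shiftScale_mem hh hx
  have hr := windowRadius_pos hh hx
  rw [abs_mul, abs_of_nonneg (zero_le_one.trans hs.1)]
  refine mul_le_mul hs.2 ((Finset.abs_sum_le_sum_abs _ _).trans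
    (Finset.sum_le_sum fun j _ => ?_)) (abs_nonneg _) zero_le_two
  rw [abs_mul]
  refine mul_le_mul (hB j _ (shiftCenter_mem hh hx)) (hB j _ ?_) (abs_nonneg _) (hB0 j)
  rw [mem_Icc, ← abs_le, abs_div, abs_of_pos hr, div_le_one hr]
  exact h2

/-! ### The order of the kernel -/

theorem bandwidth_pos {c : ℝ} (hc : 0 < c) : 0 < bandwidth c :=
  lt_min (by positivity) (by positivity)

theorem bandwidth_le_exp (c : ℝ) : bandwidth c ≤ Real.exp (-1) := by
  rw [Real.exp_neg, ← one_div]; exact min_le_right _ _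

theorem one_le_neg_log_bandwidth {c : ℝ} (hc : 0 < c) : 1 ≤ -Real.log (bandwidth c) := by
  have := Real.log_le_log (bandwidth_pos hc) (bandwidth_le_exp c)
  rw [Real.log_exp] at this
  linarith

/-- Rounding loses at most `1/2`, so the order plus one is at least `(1/2) log (-2 n log h)`, and
`-log h ≥ 1` makes this at least `(1/2) log n`. -/
theorem exp_kernelOrder_le {c : ℝ} (hc : 0 < c) {n : ℕ} (hn : 0 < n) :
    n * Real.exp (-1) ^ (kernelOrder c n + 1) ≤ Real.sqrt n := by
  have hlog := one_le_neg_log_bandwidth hc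
  set β := -2 * (n : ℝ) * Real.log (bandwidth c)
  have hn' : (0 : ℝ) < n := by exact_mod_cast hn
  have hβ : n ≤ β := by
    have : β = n * (2 * (-Real.log (bandwidth c))) := by ring
    rw [this]; nlinarith
  have h1 : 1 / 2 * Real.log β ≤ (kernelOrder c n : ℝ) + 1 := by
    -- Truncating a negative integer to 0 only raises the order.
    have h2 : (round (1 / 2 * Real.log β - 1 / 2) : ℝ) ≤ kernelOrder c n := by
      exact_mod_cast Int.self_le_toNat _
    have h3 := abs_le.mp (abs_sub_round (1 / 2 * Real.log β - 1 / 2))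
    linarith [h3.2]
  have h4 : 1 / 2 * Real.log n ≤ (kernelOrder c n : ℝ) + 1 :=
    le_trans (by gcongr) h1
  rw [← Real.exp_nat_mul]
  push_cast
  calc (n : ℝ) * Real.exp (((kernelOrder c n : ℝ) + 1) * -1)
      ≤ n * Real.exp (-(1 / 2 * Real.log n)) := by gcongr; linarith
    _ = Real.sqrt n := by
      rw [show -(1 / 2 * Real.log n) = -Real.log n / 2 by ring, Real.exp_half, Real.exp_neg,
        Real.exp_log hn', Real.sqrt_inv]
      have := Real.mul_self_sqrt hn'.le
      have h5 := Real.sqrt_pos.mpr hn'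
      field_simp
      linarith

/-- A constant that bounds the growth of the order of the kernel. -/
noncomputable def orderConst (c : ℝ) : ℝ := 2 + Real.log (2 * -Real.log (bandwidth c))

theorem two_le_orderConst {c : ℝ} (hc : 0 < c) : 2 ≤ orderConst c := by
  have := one_le_neg_log_bandwidth hc
  have := Real.log_nonneg (show 1 ≤ 2 * -Real.log (bandwidth c) by linarith)
  unfold orderConst; linarith

theorem kernelOrder_add_two_le {c : ℝ} (hc : 0 < c) {n M : ℕ} (hM : 0 < M) (hn : n ≤ M) :
    (kernelOrder c n : ℝ) + 2 ≤ orderConst c * (1 + Real.log M) := by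
  have hlog := one_le_neg_log_bandwidth hc
  have hM1 : 0 ≤ Real.log M := Real.log_natCast_nonneg M
  have h2 := two_le_orderConst hc
  set t := 1 / 2 * Real.log (-2 * (n : ℝ) * Real.log (bandwidth c)) - 1 / 2 with ht
  have h0 : 0 ≤ Real.log (2 * -Real.log (bandwidth c)) := Real.log_nonneg (by linarith)
  have h1 : (kernelOrder c n : ℝ) ≤ max (round t : ℝ) 0 := by
    have : ((kernelOrder c n : ℤ)) = max (round t) 0 := Int.toNat_eq_max _
    exact_mod_cast this.le
  have h3 := abs_le.mp (abs_sub_round t)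
  have h4 : Real.log (-2 * (n : ℝ) * Real.log (bandwidth c)) ≤
      Real.log (2 * -Real.log (bandwidth c)) + Real.log M := by
    -- Without purchases the logarithm takes its default value `log 0 = 0`.
    rcases Nat.eq_zero_or_pos n with rfl | hn0
    · simp only [Nat.cast_zero, mul_zero, zero_mul, Real.log_zero]; linarith
    · have hn' : (0 : ℝ) < n := by exact_mod_cast hn0
      have hM' : (0 : ℝ) < M := by exact_mod_cast hM
      rw [← Real.log_mul (by linarith) hM'.ne']
      have hnM : (n : ℝ) ≤ M := by exact_mod_cast hn
      refine Real.log_le_log (by nlinarith) ?_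
      nlinarith
  have h5 : (kernelOrder c n : ℝ) ≤ Real.log (2 * -Real.log (bandwidth c)) + Real.log M :=
    h1.trans (max_le (by linarith [h3.1]) (by linarith))
  have h6 : orderConst c + Real.log M ≤ orderConst c * (1 + Real.log M) := by nlinarith
  unfold orderConst at h6 ⊢
  linarith

end ContAssort

/-! ### Mean and variance of the kernel, given a purchase. -/

namespace ContAssort

open MeasureTheory Set

section Centred

/-- The products in `[a, b]`. -/
def productInterval (a b : ℝ) : Set unitInterval := {x | (x : ℝ) ∈ Icc a b}

/-- The mean of the kernel of an observation at `x`, given that there is a purchase. -/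
noncomputable def obsMean (a b h : ℝ) (l : ℕ) (v : ℝ → ℝ) (x : ℝ) : ℝ :=
  (∫ o in purchase, obsKernel a b h l x o ∂(choiceLaw v (productInterval a b))) /
    (choiceLaw v (productInterval a b)).real purchase

open Classical in
/-- The kernel of a purchase, centred by its mean given that there is a purchase. -/
noncomputable def centredKernel (a b h : ℝ) (l : ℕ) (v : ℝ → ℝ) (x : ℝ) (o : Outcome) : ℝ :=
  if o ∈ purchase then obsKernel a b h l x o - obsMean a b h l v x else 0

variable {a b h lo hi : ℝ} {v : ℝ → ℝ}

theorem IsRegular.mass_productInterval_pos (hv : IsRegular lo hi v) (ha : 0 ≤ a) (hb : b ≤ 1)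
    (hlt : a < b) : 0 < mass v (productInterval a b) := by
  refine (setIntegral_pos_iff_support_of_nonneg_ae (ae_of_all _ fun x => (hv.pos x).le)
    (hv.integrable _)).mpr ?_
  have h1 : Function.support (fun x : unitInterval => v x) = univ := by
    ext x; simpa using (hv.pos x).ne'
  rw [h1, univ_inter]
  have h2 := unitInterval.measurePreserving_coe.measure_preimage_emb
    unitInterval.measurableEmbedding_coe (Icc a b)
  rw [Measure.restrict_apply measurableSet_Icc,
    inter_eq_left.mpr (show Icc a b ⊆ unitInterval from Icc_subset_Icc ha hb)] at h2
  change 0 < volume ((fun x : unitInterval => (x : ℝ)) ⁻¹' Icc a b)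
  rw [h2, Real.volume_Icc]
  simpa using hlt

theorem setIntegral_obsKernel (hv : IsRegular lo hi v) (hh : 0 < h) (hab : 2 * h ≤ b - a)
    (ha : 0 ≤ a) (hb : b ≤ 1) (l : ℕ) {x : ℝ} (hx : x ∈ Icc a b) :
    ∫ o in purchase, obsKernel a b h l x o ∂(choiceLaw v (productInterval a b)) =
      1 / (1 + mass v (productInterval a b)) * (h * (v x + kernelBias a b h l v x)) := by
  rw [hv.setIntegral_choiceLaw]
  simp_rw [obsKernel_inl]
  rw [productInterval, setIntegral_preimage_unitInterval ha hb
    (fun y => legendreKernel a b h l x ((y - x) / h) * v y),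
    setIntegral_legendreKernel_mul_eq hh hab hx]

/-- Given a purchase, the position has density `v` divided by the mass; the factor `1 + mass`
cancels. -/
theorem obsMean_eq (hv : IsRegular lo hi v) (hh : 0 < h) (hab : 2 * h ≤ b - a)
    (ha : 0 ≤ a) (hb : b ≤ 1) (l : ℕ) {x : ℝ} (hx : x ∈ Icc a b) :
    obsMean a b h l v x =
      h / mass v (productInterval a b) * (v x + kernelBias a b h l v x) := by
  have hV := hv.mass_productInterval_pos ha hb (by linarith : a < b)
  rw [obsMean, setIntegral_obsKernel hv hh hab ha hb l hx, hv.choiceLaw_real_purchase]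
  field_simp

theorem measurable_obsMean (hv : IsRegular lo hi v) (a b h : ℝ) (l : ℕ) :
    Measurable (obsMean a b h l v) := by
  have := hv.isProbabilityMeasure_choiceLaw (productInterval a b)
  unfold obsMean
  refine Measurable.div_const ?_ _
  exact ((measurable_obsKernel a b h l).stronglyMeasurable.integral_prod_right
    (ν := (choiceLaw v (productInterval a b)).restrict purchase)).measurable

theorem measurable_centredKernel (hv : IsRegular lo hi v) (a b h : ℝ) (l : ℕ) :
    Measurable fun p : ℝ × Outcome => centredKernel a b h l v p.1 p.2 := by
  unfold centredKernel
  exact Measurable.ite (measurable_snd measurableSet_purchase)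
    ((measurable_obsKernel a b h l).sub ((measurable_obsMean hv a b h l).comp measurable_fst))
    measurable_const

theorem exists_abs_centredKernel_le (v : ℝ → ℝ) (hh : 0 < h) (hab : 2 * h ≤ b - a) (l : ℕ)
    {x : ℝ} (hx : x ∈ Icc a b) : ∃ K, ∀ o, |centredKernel a b h l v x o| ≤ K := by
  obtain ⟨K, hK⟩ := exists_abs_obsKernel_le hh hab l
  refine ⟨K + |obsMean a b h l v x|, fun o => ?_⟩
  have h1 := hK x hx o
  unfold centredKernel
  split_ifs
  · exact (abs_sub _ _).trans (by linarith)
  · simpa using add_nonneg ((abs_nonneg _).trans h1) (abs_nonneg _)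

theorem integrable_obsKernel (hv : IsRegular lo hi v) (hh : 0 < h) (hab : 2 * h ≤ b - a) (l : ℕ)
    {x : ℝ} (hx : x ∈ Icc a b) (n : ℕ) (s : Set Outcome) :
    Integrable (fun o => obsKernel a b h l x o ^ n)
      ((choiceLaw v (productInterval a b)).restrict s) := by
  have := hv.isProbabilityMeasure_choiceLaw (productInterval a b)
  obtain ⟨K, hK⟩ := exists_abs_obsKernel_le hh hab l
  refine Integrable.of_bound (((measurable_obsKernel a b h l).comp
    measurable_prodMk_left).pow_const n).aestronglyMeasurable (K ^ n) (ae_of_all _ fun o => ?_)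
  rw [Real.norm_eq_abs, abs_pow]
  exact pow_le_pow_left₀ (abs_nonneg _) (hK x hx o) n

theorem setIntegral_centredKernel (hv : IsRegular lo hi v) (hh : 0 < h) (hab : 2 * h ≤ b - a)
    (ha : 0 ≤ a) (hb : b ≤ 1) (l : ℕ) {x : ℝ} (hx : x ∈ Icc a b) :
    ∫ o in purchase, centredKernel a b h l v x o ∂(choiceLaw v (productInterval a b)) = 0 := by
  have := hv.isProbabilityMeasure_choiceLaw (productInterval a b)
  have hV := hv.mass_productInterval_pos ha hb (by linarith : a < b)
  have hp : (choiceLaw v (productInterval a b)).real purchase ≠ 0 := by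
    rw [hv.choiceLaw_real_purchase]; positivity
  have h1 : ∫ o in purchase, centredKernel a b h l v x o ∂(choiceLaw v (productInterval a b)) =
      ∫ o in purchase, (obsKernel a b h l x o - obsMean a b h l v x)
        ∂(choiceLaw v (productInterval a b)) :=
    setIntegral_congr_fun measurableSet_purchase fun o ho => if_pos ho
  have h2 := integrable_obsKernel hv hh hab l hx 1 purchase
  simp only [pow_one] at h2
  rw [h1, integral_sub h2 (integrable_const _), setIntegral_const, smul_eq_mul, obsMean,
    mul_div_cancel₀ _ hp, sub_self]

/-- Centring can only lower the second moment. The density of the position is at most `hi`, which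
leaves the integral of the squared kernel. -/
theorem setIntegral_centredKernel_sq_le (hv : IsRegular lo hi v) (hh : 0 < h)
    (hab : 2 * h ≤ b - a) (ha : 0 ≤ a) (hb : b ≤ 1) (l : ℕ) {x : ℝ} (hx : x ∈ Icc a b) :
    ∫ o in purchase, centredKernel a b h l v x o ^ 2 ∂(choiceLaw v (productInterval a b)) ≤
      hi * (2 * h * ∑ j ∈ Finset.range (l + 1), legendre j (shiftCenter a b h x) ^ 2) := by
  have := hv.isProbabilityMeasure_choiceLaw (productInterval a b)
  have hV := hv.mass_productInterval_pos ha hb (by linarith : a < b)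
  set ν := choiceLaw v (productInterval a b) with hν
  set κ := obsMean a b h l v x with hκ
  have hp : ν.real purchase ≠ 0 := by
    rw [hv.choiceLaw_real_purchase]; positivity
  have hi0 := hv.hi_pos
  have i1 := integrable_obsKernel hv hh hab l hx 1 purchase
  have i2 := integrable_obsKernel hv hh hab l hx 2 purchase
  simp only [pow_one] at i1
  have h1 : ∫ o in purchase, centredKernel a b h l v x o ^ 2 ∂ν =
      ∫ o in purchase, (obsKernel a b h l x o ^ 2 - 2 * κ * obsKernel a b h l x o + κ ^ 2) ∂ν :=
    setIntegral_congr_fun measurableSet_purchase fun o ho => by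
      simp only [centredKernel, if_pos ho]; ring
  have h2 : ∫ o in purchase, obsKernel a b h l x o ∂ν = κ * ν.real purchase := by
    rw [hκ, obsMean, div_mul_cancel₀ _ hp]
  have h3 : ∫ o in purchase, centredKernel a b h l v x o ^ 2 ∂ν ≤
      ∫ o in purchase, obsKernel a b h l x o ^ 2 ∂ν := by
    have i3 : Integrable (fun o => obsKernel a b h l x o ^ 2 - 2 * κ * obsKernel a b h l x o)
        (ν.restrict purchase) := i2.sub (i1.const_mul _)
    rw [h1, integral_add i3 (integrable_const _),
      integral_sub i2 (i1.const_mul _), integral_const_mul, h2, setIntegral_const, smul_eq_mul]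
    have : 0 ≤ κ ^ 2 * ν.real purchase := by positivity
    nlinarith
  refine h3.trans ?_
  rw [hv.setIntegral_choiceLaw]
  simp_rw [obsKernel_inl]
  rw [productInterval, setIntegral_preimage_unitInterval ha hb
    (fun y => legendreKernel a b h l x ((y - x) / h) ^ 2 * v y)]
  have h4 : ∫ y in Icc a b, legendreKernel a b h l x ((y - x) / h) ^ 2 * v y ≤
      hi * ∫ y in Icc a b, legendreKernel a b h l x ((y - x) / h) ^ 2 := by
    rw [← integral_const_mul]
    obtain ⟨K, hK⟩ := exists_abs_obsKernel_le hh hab l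
    have hbd : IntegrableOn (fun y => legendreKernel a b h l x ((y - x) / h) ^ 2) (Icc a b) := by
      refine Integrable.of_bound (((measurable_legendreKernel a b h l).comp
        (measurable_const.prodMk ((measurable_id.sub_const x).div_const h))).pow_const
          2).aestronglyMeasurable (K ^ 2) ?_
      filter_upwards [ae_restrict_mem measurableSet_Icc] with y hy
      have := hK x hx (Sum.inl ⟨y, Icc_subset_Icc ha hb hy⟩)
      rw [obsKernel_inl] at this
      rw [Real.norm_eq_abs, abs_pow]
      exact pow_le_pow_left₀ (abs_nonneg _) this 2
    refine integral_mono_of_nonneg ?_ (hbd.const_mul hi) ?_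
    · filter_upwards [ae_restrict_mem measurableSet_Icc] with y hy
      exact mul_nonneg (sq_nonneg _) (hv.pos ⟨y, Icc_subset_Icc ha hb hy⟩).le
    · filter_upwards [ae_restrict_mem measurableSet_Icc] with y hy
      have := hv.ge y (Icc_subset_Icc ha hb hy)
      rw [mul_comm]
      exact mul_le_mul_of_nonneg_right this (sq_nonneg _)
  have h5 := setIntegral_legendreKernel_sq_le hh hab hx l
  have h6 : 0 ≤ ∑ j ∈ Finset.range (l + 1), legendre j (shiftCenter a b h x) ^ 2 :=
    Finset.sum_nonneg fun j _ => sq_nonneg _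
  refine (mul_le_of_le_one_left ?_ ?_).trans (h4.trans (by gcongr))
  · refine setIntegral_nonneg measurableSet_Icc fun y hy => ?_
    exact mul_nonneg (sq_nonneg _) (hv.pos ⟨y, Icc_subset_Icc ha hb hy⟩).le
  · have : 0 < mass v {x : unitInterval | (x : ℝ) ∈ Icc a b} := hV
    rw [div_le_one (by linarith)]
    linarith

section Pattern

variable {ι : Type*} [Fintype ι] [DecidableEq ι] {μ : ι → Measure Outcome}
  [∀ t, IsProbabilityMeasure (μ t)] {B P : Finset ι}

/-- Tonelli puts the integral over `x` outside. The variance is computed for each `x` and the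
Legendre squares are averaged over `x` only afterwards, which keeps the bound linear in `l`. -/
theorem lintegral_patternInd_mul_sq_le (hv : IsRegular lo hi v) (hh : 0 < h)
    (hab : 2 * h ≤ b - a) (ha : 0 ≤ a) (hb : b ≤ 1) (l : ℕ)
    (hμ : ∀ t ∈ B, μ t = choiceLaw v (productInterval a b)) (hPB : P ⊆ B) :
    ∫⁻ X, ENNReal.ofReal (patternInd purchase B P X) *
        (∫⁻ x in Icc a b, ENNReal.ofReal ((∑ s ∈ P, centredKernel a b h l v x (X s)) ^ 2))
      ∂(Measure.pi μ) ≤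
    ENNReal.ofReal (P.card * (hi * (2 * h * ((l + 1) * 3))) /
      (choiceLaw v (productInterval a b)).real purchase *
        ∫ X, patternInd purchase B P X ∂(Measure.pi μ)) := by
  have := hv.isProbabilityMeasure_choiceLaw (productInterval a b)
  have hV := hv.mass_productInterval_pos ha hb (by linarith : a < b)
  have hi0 := hv.hi_pos
  set p := (choiceLaw v (productInterval a b)).real purchase with hpdef
  have hp : 0 < p := by
    rw [hpdef, hv.choiceLaw_real_purchase]; positivity
  set Q := ∫ X, patternInd purchase B P X ∂(Measure.pi μ)
  have hQ : 0 ≤ Q := integral_nonneg fun X => patternInd_nonneg X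
  have hmeas : Measurable fun z : (ι → Outcome) × ℝ =>
      ∑ s ∈ P, centredKernel a b h l v z.2 (z.1 s) :=
    Finset.measurable_sum _ fun s _ => (measurable_centredKernel hv a b h l).comp
      (measurable_snd.prodMk ((measurable_pi_apply s).comp measurable_fst))
  calc _ = ∫⁻ X, (∫⁻ x in Icc a b, ENNReal.ofReal (patternInd purchase B P X *
          (∑ s ∈ P, centredKernel a b h l v x (X s)) ^ 2)) ∂(Measure.pi μ) := by
        refine lintegral_congr fun X => ?_
        rw [← lintegral_const_mul' _ _ ENNReal.ofReal_ne_top]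
        simp_rw [ENNReal.ofReal_mul (patternInd_nonneg X)]
    _ = ∫⁻ x in Icc a b, ∫⁻ X, ENNReal.ofReal (patternInd purchase B P X *
          (∑ s ∈ P, centredKernel a b h l v x (X s)) ^ 2) ∂(Measure.pi μ) := by
        refine lintegral_lintegral_swap (Measurable.aemeasurable ?_)
        exact (((measurable_patternInd measurableSet_purchase).comp measurable_fst).mul
          (hmeas.pow_const 2)).ennreal_ofReal
    _ ≤ ∫⁻ x in Icc a b, ENNReal.ofReal (P.card * (hi * (2 * h *
          ∑ j ∈ Finset.range (l + 1), legendre j (shiftCenter a b h x) ^ 2)) / p * Q) := by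
        refine setLIntegral_mono_ae' measurableSet_Icc (ae_of_all _ fun x hx => ?_)
        obtain ⟨K, hK⟩ := exists_abs_centredKernel_le v hh hab l hx
        have hm : Measurable (centredKernel a b h l v x) :=
          (measurable_centredKernel hv a b h l).comp measurable_prodMk_left
        obtain ⟨i1, i2⟩ := integral_patternInd_mul_sq measurableSet_purchase hμ hPB hp.ne' hm hK
          (setIntegral_centredKernel hv hh hab ha hb l hx)
        rw [← ofReal_integral_eq_lintegral_ofReal i1 (ae_of_all _ fun X =>
          mul_nonneg (patternInd_nonneg X) (sq_nonneg _))]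
        refine ENNReal.ofReal_le_ofReal ?_
        refine i2.trans_le ?_
        have := setIntegral_centredKernel_sq_le hv hh hab ha hb l hx
        have hcard : (0 : ℝ) ≤ P.card := by positivity
        exact mul_le_mul_of_nonneg_right (div_le_div_of_nonneg_right
          (mul_le_mul_of_nonneg_left this hcard) hp.le) hQ
    _ = ENNReal.ofReal (∫ x in Icc a b, P.card * (hi * (2 * h *
          ∑ j ∈ Finset.range (l + 1), legendre j (shiftCenter a b h x) ^ 2)) / p * Q) := by
        refine (ofReal_integral_eq_lintegral_ofReal ?_ (ae_of_all _ fun x => ?_)).symm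
        · exact (((((integrable_finsetSum _ fun j _ =>
            integrableOn_legendre_shiftCenter_sq hh a b j).const_mul _).const_mul _).const_mul
              _).div_const _).mul_const _
        · simp only [Pi.zero_apply]
          have h6 : 0 ≤ ∑ j ∈ Finset.range (l + 1), legendre j (shiftCenter a b h x) ^ 2 :=
            Finset.sum_nonneg fun j _ => sq_nonneg _
          positivity
    _ ≤ _ := by
        refine ENNReal.ofReal_le_ofReal ?_
        rw [integral_mul_const, integral_div, integral_const_mul, integral_const_mul,
          integral_const_mul, integral_finsetSum _ fun j _ =>
            integrableOn_legendre_shiftCenter_sq hh a b j]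
        gcongr
        calc _ ≤ ∑ _j ∈ Finset.range (l + 1), (3 : ℝ) := Finset.sum_le_sum fun j _ =>
              (setIntegral_legendre_shiftCenter_sq_le hh hab j).trans (by linarith)
          _ = (l + 1) * 3 := by simp

end Pattern

end Centred

end ContAssort

/-! ### Estimation error on a fixed purchase pattern. -/

namespace ContAssort

open MeasureTheory Set

section BlockError

variable {a b h lo hi C : ℝ} {v : ℝ → ℝ}

/-- Strong smoothness with constant `C`. -/
structure IsStronglySmoothWith (C : ℝ) (v : ℝ → ℝ) : Prop where
  pos : 0 < C
  contDiffOn : ContDiffOn ℝ (⊤ : ℕ∞) v (Ioo 0 1)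
  bound : ∀ y ∈ Ioo (0 : ℝ) 1, ∀ l : ℕ, 1 ≤ l →
    |iteratedDeriv l v y / (Nat.factorial (l + 1) : ℝ)| < C

/-- The bound for the error of the estimate when there are `k` purchases and the normalization
is `e`. -/
noncomputable def patternBound (h hi C p V : ℝ) (k l : ℕ) (e : ℝ) : ℝ :=
  Real.sqrt ((k + 1) * (l + 1)) * (3 * hi / p + 1 / (2 * h)) / e +
    k / (e * V) * (4 * C * expSeries * Real.sqrt (l + 2) * Real.exp (-1) ^ (l + 1)) +
    hi * |k / (e * V) - 1|

variable {ι : Type*} [Fintype ι] [DecidableEq ι] {μ : ι → Measure Outcome}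
  [∀ t, IsProbabilityMeasure (μ t)] {B P : Finset ι}

/-- The error is noise, plus bias scaled by `k / (e V)`, plus the normalization error `v (k / (e V)
- 1)`. The inequality `|Y| ≤ Y² / (2s) + s / 2` for the noise replaces Cauchy–Schwarz, so that only
second moments are integrated; `s` is free for balancing. -/
theorem abs_estimate_sub_le (hv : IsRegular lo hi v) (hh : 0 < h)
    (hab : 2 * h ≤ b - a) (ha : 0 ≤ a) (hb : b ≤ 1) (l : ℕ) (hPB : P ⊆ B) {e s : ℝ} (he : 0 < e)
    (hs : 0 < s) {X : ι → Outcome} (hX : patternInd purchase B P X ≠ 0) {x : ℝ}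
    (hx : x ∈ Icc a b) :
    |1 / (e * h) * ∑ t ∈ P, obsKernel a b h l x (X t) - v x| ≤
      1 / (e * h) / (2 * s) * (∑ t ∈ P, centredKernel a b h l v x (X t)) ^ 2 +
      (P.card / (e * mass v (productInterval a b)) * |kernelBias a b h l v x| +
        (1 / (e * h) * s / 2 +
          hi * |P.card / (e * mass v (productInterval a b)) - 1|)) := by
  have hV := hv.mass_productInterval_pos ha hb (by linarith : a < b)
  set V := mass v (productInterval a b)
  set k : ℝ := (P.card : ℝ)
  have hk : 0 ≤ k := by positivity
  set Y := ∑ t ∈ P, centredKernel a b h l v x (X t) with hY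
  have h1 : ∑ t ∈ P, obsKernel a b h l x (X t) =
      Y + k * (h / V * (v x + kernelBias a b h l v x)) := by
    rw [← obsMean_eq hv hh hab ha hb l hx, hY, ← nsmul_eq_mul, ← Finset.sum_const,
      ← Finset.sum_add_distrib]
    refine Finset.sum_congr rfl fun t ht => ?_
    rw [centredKernel, if_pos ((mem_iff_of_patternInd_ne_zero hX (hPB ht)).mpr ht)]
    ring
  have h2 : 1 / (e * h) * ∑ t ∈ P, obsKernel a b h l x (X t) - v x =
      1 / (e * h) * Y + (k / (e * V) * kernelBias a b h l v x +
        v x * (k / (e * V) - 1)) := by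
    rw [h1]; field_simp; ring
  have hα : 0 ≤ 1 / (e * h) := by positivity
  have h3 : |Y| ≤ Y ^ 2 / (2 * s) + s / 2 := by
    rw [← sub_nonneg]
    have : Y ^ 2 / (2 * s) + s / 2 - |Y| = (|Y| - s) ^ 2 / (2 * s) := by
      rw [sub_sq, sq_abs]; field_simp; ring
    rw [this]; positivity
  have hvx : |v x| ≤ hi := hv.abs_le ⟨x, Icc_subset_Icc ha hb hx⟩
  rw [h2]
  calc _ ≤ |1 / (e * h) * Y| + (|k / (e * V) * kernelBias a b h l v x| +
        |v x * (k / (e * V) - 1)|) :=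
        (abs_add_le _ _).trans (add_le_add_right (abs_add_le _ _) _)
    _ ≤ 1 / (e * h) * (Y ^ 2 / (2 * s) + s / 2) +
        (k / (e * V) * |kernelBias a b h l v x| + hi * |k / (e * V) - 1|) := by
        rw [abs_mul, abs_mul, abs_mul, abs_of_nonneg hα,
          abs_of_nonneg (show 0 ≤ k / (e * V) by positivity)]
        gcongr
    _ = _ := by ring

/-- The function `F` stands for an estimate whose order and normalization depend on `X`; it has to
agree with a fixed order `l` and normalization `e` only on the pattern event. -/
theorem lintegral_patternInd_mul_error_le (hv : IsRegular lo hi v) (hC : IsStronglySmoothWith C v)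
    (hh : 0 < h) (hh' : h ≤ Real.exp (-1)) (hab : 2 * h ≤ b - a) (ha : 0 ≤ a) (hb : b ≤ 1) (l : ℕ)
    (hμ : ∀ t ∈ B, μ t = choiceLaw v (productInterval a b)) (hPB : P ⊆ B) {e : ℝ} (he : 0 < e)
    {F : (ι → Outcome) → ℝ → ℝ}
    (hF : ∀ X, patternInd purchase B P X ≠ 0 → ∀ x ∈ Icc a b,
      F X x = 1 / (e * h) * ∑ t ∈ P, obsKernel a b h l x (X t)) :
    ∫⁻ X, ENNReal.ofReal (patternInd purchase B P X) *
        (∫⁻ x in Icc a b, ENNReal.ofReal |F X x - v x|) ∂(Measure.pi μ) ≤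
      ENNReal.ofReal ((∫ X, patternInd purchase B P X ∂(Measure.pi μ)) *
        patternBound h hi C ((choiceLaw v (productInterval a b)).real purchase)
          (mass v (productInterval a b)) P.card l e) := by
  have hprob := hv.isProbabilityMeasure_choiceLaw (productInterval a b)
  have hV := hv.mass_productInterval_pos ha hb (by linarith : a < b)
  have hi0 := hv.hi_pos
  have hpV := hv.choiceLaw_real_purchase (productInterval a b)
  set V := mass v (productInterval a b)
  set p := (choiceLaw v (productInterval a b)).real purchase
  have hp : 0 < p := by rw [hpV]; positivity
  have hC0 := hC.pos
  have hexp := expSeries_pos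
  set k : ℝ := (P.card : ℝ) with hkdef
  have hk : 0 ≤ k := by positivity
  -- The balancing scale: the integrated variance is of order `k (l + 1)`. The `+ 1` on `k` keeps it
  -- positive when there are no purchases.
  set s := Real.sqrt ((k + 1) * (l + 1)) with hsdef
  have hs : 0 < s := Real.sqrt_pos.mpr (by positivity)
  have hss : s * s = (k + 1) * (l + 1) := Real.mul_self_sqrt (by positivity)
  set Q := ∫ X, patternInd purchase B P X ∂(Measure.pi μ) with hQdef
  have hQ : 0 ≤ Q := integral_nonneg fun X => patternInd_nonneg X
  have hQ' : ∫⁻ X, ENNReal.ofReal (patternInd purchase B P X) ∂(Measure.pi μ) =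
      ENNReal.ofReal Q := by
    refine (ofReal_integral_eq_lintegral_ofReal ?_ (ae_of_all _ fun X => patternInd_nonneg X)).symm
    refine Integrable.of_bound (measurable_patternInd measurableSet_purchase).aestronglyMeasurable
      1 (ae_of_all _ fun X => ?_)
    rw [Real.norm_eq_abs, abs_of_nonneg (patternInd_nonneg X)]
    exact Finset.prod_le_one (fun t _ => patternFactor_nonneg t _)
      fun t _ => patternFactor_le_one t _
  set A := 1 / (e * h) / (2 * s) with hA
  set bc := 4 * C * expSeries * Real.sqrt (l + 2) * Real.exp (-1) ^ (l + 1) with hbc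
  set R := k / (e * V) * bc + (1 / (e * h) * s / 2 + hi * |k / (e * V) - 1|) with hR
  have hR0 : 0 ≤ R := by positivity
  have hA0 : 0 ≤ A := by positivity
  have hinner : ∀ X, patternInd purchase B P X ≠ 0 →
      ∫⁻ x in Icc a b, ENNReal.ofReal |F X x - v x| ≤
      ENNReal.ofReal A * (∫⁻ x in Icc a b,
        ENNReal.ofReal ((∑ t ∈ P, centredKernel a b h l v x (X t)) ^ 2)) + ENNReal.ofReal R := by
    intro X hX
    have hm : Measurable fun x => ∑ t ∈ P, centredKernel a b h l v x (X t) :=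
      Finset.measurable_sum _ fun t _ =>
        (measurable_centredKernel hv a b h l).comp (measurable_id.prodMk measurable_const)
    calc _ ≤ ∫⁻ x in Icc a b, (ENNReal.ofReal A *
            ENNReal.ofReal ((∑ t ∈ P, centredKernel a b h l v x (X t)) ^ 2) +
          (ENNReal.ofReal (k / (e * V)) * ENNReal.ofReal |kernelBias a b h l v x| +
            ENNReal.ofReal (1 / (e * h) * s / 2 + hi * |k / (e * V) - 1|))) := by
          refine setLIntegral_mono_ae' measurableSet_Icc (ae_of_all _ fun x hx => ?_)
          rw [hF X hX x hx, ← ENNReal.ofReal_mul hA0, ← ENNReal.ofReal_mul (by positivity),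
            ← ENNReal.ofReal_add (by positivity) (by positivity),
            ← ENNReal.ofReal_add (by positivity) (by positivity)]
          exact ENNReal.ofReal_le_ofReal
            (abs_estimate_sub_le hv hh hab ha hb l hPB he hs hX hx)
      _ = ENNReal.ofReal A * (∫⁻ x in Icc a b,
            ENNReal.ofReal ((∑ t ∈ P, centredKernel a b h l v x (X t)) ^ 2)) +
          (ENNReal.ofReal (k / (e * V)) *
            (∫⁻ x in Icc a b, ENNReal.ofReal |kernelBias a b h l v x|) +
            ENNReal.ofReal (1 / (e * h) * s / 2 + hi * |k / (e * V) - 1|) *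
              volume (Icc a b)) := by
          rw [lintegral_add_left ((hm.pow_const 2).ennreal_ofReal.const_mul _),
            lintegral_add_right _ measurable_const,
            lintegral_const_mul' _ _ ENNReal.ofReal_ne_top,
            lintegral_const_mul' _ _ ENNReal.ofReal_ne_top, setLIntegral_const]
      _ ≤ _ := by
          have hR' : ENNReal.ofReal R = ENNReal.ofReal (k / (e * V)) * ENNReal.ofReal bc +
              ENNReal.ofReal (1 / (e * h) * s / 2 + hi * |k / (e * V) - 1|) := by
            rw [← ENNReal.ofReal_mul (by positivity)]
            exact ENNReal.ofReal_add (by positivity) (by positivity)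
          rw [hR']
          gcongr
          · exact lintegral_abs_kernelBias_le hh hh' hab ha hb hC.contDiffOn hC0 hC.bound
              (fun y hy => hv.abs_le ⟨y, Ioo_subset_Icc_self hy⟩) l
          · refine mul_le_of_le_one_right' ?_
            rw [Real.volume_Icc, ← ENNReal.ofReal_one]
            exact ENNReal.ofReal_le_ofReal (by linarith)
  calc _ ≤ ∫⁻ X, (ENNReal.ofReal A * (ENNReal.ofReal (patternInd purchase B P X) *
          (∫⁻ x in Icc a b,
            ENNReal.ofReal ((∑ t ∈ P, centredKernel a b h l v x (X t)) ^ 2))) +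
          ENNReal.ofReal (patternInd purchase B P X) * ENNReal.ofReal R) ∂(Measure.pi μ) := by
        refine lintegral_mono fun X => ?_
        by_cases hX : patternInd purchase B P X = 0
        · simp [hX]
        · refine (mul_le_mul_right (hinner X hX) _).trans_eq ?_
          ring
    _ = ENNReal.ofReal A * (∫⁻ X, (ENNReal.ofReal (patternInd purchase B P X) *
          (∫⁻ x in Icc a b,
            ENNReal.ofReal ((∑ t ∈ P, centredKernel a b h l v x (X t)) ^ 2))) ∂(Measure.pi μ)) +
          ENNReal.ofReal Q * ENNReal.ofReal R := by
        rw [lintegral_add_right _ ((measurable_patternInd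
            measurableSet_purchase).ennreal_ofReal.mul_const _),
          lintegral_const_mul' _ _ ENNReal.ofReal_ne_top,
          lintegral_mul_const' _ _ ENNReal.ofReal_ne_top, hQ']
    _ ≤ ENNReal.ofReal A * ENNReal.ofReal (k * (hi * (2 * h * ((l + 1) * 3))) / p * Q) +
          ENNReal.ofReal Q * ENNReal.ofReal R := by
        gcongr
        exact lintegral_patternInd_mul_sq_le hv hh hab ha hb l hμ hPB
    _ = ENNReal.ofReal (Q * (A * (k * (hi * (2 * h * ((l + 1) * 3))) / p) + R)) := by
        rw [← ENNReal.ofReal_mul hA0, ← ENNReal.ofReal_mul hQ,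
          ← ENNReal.ofReal_add (by positivity) (by positivity)]
        congr 1; ring
    _ ≤ _ := by
        refine ENNReal.ofReal_le_ofReal (mul_le_mul_of_nonneg_left ?_ hQ)
        have h1 : A * (k * (hi * (2 * h * ((l + 1) * 3))) / p) ≤ s * (3 * hi / p) / e := by
          have h2 : A * (k * (hi * (2 * h * ((l + 1) * 3))) / p) =
              k * (l + 1) / s * (3 * hi / p) / e := by
            rw [hA]; field_simp
          rw [h2]
          gcongr
          rw [div_le_iff₀ hs, hss]
          gcongr
          linarith
        have h3 : patternBound h hi C p V P.card l e =
            s * (3 * hi / p) / e + R := by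
          rw [patternBound, ← hkdef, ← hsdef, ← hbc, hR]
          field_simp
          ring
        rw [h3]
        linarith

/-- The average of `1 / (e V)`-type terms over the binomial distribution. -/
theorem sum_binomial_abs_sub_le {p q : ℝ} (hp : 0 < p) (hq : 0 < q) (hpq : p + q = 1) {M : ℕ}
    (hM : 0 < M) :
    ∑ k ∈ Finset.range (M + 1), (M.choose k : ℝ) * (p ^ k * q ^ (M - k)) *
      |k / (((M : ℝ) - k + 1) * (p / q)) - 1| ≤
      (1 / p * (p * q / 2 + 1 / q ^ 2) + 1 / q) / Real.sqrt M := by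
  have hM' : (1 : ℝ) ≤ M := by exact_mod_cast hM
  set r := Real.sqrt M with hr
  have hr1 : 1 ≤ r := Real.one_le_sqrt.mpr hM'
  have hrr : r * r = M := Real.mul_self_sqrt (by linarith)
  have hr0 : 0 < r := by linarith
  -- With weight `r M = M^(3/2)`, the inequality between arithmetic and geometric means splits the
  -- deviation `|M p - k| / e` into a variance term and an inverse square of `e`. Both average to
  -- `O(M^(-1/2))`.
  have hterm : ∀ k ∈ Finset.range (M + 1),
      (M.choose k : ℝ) * (p ^ k * q ^ (M - k)) * |k / (((M : ℝ) - k + 1) * (p / q)) - 1| ≤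
      1 / (2 * p * (r * M)) * ((M.choose k : ℝ) * (p ^ k * q ^ (M - k)) * (M * p - k) ^ 2) +
      (r * M) / p * ((M.choose k : ℝ) * (p ^ k * q ^ (M - k)) /
        (((M : ℝ) - k + 1) * ((M : ℝ) - k + 2))) +
      (M.choose k : ℝ) * (p ^ k * q ^ (M - k)) / ((M : ℝ) - k + 1) := by
    intro k hk
    have hk' : (k : ℝ) ≤ M := by
      exact_mod_cast Nat.lt_succ_iff.mp (Finset.mem_range.mp hk)
    set e := (M : ℝ) - k + 1 with he
    have he1 : 1 ≤ e := by linarith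
    have he0 : 0 < e := by linarith
    set β := (M.choose k : ℝ) * (p ^ k * q ^ (M - k))
    have hβ : 0 ≤ β := by positivity
    have h1 : |k / (e * (p / q)) - 1| ≤ |M * p - k| / (p * e) + 1 / e := by
      -- The numerator is `k q - e p = k - M p - p`; its last term comes from the `+ 1` in `e`.
      have h2 : k / (e * (p / q)) - 1 = -(M * p - k) / (p * e) - 1 / e := by
        have : q = 1 - p := by linarith
        field_simp
        rw [this, he]
        ring
      rw [h2]
      refine (abs_sub _ _).trans_eq ?_
      rw [abs_div, abs_neg, abs_of_pos (show 0 < p * e by positivity),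
        abs_of_pos (show 0 < 1 / e by positivity)]
    have h3 : |M * p - k| / e ≤ (M * p - k) ^ 2 / (2 * (r * M)) + (r * M) / (2 * e ^ 2) := by
      set z := |M * p - k|
      rw [← sq_abs (M * p - k), ← sub_nonneg]
      have hM0 : (0 : ℝ) < M := by linarith
      have : z ^ 2 / (2 * (r * M)) + (r * M) / (2 * e ^ 2) - z / e =
          (z - r * M / e) ^ 2 / (2 * (r * M)) := by
        field_simp
        ring
      rw [this]
      positivity
    -- As `e ≥ 1`, `e (e + 1) ≤ 2 e²`. This gives the form that `sum_binomial_div_mul_le` averages.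
    have h4 : (r * M) / (2 * e ^ 2) ≤ r * M / (e * (M - k + 2)) := by
      have h5 : (M : ℝ) - k + 2 = e + 1 := by rw [he]; ring
      rw [h5]
      exact div_le_div_of_nonneg_left (by positivity) (by positivity) (by nlinarith)
    calc β * |k / (e * (p / q)) - 1|
        ≤ β * (1 / p * ((M * p - k) ^ 2 / (2 * (r * M)) + r * M / (e * (M - k + 2))) + 1 / e) := by
          gcongr
          refine h1.trans (add_le_add_left ?_ _)
          rw [mul_comm p e, ← div_div, one_div, mul_comm p⁻¹, ← div_eq_mul_inv]
          gcongr
          linarith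
      _ = _ := by
          have h5 : (M : ℝ) - k + 2 ≠ 0 := by linarith
          field_simp
  refine (Finset.sum_le_sum hterm).trans ?_
  rw [Finset.sum_add_distrib, Finset.sum_add_distrib, ← Finset.mul_sum, ← Finset.mul_sum,
    sum_binomial_mul_sq hpq]
  have b1 := sum_binomial_div_le hp.le hq hpq M
  have b2 := sum_binomial_div_mul_le hp.le hq hpq M
  have hM0 : (0 : ℝ) < M := by linarith
  have c1 : 1 / (2 * p * (r * M)) * (M * p * q) = 1 / p * (p * q / 2) / r := by field_simp
  have c2 : r * M / p * (1 / (q ^ 2 * ((M + 1) * (M + 2)))) ≤ 1 / p * (1 / q ^ 2) / r := by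
    have d1 : r * M / p * (1 / (q ^ 2 * ((M + 1) * (M + 2)))) =
        r * M / ((M + 1) * (M + 2)) * (1 / p * (1 / q ^ 2)) := by field_simp
    have d2 : 1 / p * (1 / q ^ 2) / r = 1 / r * (1 / p * (1 / q ^ 2)) := by ring
    rw [d1, d2]
    refine mul_le_mul_of_nonneg_right ?_ (by positivity)
    rw [div_le_div_iff₀ (by positivity) hr0]
    nlinarith
  have c3 : 1 / (q * ((M : ℝ) + 1)) ≤ 1 / q / r := by
    rw [div_div]
    gcongr
    nlinarith
  have c4 : 0 ≤ r * M / p := by positivity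
  calc _ ≤ 1 / (2 * p * (r * M)) * (M * p * q) +
        r * M / p * (1 / (q ^ 2 * ((M + 1) * (M + 2)))) + 1 / (q * ((M : ℝ) + 1)) := by
        gcongr
    _ ≤ 1 / p * (p * q / 2) / r + 1 / p * (1 / q ^ 2) / r + 1 / q / r := by
        rw [c1]; gcongr
    _ = _ := by ring

end BlockError

end ContAssort

/-! ### Expected `L¹` error of a block estimate. -/

namespace ContAssort

open MeasureTheory Set

section BlockEstimate

variable {c lo hi C : ℝ} {v : ℝ → ℝ}

/-- With this kernel order, noise and bias are both bounded by a multiple of `√((M + 1)(1 + log M))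
/ e`, uniformly in the number `k` of purchases. Only the normalization error still has to be
averaged with care. -/
theorem patternBound_kernelOrder_le (hc : 0 < c) (hhi : 0 < hi) (hC : 0 < C) {h p V : ℝ}
    (hh : 0 < h) (hp : 0 < p) (hV : 0 < V) {k M : ℕ} (hM : 0 < M) (hk : k ≤ M) :
    patternBound h hi C p V k (kernelOrder c k) ((M : ℝ) - k + 1) ≤
      (3 * hi / p + 1 / (2 * h) + 4 * C * expSeries / V) *
        Real.sqrt ((M + 1) * (orderConst c * (1 + Real.log M))) / ((M : ℝ) - k + 1) +
      hi * |k / (((M : ℝ) - k + 1) * V) - 1| := by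
  have hk' : (k : ℝ) ≤ M := by exact_mod_cast hk
  set e := (M : ℝ) - k + 1
  have he : 0 < e := by linarith
  set l := kernelOrder c k with hl
  have hord := kernelOrder_add_two_le hc hM hk
  rw [← hl] at hord
  have hexp := expSeries_pos
  have h1 : Real.sqrt ((k + 1) * (l + 1)) ≤
      Real.sqrt ((M + 1) * (orderConst c * (1 + Real.log M))) := by
    refine Real.sqrt_le_sqrt (mul_le_mul (by linarith) (by linarith) (by positivity)
      (by positivity))
  have h2 : k * (Real.sqrt (l + 2) * Real.exp (-1) ^ (l + 1)) ≤
      Real.sqrt ((M + 1) * (orderConst c * (1 + Real.log M))) := by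
    rcases Nat.eq_zero_or_pos k with hk0 | hk0
    · rw [hk0]; simp
    · calc _ = Real.sqrt (l + 2) * (k * Real.exp (-1) ^ (l + 1)) := by ring
        _ ≤ Real.sqrt (l + 2) * Real.sqrt k := by
          gcongr
          exact exp_kernelOrder_le hc hk0
        _ = Real.sqrt (k * (l + 2)) := by
          rw [← Real.sqrt_mul (by positivity), mul_comm]
        _ ≤ _ := Real.sqrt_le_sqrt (mul_le_mul (by linarith) hord (by positivity) (by positivity))
  set r := Real.sqrt ((M + 1) * (orderConst c * (1 + Real.log M)))
  rw [patternBound]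
  refine add_le_add_left ?_ _
  calc _ = (Real.sqrt ((k + 1) * (l + 1)) * (3 * hi / p + 1 / (2 * h)) +
        (k * (Real.sqrt (l + 2) * Real.exp (-1) ^ (l + 1))) * (4 * C * expSeries / V)) / e := by
        field_simp
    _ ≤ (r * (3 * hi / p + 1 / (2 * h)) + r * (4 * C * expSeries / V)) / e := by gcongr
    _ = _ := by ring

theorem sum_patternBound_le (hc : 0 < c) (hhi : 0 < hi) (hC : 0 < C) {h p V : ℝ}
    (hh : 0 < h) (hV : 0 < V) (hpV : p = V / (1 + V)) {M : ℕ} (hM : 0 < M) :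
    ∑ k ∈ Finset.range (M + 1), (M.choose k : ℝ) * ((p ^ k * (1 - p) ^ (M - k)) *
      patternBound h hi C p V k (kernelOrder c k) ((M : ℝ) - k + 1)) ≤
    ((3 * hi / p + 1 / (2 * h) + 4 * C * expSeries / V) * Real.sqrt (orderConst c) / (1 - p) +
      hi * (1 / p * (p * (1 - p) / 2 + 1 / (1 - p) ^ 2) + 1 / (1 - p))) *
        Real.sqrt ((1 + Real.log M) / M) := by
  have hp : 0 < p := by rw [hpV]; positivity
  set q := 1 - p with hq
  have hq' : q = 1 / (1 + V) := by rw [hq, hpV]; field_simp; ring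
  have hq0 : 0 < q := by rw [hq']; positivity
  have hpq : p + q = 1 := by rw [hq]; ring
  have hV' : V = p / q := by rw [hq', hpV]; field_simp
  have hM' : (1 : ℝ) ≤ M := by exact_mod_cast hM
  have hM0 : (0 : ℝ) < M := by linarith
  have hlog : 0 ≤ Real.log M := Real.log_natCast_nonneg M
  have hexp := expSeries_pos
  have hoc := two_le_orderConst hc
  set D := 3 * hi / p + 1 / (2 * h) + 4 * C * expSeries / V
  have hD : 0 ≤ D := by positivity
  set Λ := orderConst c * (1 + Real.log M)
  have hΛ : 0 ≤ Λ := mul_nonneg (by linarith) (by linarith)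
  calc _ ≤ ∑ k ∈ Finset.range (M + 1), (D * Real.sqrt ((M + 1) * Λ) *
        ((M.choose k : ℝ) * (p ^ k * q ^ (M - k)) / ((M : ℝ) - k + 1)) +
        hi * ((M.choose k : ℝ) * (p ^ k * q ^ (M - k)) *
          |k / (((M : ℝ) - k + 1) * (p / q)) - 1|)) := by
        refine Finset.sum_le_sum fun k hk => ?_
        have hk' : k ≤ M := Nat.lt_succ_iff.mp (Finset.mem_range.mp hk)
        have := patternBound_kernelOrder_le hc hhi hC hh hp hV hM hk'
        rw [← mul_assoc]
        refine (mul_le_mul_of_nonneg_left this (by positivity)).trans_eq ?_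
        rw [← hV']
        ring
    _ ≤ D * Real.sqrt ((M + 1) * Λ) * (1 / (q * (M + 1))) +
        hi * ((1 / p * (p * q / 2 + 1 / q ^ 2) + 1 / q) / Real.sqrt M) := by
        rw [Finset.sum_add_distrib, ← Finset.mul_sum, ← Finset.mul_sum]
        gcongr
        · exact sum_binomial_div_le hp.le hq0 hpq M
        · exact sum_binomial_abs_sub_le hp hq0 hpq hM
    _ ≤ D * (Real.sqrt (orderConst c) / q * Real.sqrt ((1 + Real.log M) / M)) +
        hi * ((1 / p * (p * q / 2 + 1 / q ^ 2) + 1 / q) * Real.sqrt ((1 + Real.log M) / M)) := by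
        rw [mul_assoc]
        gcongr ?_ + ?_
        · refine mul_le_mul_of_nonneg_left ?_ hD
          have hs : Real.sqrt ((M : ℝ) + 1) * Real.sqrt ((M : ℝ) + 1) = M + 1 :=
            Real.mul_self_sqrt (by positivity)
          have hs0 : 0 < Real.sqrt ((M : ℝ) + 1) := Real.sqrt_pos.mpr (by positivity)
          have hsM : Real.sqrt M ≤ Real.sqrt ((M : ℝ) + 1) := Real.sqrt_le_sqrt (by linarith)
          have hsM0 : 0 < Real.sqrt M := Real.sqrt_pos.mpr hM0
          rw [Real.sqrt_mul (by positivity), Real.sqrt_mul (by linarith),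
            Real.sqrt_div (by linarith)]
          set sM := Real.sqrt ((M : ℝ) + 1)
          rw [← hs]
          calc _ = Real.sqrt (orderConst c) / q * (Real.sqrt (1 + Real.log M) / sM) := by
                field_simp
            _ ≤ _ := by gcongr
        · refine mul_le_mul_of_nonneg_left ?_ hhi.le
          rw [div_eq_mul_inv]
          refine mul_le_mul_of_nonneg_left ?_ (by positivity)
          rw [← Real.sqrt_inv, inv_eq_one_div]
          exact Real.sqrt_le_sqrt (by gcongr; linarith)
    _ = _ := by ring

theorem measurable_numPurchases {n : ℕ} (M i : ℕ) :
    Measurable fun X : Fin n → Outcome => numPurchases M X i := by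
  unfold numPurchases
  simp_rw [Finset.card_filter]
  refine Finset.measurable_sum _ fun s _ => Measurable.ite ?_ measurable_const measurable_const
  have : {X : Fin n → Outcome | (X s).isLeft = true} = (fun X => X s) ⁻¹' purchase := by
    ext X; simp [mem_purchase_iff]
  rw [this]
  exact measurable_pi_apply s measurableSet_purchase

theorem numNoPurchases_add_numPurchases {n : ℕ} (M : ℕ) (X : Fin n → Outcome) (i : ℕ) :
    numNoPurchases M X i + numPurchases M X i = (block M i : Finset (Fin n)).card := by
  unfold numNoPurchases numPurchases
  rw [add_comm, ← Finset.card_filter_add_card_filter_not (s := block M i)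
    (fun s => (X s).isLeft = true)]
  congr 2
  refine Finset.filter_congr fun s _ => ?_
  cases X s <;> simp

theorem blockEstimate_of_mem {n : ℕ} (c : ℝ) (M : ℕ) (X : Fin n → Outcome) (i : ℕ) {x : ℝ}
    (hx : x ∈ Icc (testLeft c i) (testRight c i)) :
    blockEstimate c M X i x = 1 / (((numNoPurchases M X i : ℝ) + 1) * bandwidth c) *
      ∑ s ∈ block M i, obsKernel (testLeft c i) (testRight c i) (bandwidth c)
        (kernelOrder c (numPurchases M X i)) x (X s) := by
  rw [blockEstimate, if_pos hx]
  simp_rw [sumElim_legendreKernel]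

theorem measurable_numNoPurchases {n : ℕ} (M i : ℕ) :
    Measurable fun X : Fin n → Outcome => (numNoPurchases M X i : ℝ) := by
  have h1 : ∀ X : Fin n → Outcome, (numNoPurchases M X i : ℝ) =
      ((block M i : Finset (Fin n)).card : ℝ) - (numPurchases M X i : ℝ) := fun X => by
    rw [← numNoPurchases_add_numPurchases M X i]; push_cast; ring
  have h2 : Measurable fun X : Fin n → Outcome => (numPurchases M X i : ℝ) :=
    (measurable_of_countable fun k : ℕ => (k : ℝ)).comp (measurable_numPurchases M i)
  simp_rw [h1]
  exact measurable_const.sub h2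

/-- The number of purchases takes countably many values, so it suffices to treat each order
separately. -/
theorem measurable_obsKernel_kernelOrder (a b h c : ℝ) : Measurable fun w : ℕ × (ℝ × Outcome) =>
    obsKernel a b h (kernelOrder c w.1) w.2.1 w.2.2 :=
  measurable_from_prod_countable_right fun k => measurable_obsKernel a b h (kernelOrder c k)

theorem measurable_obsKernel_numPurchases {n : ℕ} (a b h c : ℝ) (M i : ℕ) (s : Fin n) :
    Measurable fun z : (Fin n → Outcome) × ℝ =>
      obsKernel a b h (kernelOrder c (numPurchases M z.1 i)) z.2 (z.1 s) := by
  have hA : Measurable fun z : (Fin n → Outcome) × ℝ => numPurchases M z.1 i :=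
    (measurable_numPurchases M i).comp measurable_fst
  have hz : Measurable fun z : (Fin n → Outcome) × ℝ => (z.2, z.1 s) :=
    measurable_snd.prodMk ((measurable_pi_apply s).comp measurable_fst)
  have := (measurable_obsKernel_kernelOrder a b h c).comp (hA.prodMk hz)
  exact this

theorem measurable_sum_obsKernel {n : ℕ} (a b h c : ℝ) (M i : ℕ) :
    Measurable fun z : (Fin n → Outcome) × ℝ => ∑ s ∈ block M i,
      obsKernel a b h (kernelOrder c (numPurchases M z.1 i)) z.2 (z.1 s) :=
  Finset.measurable_sum _ fun s _ => measurable_obsKernel_numPurchases a b h c M i s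

theorem measurable_blockEstimate {n : ℕ} (c : ℝ) (M i : ℕ) :
    Measurable fun z : (Fin n → Outcome) × ℝ => blockEstimate c M z.1 i z.2 := by
  have h1 : (fun z : (Fin n → Outcome) × ℝ => blockEstimate c M z.1 i z.2) =
      (Prod.snd ⁻¹' Icc (testLeft c i) (testRight c i)).indicator
        (fun z => 1 / (((numNoPurchases M z.1 i : ℝ) + 1) * bandwidth c) *
          ∑ s ∈ block M i, obsKernel (testLeft c i) (testRight c i) (bandwidth c)
            (kernelOrder c (numPurchases M z.1 i)) z.2 (z.1 s)) := by
    ext z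
    by_cases hz : z.2 ∈ Icc (testLeft c i) (testRight c i)
    · rw [indicator_of_mem (by exact hz), blockEstimate_of_mem c M z.1 i hz]
    · rw [indicator_of_notMem (by exact hz), blockEstimate, if_neg hz]
  rw [h1]
  refine Measurable.indicator (Measurable.mul ?_ (measurable_sum_obsKernel _ _ _ c M i))
    (measurable_snd measurableSet_Icc)
  exact ((((measurable_numNoPurchases M i).comp measurable_fst).add_const 1).mul_const _).const_div _

theorem IsRegular.measurable_comp_projIcc (hv : IsRegular lo hi v) :
    Measurable fun x : ℝ => v (projIcc (0 : ℝ) 1 zero_le_one x) :=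
  hv.measurable.comp continuous_projIcc.measurable

theorem measurable_lintegral_blockEstimate_sub {n : ℕ} (hv : IsRegular lo hi v) (c : ℝ)
    (M i : ℕ) {a b : ℝ} (ha : 0 ≤ a) (hb : b ≤ 1) :
    Measurable fun X : Fin n → Outcome =>
      ∫⁻ x in Icc a b, ENNReal.ofReal |blockEstimate c M X i x - v x| := by
  -- `v` is known to be measurable only on the unit interval. Composition with the projection gives
  -- a function that is measurable on `ℝ` and unchanged on `[a, b]`.
  have h1 : ∀ X : Fin n → Outcome,
      ∫⁻ x in Icc a b, ENNReal.ofReal |blockEstimate c M X i x - v x| =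
      ∫⁻ x in Icc a b, ENNReal.ofReal
        |blockEstimate c M X i x - v (projIcc (0 : ℝ) 1 zero_le_one x)| := fun X =>
    setLIntegral_congr_fun measurableSet_Icc fun x hx => by
      simp only [projIcc_of_mem zero_le_one (Icc_subset_Icc ha hb hx)]
  simp_rw [h1]
  refine Measurable.lintegral_prod_right' (f := fun z : (Fin n → Outcome) × ℝ => ENNReal.ofReal
    |blockEstimate c M z.1 i z.2 - v (projIcc (0 : ℝ) 1 zero_le_one z.2)|) ?_
  exact (((measurable_blockEstimate c M i).sub
    (hv.measurable_comp_projIcc.comp measurable_snd)).abs).ennreal_ofReal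

theorem two_le_numTests (hc0 : 0 < c) (hc1 : c < 1) : 2 ≤ numTests c := by
  have h1 : (1 : ℝ) < 1 / c := by rw [lt_div_iff₀ hc0]; linarith
  have h2 : (1 : ℝ) < numTests c := h1.trans_le (Nat.le_ceil _)
  exact_mod_cast h2

theorem testLeft_nonneg (hc0 : 0 < c) (hc1 : c < 1) (i : ℕ) : 0 ≤ testLeft c i := by
  have h1 : (2 : ℝ) ≤ numTests c := by exact_mod_cast two_le_numTests hc0 hc1
  unfold testLeft
  exact mul_nonneg (div_nonneg (by positivity) (by linarith)) (by linarith)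

theorem testRight_le_one (hc0 : 0 < c) (hc1 : c < 1) {i : ℕ} (hi : i < numTests c) :
    testRight c i ≤ 1 := by
  have h1 : (2 : ℝ) ≤ numTests c := by exact_mod_cast two_le_numTests hc0 hc1
  have h2 : (i : ℝ) + 1 ≤ numTests c := by exact_mod_cast hi
  unfold testRight testLeft
  have : (i : ℝ) / ((numTests c : ℝ) - 1) ≤ 1 := by
    rw [div_le_one (by linarith)]; linarith
  nlinarith

theorem two_mul_bandwidth_le (i : ℕ) : 2 * bandwidth c ≤ testRight c i - testLeft c i := by
  have : bandwidth c ≤ c / 2 := min_le_left _ _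
  unfold testRight
  linarith

/-- The expected `L¹` error of the estimate from the `i`-th block. -/
theorem exists_lintegral_blockEstimate_le (hc0 : 0 < c) (hc1 : c < 1) (hv : IsRegular lo hi v)
    (hC : IsStronglySmoothWith C v) {i : ℕ} (hiN : i < numTests c) :
    ∃ K, 0 ≤ K ∧ ∀ M : ℕ, 0 < M → ∀ (n : ℕ) (μ : Fin n → Measure Outcome),
      (∀ t, IsProbabilityMeasure (μ t)) →
      (∀ t ∈ (block M i : Finset (Fin n)), μ t = choiceLaw v (testSet c i)) →
      (block M i : Finset (Fin n)).card = M →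
      ∫⁻ X, (∫⁻ x in Icc (testLeft c i) (testRight c i),
        ENNReal.ofReal |blockEstimate c M X i x - v x|) ∂(Measure.pi μ) ≤
      ENNReal.ofReal (K * Real.sqrt ((1 + Real.log M) / M)) := by
  set a := testLeft c i with ha_def
  set b := testRight c i with hb_def
  have ha : 0 ≤ a := testLeft_nonneg hc0 hc1 i
  have hb : b ≤ 1 := testRight_le_one hc0 hc1 hiN
  have hh := bandwidth_pos hc0
  have hh' := bandwidth_le_exp c
  have hab : 2 * bandwidth c ≤ b - a := two_mul_bandwidth_le i
  have hhi := hv.hi_pos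
  have hC0 := hC.pos
  have hexp := expSeries_pos
  have hV := hv.mass_productInterval_pos ha hb (by linarith : a < b)
  set h := bandwidth c
  set p := (choiceLaw v (productInterval a b)).real purchase
  have hpV : p = _ := hv.choiceLaw_real_purchase (productInterval a b)
  set V := mass v (productInterval a b)
  have hp : 0 < p := by rw [hpV]; positivity
  have hq : 0 < 1 - p := by
    have : 1 - p = 1 / (1 + V) := by rw [hpV]; field_simp; ring
    rw [this]; positivity
  refine ⟨(3 * hi / p + 1 / (2 * h) + 4 * C * expSeries / V) * Real.sqrt (orderConst c) / (1 - p) +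
    hi * (1 / p * (p * (1 - p) / 2 + 1 / (1 - p) ^ 2) + 1 / (1 - p)), ?_,
    fun M hM n μ hprob hμ hcard => ?_⟩
  rotate_left
  · have hprob' := hv.isProbabilityMeasure_choiceLaw (productInterval a b)
    replace hμ : ∀ t ∈ (block M i : Finset (Fin n)), μ t = choiceLaw v (productInterval a b) := hμ
    calc _ = ∫⁻ X, ∑ P ∈ (block M i : Finset (Fin n)).powerset,
          ENNReal.ofReal (patternInd purchase (block M i) P X) * (∫⁻ x in Icc a b,
            ENNReal.ofReal |blockEstimate c M X i x - v x|) ∂(Measure.pi μ) := by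
          refine lintegral_congr fun X => ?_
          rw [← Finset.sum_mul, ← ENNReal.ofReal_sum_of_nonneg fun P _ => patternInd_nonneg X,
            sum_patternInd, ENNReal.ofReal_one, one_mul]
      _ = ∑ P ∈ (block M i : Finset (Fin n)).powerset, ∫⁻ X,
          ENNReal.ofReal (patternInd purchase (block M i) P X) * (∫⁻ x in Icc a b,
            ENNReal.ofReal |blockEstimate c M X i x - v x|) ∂(Measure.pi μ) :=
          lintegral_finsetSum _ fun P _ =>
            (measurable_patternInd measurableSet_purchase).ennreal_ofReal.mul
              (measurable_lintegral_blockEstimate_sub hv c M i ha hb)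
      _ ≤ ∑ P ∈ (block M i : Finset (Fin n)).powerset,
          ENNReal.ofReal ((p ^ P.card * (1 - p) ^ (M - P.card)) *
            patternBound h hi C p V P.card (kernelOrder c P.card) ((M : ℝ) - P.card + 1)) := by
          refine Finset.sum_le_sum fun P hP => ?_
          have hPB := Finset.mem_powerset.mp hP
          have hPM : (P.card : ℝ) ≤ M := by
            rw [← hcard]; exact_mod_cast Finset.card_le_card hPB
          have hind := integral_patternInd (P := P) measurableSet_purchase hμ hPB
          rw [hcard] at hind
          refine (lintegral_patternInd_mul_error_le hv hC hh hh' hab ha hb (kernelOrder c P.card)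
            hμ hPB (e := (M : ℝ) - P.card + 1) (by linarith) ?_).trans_eq ?_
          · intro X hX x hx
            -- On the pattern event the purchases are exactly those in `P`, which fixes the random
            -- order and the random normalization.
            have hfil : ((block M i : Finset (Fin n)).filter fun s => (X s).isLeft) = P := by
              ext t
              rw [Finset.mem_filter]
              constructor
              · rintro ⟨h1, h2⟩
                exact (mem_iff_of_patternInd_ne_zero hX h1).mp ((mem_purchase_iff _).mpr h2)
              · intro h1
                exact ⟨hPB h1, (mem_purchase_iff _).mp
                  ((mem_iff_of_patternInd_ne_zero hX (hPB h1)).mpr h1)⟩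
            have hA : numPurchases M X i = P.card := by rw [numPurchases, hfil]
            have hE : (numNoPurchases M X i : ℝ) + 1 = (M : ℝ) - P.card + 1 := by
              have h1 := numNoPurchases_add_numPurchases M X i
              rw [hcard, hA] at h1
              have h2 : (numNoPurchases M X i : ℝ) + P.card = M := by exact_mod_cast h1
              linarith
            rw [blockEstimate_of_mem c M X i hx, hA, hE]
            congr 1
            refine (Finset.sum_subset hPB fun t ht htP => ?_).symm
            rw [obsKernel, if_neg fun h1 => htP ((mem_iff_of_patternInd_ne_zero hX ht).mp h1)]
          · rw [hind]
      _ = ENNReal.ofReal (∑ k ∈ Finset.range (M + 1), (M.choose k : ℝ) *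
          ((p ^ k * (1 - p) ^ (M - k)) *
            patternBound h hi C p V k (kernelOrder c k) ((M : ℝ) - k + 1))) := by
          rw [← ENNReal.ofReal_sum_of_nonneg]
          -- The bound depends on a pattern only through its size, so grouping by size yields
          -- binomial weights.
          · rw [Finset.sum_powerset_apply_card (fun k => (p ^ k * (1 - p) ^ (M - k)) *
              patternBound h hi C p V k (kernelOrder c k) ((M : ℝ) - k + 1)), hcard]
            simp_rw [nsmul_eq_mul]
          · intro P hP
            have hPM : (P.card : ℝ) ≤ M := by
              rw [← hcard]; exact_mod_cast Finset.card_le_card (Finset.mem_powerset.mp hP)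
            have he : 0 < (M : ℝ) - P.card + 1 := by linarith
            unfold patternBound
            positivity
      _ ≤ _ := ENNReal.ofReal_le_ofReal (sum_patternBound_le hc0 hhi hC0 hh hV hpV hM)
  · positivity

end BlockEstimate

end ContAssort

/-! ### Measurability in the assortment, and the law of the history. -/

namespace ContAssort

open MeasureTheory Set ProbabilityTheory

section Measurability

variable {c lo hi : ℝ} {v : ℝ → ℝ}

theorem measurable_volume_inter {B : Set unitInterval} (hB : MeasurableSet B) :
    Measurable fun S : Assortment c => volume (S.carrier ∩ B) := by
  rw [measurable_iff_comap_le]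
  exact le_iSup (fun B : {B : Set unitInterval // MeasurableSet B} =>
    MeasurableSpace.comap (fun S : Assortment c => volume (S.carrier ∩ B.1)) inferInstance) ⟨B, hB⟩

/-- For indicators this is the definition of the σ-algebra on assortments; sums and monotone limits
do the rest. -/
theorem measurable_setLIntegral {f : unitInterval → ENNReal} (hf : Measurable f) :
    Measurable fun S : Assortment c => ∫⁻ x in S.carrier, f x := by
  refine Measurable.ennreal_induction
    (motive := fun f => Measurable fun S : Assortment c => ∫⁻ x in S.carrier, f x)
    (fun r B hB => ?_) (fun f g _ hf hg ihf ihg => ?_) (fun f hf hmono ih => ?_) hf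
  · simp_rw [lintegral_indicator hB, lintegral_const, Measure.restrict_apply MeasurableSet.univ,
      univ_inter, Measure.restrict_apply hB, inter_comm B]
    exact (measurable_volume_inter hB).const_mul r
  · simp_rw [Pi.add_apply, lintegral_add_left hf]
    exact ihf.add ihg
  · simp_rw [lintegral_iSup hf hmono]
    exact Measurable.iSup ih

theorem measurable_setIntegral_of_nonneg {f : unitInterval → ℝ} (hf : Measurable f)
    (h0 : ∀ x, 0 ≤ f x) : Measurable fun S : Assortment c => ∫ x in S.carrier, f x := by
  simp_rw [integral_eq_lintegral_of_nonneg_ae (ae_of_all _ h0) hf.aestronglyMeasurable]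
  exact (measurable_setLIntegral hf.ennreal_ofReal).ennreal_toReal

theorem measurable_choiceLaw (hv : IsRegular lo hi v) :
    Measurable fun S : Assortment c => choiceLaw v S.carrier := by
  refine Measure.measurable_of_measurable_coe _ fun A hA => ?_
  have h1 : ∀ S : Assortment c, choiceLaw v S.carrier A =
      ENNReal.ofReal (1 / (1 + mass v S.carrier)) *
        ((∫⁻ x in S.carrier, (Sum.inl ⁻¹' A).indicator (fun x => ENNReal.ofReal (v x)) x) +
          Measure.dirac (Sum.inr ()) A) := fun S => by
    rw [choiceLaw, Measure.smul_apply, Measure.add_apply, Measure.map_apply measurable_inl hA,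
      withDensity_apply _ (measurable_inl hA), lintegral_indicator (measurable_inl hA), smul_eq_mul]
  simp_rw [h1]
  refine Measurable.mul ?_ (Measurable.add ?_ measurable_const)
  · refine Measurable.ennreal_ofReal (Measurable.const_div (Measurable.const_add ?_ 1) 1)
    exact measurable_setIntegral_of_nonneg hv.measurable fun x => (hv.pos x).le
  · exact measurable_setLIntegral (hv.measurable.ennreal_ofReal.indicator (measurable_inl hA))

/-- The history extended by the assortment that the policy prescribes and an outcome. -/
def extend {t : ℕ} (π : Policy c) (h : History c t) (x : Outcome) : History c (t + 1) :=
  Fin.snoc (α := fun _ => Assortment c × Outcome) h (π.act t h, x)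

theorem measurable_extend {t : ℕ} (π : Policy c) :
    Measurable fun p : History c t × Outcome => extend π p.1 p.2 := by
  refine measurable_pi_lambda _ fun i => ?_
  induction i using Fin.lastCases with
  | last =>
    simp only [extend, Fin.snoc_last]
    exact ((π.measurable_act t).comp measurable_fst).prodMk measurable_snd
  | cast i =>
    simp only [extend, Fin.snoc_castSucc]
    exact (measurable_pi_apply i).comp measurable_fst

/-- The conditional law of the next outcome. -/
noncomputable def nextOutcome (hv : IsRegular lo hi v) (π : Policy c) (t : ℕ) :
    Kernel (History c t) Outcome :=
  ⟨fun h => choiceLaw v (π.act t h).carrier, (measurable_choiceLaw hv).comp (π.measurable_act t)⟩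

instance (hv : IsRegular lo hi v) (π : Policy c) (t : ℕ) :
    IsMarkovKernel (nextOutcome hv π t) :=
  ⟨fun _ => hv.isProbabilityMeasure_choiceLaw _⟩

theorem historyLaw_succ (v : ℝ → ℝ) (π : Policy c) (t : ℕ) :
    historyLaw v π (t + 1) = (historyLaw v π t).bind fun h =>
      (choiceLaw v (π.act t h).carrier).map (extend π h) := rfl

theorem measurable_map_extend (hv : IsRegular lo hi v) (π : Policy c) (t : ℕ) :
    Measurable fun h : History c t => (choiceLaw v (π.act t h).carrier).map (extend π h) := by
  refine Measure.measurable_of_measurable_coe _ fun A hA => ?_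
  have h1 : ∀ h : History c t, (choiceLaw v (π.act t h).carrier).map (extend π h) A =
      nextOutcome hv π t h (Prod.mk h ⁻¹' ((fun p => extend π p.1 p.2) ⁻¹' A)) := fun h =>
    Measure.map_apply ((measurable_extend π).comp measurable_prodMk_left) hA
  simp_rw [h1]
  exact Kernel.measurable_kernel_prodMk_left (measurable_extend π hA)

theorem lintegral_historyLaw_succ (hv : IsRegular lo hi v) (π : Policy c) (t : ℕ)
    {F : History c (t + 1) → ENNReal} (hF : Measurable F) :
    ∫⁻ h, F h ∂(historyLaw v π (t + 1)) =
      ∫⁻ h, (∫⁻ x, F (extend π h x) ∂(choiceLaw v (π.act t h).carrier)) ∂(historyLaw v π t) := by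
  rw [historyLaw_succ, Measure.lintegral_bind (measurable_map_extend hv π t).aemeasurable
    hF.aemeasurable]
  refine lintegral_congr fun h => ?_
  exact lintegral_map hF ((measurable_extend π).comp measurable_prodMk_left)

theorem isProbabilityMeasure_historyLaw (hv : IsRegular lo hi v) (π : Policy c) (t : ℕ) :
    IsProbabilityMeasure (historyLaw v π t) := by
  induction t with
  | zero => rw [historyLaw]; infer_instance
  | succ t ih =>
    constructor
    rw [← lintegral_one, lintegral_historyLaw_succ hv π t measurable_const]
    have : ∀ h : History c t, ∫⁻ _x : Outcome, 1 ∂(choiceLaw v (π.act t h).carrier) = 1 :=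
      fun h => by
        have := hv.isProbabilityMeasure_choiceLaw (π.act t h).carrier
        simp
    simp_rw [this]
    simp

/-- The outcomes of the first `n` periods of a history. -/
def outcomes {n t : ℕ} (hnt : n ≤ t) (h : History c t) : Fin n → Outcome :=
  fun s => (h (Fin.castLE hnt s)).2

theorem measurable_outcomes {n t : ℕ} (hnt : n ≤ t) :
    Measurable (outcomes hnt : History c t → Fin n → Outcome) :=
  measurable_pi_lambda _ fun s => measurable_snd.comp (measurable_pi_apply (Fin.castLE hnt s))

theorem outcomes_extend_of_le {n t : ℕ} (hnt : n ≤ t) (π : Policy c) (h : History c t)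
    (x : Outcome) : outcomes (hnt.trans (Nat.le_succ t)) (extend π h x) = outcomes hnt h := by
  ext1 s
  have : Fin.castLE (hnt.trans (Nat.le_succ t)) s = (Fin.castLE hnt s).castSucc := rfl
  rw [outcomes, extend, this, Fin.snoc_castSucc, outcomes]

theorem outcomes_extend_self {t : ℕ} (π : Policy c) (h : History c t) (x : Outcome) :
    outcomes le_rfl (extend π h x) = Fin.snoc (α := fun _ => Outcome) (outcomes le_rfl h) x := by
  ext1 s
  induction s using Fin.lastCases with
  | last =>
    have : Fin.castLE le_rfl (Fin.last t) = Fin.last t := rfl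
    rw [outcomes, this, extend, Fin.snoc_last, Fin.snoc_last]
  | cast s =>
    have : Fin.castLE le_rfl s.castSucc = (Fin.castLE le_rfl s).castSucc := rfl
    rw [outcomes, this, extend, Fin.snoc_castSucc, Fin.snoc_castSucc, outcomes]

/-- If the policy offers prescribed assortments in the first `n` periods, then the outcomes in
these periods are independent. -/
theorem map_outcomes_eq_pi (hv : IsRegular lo hi v) (π : Policy c) {n : ℕ}
    {S : ℕ → Set unitInterval} (hS : ∀ t < n, ∀ h : History c t, (π.act t h).carrier = S t)
    {t : ℕ} (ht : t ≤ n) :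
    (historyLaw v π t).map (outcomes le_rfl) =
      Measure.pi fun s : Fin t => choiceLaw v (S s) := by
  have hprob : ∀ S, IsProbabilityMeasure (choiceLaw v S) := hv.isProbabilityMeasure_choiceLaw
  induction t with
  | zero =>
    have := isProbabilityMeasure_historyLaw hv π 0
    refine (Measure.pi_eq fun A hA => ?_).symm
    rw [Measure.map_apply (measurable_outcomes le_rfl) (MeasurableSet.univ_pi hA),
      Finset.univ_eq_empty, Finset.prod_empty]
    have : outcomes le_rfl ⁻¹' (univ.pi A) = (univ : Set (History c 0)) :=
      eq_univ_of_forall fun h => mem_univ_pi.mpr fun i => i.elim0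
    rw [this, measure_univ]
  | succ t ih =>
    refine (Measure.pi_eq fun A hA => ?_).symm
    have hA' : MeasurableSet (univ.pi fun s : Fin t => A s.castSucc) :=
      MeasurableSet.univ_pi fun s => hA _
    rw [Measure.map_apply (measurable_outcomes le_rfl) (MeasurableSet.univ_pi hA),
      ← lintegral_indicator_one (measurable_outcomes le_rfl (MeasurableSet.univ_pi hA)),
      lintegral_historyLaw_succ hv π t (measurable_one.indicator
        (measurable_outcomes le_rfl (MeasurableSet.univ_pi hA)))]
    have h1 : ∀ h : History c t, ∫⁻ x, (outcomes le_rfl ⁻¹' univ.pi A).indicator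
        (1 : History c (t + 1) → ENNReal) (extend π h x) ∂(choiceLaw v (π.act t h).carrier) =
        (outcomes le_rfl ⁻¹' (univ.pi fun s : Fin t => A s.castSucc)).indicator
          (1 : History c t → ENNReal) h * choiceLaw v (S t) (A (Fin.last t)) := by
      intro h
      have h2 : ∀ x, (outcomes le_rfl ⁻¹' univ.pi A).indicator
          (1 : History c (t + 1) → ENNReal) (extend π h x) =
          (outcomes le_rfl ⁻¹' (univ.pi fun s : Fin t => A s.castSucc)).indicator
          (1 : History c t → ENNReal) h * (A (Fin.last t)).indicator 1 x := by
        intro x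
        have h3 : extend π h x ∈ outcomes le_rfl ⁻¹' univ.pi A ↔
            h ∈ outcomes le_rfl ⁻¹' (univ.pi fun s : Fin t => A s.castSucc) ∧
              x ∈ A (Fin.last t) := by
          simp only [mem_preimage, mem_univ_pi, outcomes_extend_self, Fin.forall_fin_succ',
            Fin.snoc_castSucc, Fin.snoc_last]
        by_cases h4 : h ∈ outcomes le_rfl ⁻¹' (univ.pi fun s : Fin t => A s.castSucc) <;>
          by_cases h5 : x ∈ A (Fin.last t) <;>
          simp only [indicator, h3, h4, h5, and_true, and_false, if_true, if_false,
            Pi.one_apply, mul_one, mul_zero]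
      simp_rw [h2]
      rw [lintegral_const_mul _ (measurable_one.indicator (hA _)),
        lintegral_indicator_one (hA _), hS t (by omega) h]
    simp_rw [h1]
    rw [lintegral_mul_const _ (measurable_one.indicator (measurable_outcomes le_rfl hA')),
      lintegral_indicator_one (measurable_outcomes le_rfl hA'),
      ← Measure.map_apply (measurable_outcomes le_rfl) hA', ih (by omega), Measure.pi_pi,
      Fin.prod_univ_castSucc]
    rfl

/-- Later periods leave the first `n` outcomes untouched, and each later outcome integrates out with
total mass 1. -/
theorem lintegral_outcomes (hv : IsRegular lo hi v) (π : Policy c) {n : ℕ}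
    {S : ℕ → Set unitInterval} (hS : ∀ t < n, ∀ h : History c t, (π.act t h).carrier = S t)
    {t : ℕ} (ht : n ≤ t) {F : (Fin n → Outcome) → ENNReal} (hF : Measurable F) :
    ∫⁻ h, F (outcomes ht h) ∂(historyLaw v π t) =
      ∫⁻ X, F X ∂(Measure.pi fun s : Fin n => choiceLaw v (S s)) := by
  induction t, ht using Nat.le_induction with
  | base =>
    rw [← map_outcomes_eq_pi hv π hS le_rfl, lintegral_map hF (measurable_outcomes le_rfl)]
  | succ t ht ih =>
    have hm : Measurable fun h : History c (t + 1) =>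
        F (outcomes (ht.trans (Nat.le_succ t)) h) := hF.comp (measurable_outcomes _)
    rw [lintegral_historyLaw_succ hv π t hm, ← ih]
    refine lintegral_congr fun h => ?_
    have := hv.isProbabilityMeasure_choiceLaw (π.act t h).carrier
    simp_rw [outcomes_extend_of_le ht]
    simp

end Measurability

end ContAssort

/-! ### Revenue is Lipschitz in the preference function. -/

namespace ContAssort

open MeasureTheory Set

section Revenue

variable {c lo hi : ℝ} {u v w : ℝ → ℝ}

theorem IsMarginalRevenue.measurable (hw : IsMarginalRevenue w) :
    Measurable fun x : unitInterval => w x :=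
  (continuousOn_iff_continuous_domRestrict.mp hw.continuousOn).measurable

theorem IsMarginalRevenue.abs_le_one (hw : IsMarginalRevenue w) (x : unitInterval) :
    |w x| ≤ 1 :=
  abs_le.mpr ⟨by linarith [(hw.mem_Icc x x.2).1], (hw.mem_Icc x x.2).2⟩

theorem IsMarginalRevenue.integrable_mul (hw : IsMarginalRevenue w) {f : unitInterval → ℝ}
    {S : Set unitInterval} (hf : IntegrableOn f S) : IntegrableOn (fun x => f x * w x) S :=
  hf.mul_bdd (c := 1) hw.measurable.aestronglyMeasurable
    (ae_of_all _ fun x => by simpa using hw.abs_le_one x)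

theorem IsMarginalRevenue.revenue_nonneg (hw : IsMarginalRevenue w) (hv : IsRegular lo hi v)
    (S : Set unitInterval) : 0 ≤ revenue w v S :=
  div_nonneg (integral_nonneg fun x => mul_nonneg (hv.pos x).le (hw.mem_Icc x x.2).1)
    (by linarith [hv.mass_nonneg S])

theorem IsMarginalRevenue.revenue_le_one (hw : IsMarginalRevenue w) (hv : IsRegular lo hi v)
    (S : Set unitInterval) : revenue w v S ≤ 1 := by
  have h0 := hv.mass_nonneg S
  rw [revenue, div_le_one (by linarith)]
  have h1 : ∫ x : unitInterval in S, v x * w x ≤ mass v S :=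
    integral_mono (hw.integrable_mul (hv.integrable S)) (hv.integrable S) fun x =>
      mul_le_of_le_one_right (hv.pos x).le (hw.mem_Icc x x.2).2
  linarith

theorem IsMarginalRevenue.bddAbove_revenue (hw : IsMarginalRevenue w) (hv : IsRegular lo hi v) :
    BddAbove (range fun S : Assortment c => revenue w v S.carrier) :=
  ⟨1, by rintro _ ⟨S, rfl⟩; exact hw.revenue_le_one hv _⟩

theorem IsMarginalRevenue.gap_nonneg (hw : IsMarginalRevenue w) (hv : IsRegular lo hi v)
    (S₀ : Assortment c) :
    0 ≤ (⨆ S : Assortment c, revenue w v S.carrier) - revenue w v S₀.carrier :=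
  sub_nonneg.mpr (le_ciSup (hw.bddAbove_revenue hv) S₀)

theorem IsMarginalRevenue.gap_le_one (hw : IsMarginalRevenue w) (hv : IsRegular lo hi v)
    (S₀ : Assortment c) :
    (⨆ S : Assortment c, revenue w v S.carrier) - revenue w v S₀.carrier ≤ 1 := by
  have : Nonempty (Assortment c) := ⟨S₀⟩
  have h1 : (⨆ S : Assortment c, revenue w v S.carrier) ≤ 1 :=
    ciSup_le fun S => hw.revenue_le_one hv _
  linarith [hw.revenue_nonneg hv S₀.carrier]

/-- The revenue is Lipschitz in the preference function, for the `L¹` distance. -/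
theorem IsMarginalRevenue.abs_revenue_sub_le (hw : IsMarginalRevenue w) (hv : IsRegular lo hi v)
    (hu : Integrable fun x : unitInterval => u x - v x)
    (hd : ∫ x : unitInterval, |u x - v x| ≤ 1 / 8) (S : Set unitInterval) :
    0 < 1 + mass u S ∧
      |revenue w u S - revenue w v S| ≤ 4 * ∫ x : unitInterval, |u x - v x| := by
  set d := ∫ x : unitInterval, |u x - v x| with hd_def
  have huS : IntegrableOn (fun x : unitInterval => u x - v x) S := hu.integrableOn
  have hvS := hv.integrable S
  have hr0 := hw.revenue_nonneg hv S
  have hr1 := hw.revenue_le_one hv S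
  have hm0 := hv.mass_nonneg S
  have hrv : revenue w v S * (1 + mass v S) = ∫ x : unitInterval in S, v x * w x :=
    div_mul_cancel₀ _ (by linarith)
  have hd0 : ∫ x : unitInterval in S, |u x - v x| ≤ d :=
    setIntegral_le_integral hu.abs (ae_of_all _ fun x => abs_nonneg _)
  have hmass : mass u S = mass v S + ∫ x : unitInterval in S, (u x - v x) := by
    rw [mass, mass, ← integral_add hvS huS]
    exact integral_congr_ae (ae_of_all _ fun x => by simp)
  have hnum : ∫ x : unitInterval in S, u x * w x = (∫ x : unitInterval in S, v x * w x) +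
      ∫ x : unitInterval in S, (u x - v x) * w x := by
    rw [← integral_add (hw.integrable_mul hvS) (hw.integrable_mul huS)]
    exact integral_congr_ae (ae_of_all _ fun x => by simp only; ring)
  have hA : |∫ x : unitInterval in S, (u x - v x) * w x| ≤ d :=
    (abs_integral_le_integral_abs.trans (integral_mono (hw.integrable_mul huS).abs huS.abs
      fun x => by
        simp only [abs_mul]
        exact mul_le_of_le_one_right (abs_nonneg _) (hw.abs_le_one x))).trans hd0
  have hB : |∫ x : unitInterval in S, (u x - v x)| ≤ d :=
    abs_integral_le_integral_abs.trans hd0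
  set A := ∫ x : unitInterval in S, (u x - v x) * w x
  set B := ∫ x : unitInterval in S, (u x - v x)
  -- Negative values of `u` can lower the mass by at most `d ≤ 1/8`.
  have hden : 1 / 2 ≤ 1 + mass u S := by
    rw [hmass]; linarith [neg_abs_le B]
  refine ⟨by linarith, ?_⟩
  have h1 : revenue w u S - revenue w v S = (A - revenue w v S * B) / (1 + mass u S) := by
    rw [eq_div_iff (by linarith), sub_mul]
    have h2 : revenue w u S * (1 + mass u S) = ∫ x : unitInterval in S, u x * w x :=
      div_mul_cancel₀ _ (by linarith)
    rw [h2, hnum, ← hrv, hmass]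
    ring
  rw [h1, abs_div, abs_of_pos (by linarith : 0 < 1 + mass u S), div_le_iff₀ (by linarith)]
  have h3 : |A - revenue w v S * B| ≤ 2 * d := by
    refine (abs_sub _ _).trans ?_
    rw [abs_mul, abs_of_nonneg hr0]
    have := mul_le_of_le_one_left (abs_nonneg B) hr1
    linarith
  have hdn : 0 ≤ d := (abs_nonneg A).trans hA
  nlinarith

/-- The revenue lost by optimizing for `u` in place of `v`. -/
theorem IsMarginalRevenue.ofReal_gap_le (hw : IsMarginalRevenue w) (hv : IsRegular lo hi v)
    (hu : Measurable fun x : unitInterval => u x) (S₀ : Assortment c)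
    (hS₀ : (∀ S : Assortment c, 0 < 1 + mass u S.carrier) →
      ∀ S : Assortment c, revenue w u S.carrier ≤ revenue w u S₀.carrier) :
    ENNReal.ofReal ((⨆ S : Assortment c, revenue w v S.carrier) - revenue w v S₀.carrier) ≤
      8 * ∫⁻ x : unitInterval, ENNReal.ofReal |u x - v x| := by
  have hm : Measurable fun x : unitInterval => u x - v x := hu.sub hv.measurable
  -- No integrability of the estimate is assumed; an infinite error makes the bound trivial.
  rcases eq_or_ne (∫⁻ x : unitInterval, ENNReal.ofReal |u x - v x|) ⊤ with htop | htop
  · rw [htop, ENNReal.mul_top (by norm_num)]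
    exact le_top
  have hint : Integrable fun x : unitInterval => u x - v x := by
    refine ⟨hm.aestronglyMeasurable, ?_⟩
    rw [hasFiniteIntegral_iff_norm]
    simpa only [Real.norm_eq_abs] using htop.lt_top
  rw [← ofReal_integral_eq_lintegral_ofReal hint.abs (ae_of_all _ fun x => abs_nonneg _),
    ← ENNReal.ofReal_ofNat, ← ENNReal.ofReal_mul (by norm_num)]
  refine ENNReal.ofReal_le_ofReal ?_
  -- For a small error all denominators are positive, so `S₀` is optimal for `u`, and the Lipschitz
  -- constant 4 is paid twice. For a large error, 8 times the error exceeds 1, the largest possible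
  -- gap; this covers an arbitrary selection.
  rcases le_or_gt (∫ x : unitInterval, |u x - v x|) (1 / 8) with hd | hd
  · have key := hw.abs_revenue_sub_le hv hint hd
    have hopt := hS₀ fun S => (key S.carrier).1
    have : Nonempty (Assortment c) := ⟨S₀⟩
    have h0 := abs_le.mp (key S₀.carrier).2
    have h1 : (⨆ S : Assortment c, revenue w v S.carrier) ≤
        revenue w v S₀.carrier + 8 * ∫ x : unitInterval, |u x - v x| :=
      ciSup_le fun S => by
        have h2 := abs_le.mp (key S.carrier).2
        linarith [hopt S, h0.1, h0.2, h2.1, h2.2]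
    linarith
  · linarith [hw.gap_le_one hv S₀]

end Revenue

/-! ### The test intervals cover `[0,1]`, and block errors are added up. -/

section Coverage

variable {c lo hi : ℝ} {v : ℝ → ℝ}

/-- Consecutive left ends are `(1 - c) / (N - 1)` apart, which is at most `c` because `N c ≥ 1`, and
the last interval is `[1 - c, 1]`. -/
theorem exists_mem_test (hc0 : 0 < c) (hc1 : c < 1) {x : ℝ} (hx : x ∈ Icc (0 : ℝ) 1) :
    ∃ i < numTests c, x ∈ Icc (testLeft c i) (testRight c i) := by
  have hN := two_le_numTests hc0 hc1
  have hN2 : (2 : ℝ) ≤ numTests c := by exact_mod_cast hN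
  have hN1 : 0 < (numTests c : ℝ) - 1 := by linarith
  have hNc : 1 ≤ numTests c * c := by
    rw [← div_le_iff₀ hc0]; exact Nat.le_ceil _
  rcases le_or_gt x (1 - c) with hxc | hxc
  · set d := (1 - c) / ((numTests c : ℝ) - 1) with hd
    have hd0 : 0 < d := div_pos (by linarith) hN1
    have hdc : d ≤ c := by rw [hd, div_le_iff₀ hN1]; linarith
    have hl : ∀ i : ℕ, testLeft c i = i * d := fun i => by rw [testLeft, hd]; ring
    have h1 := Nat.floor_le (div_nonneg hx.1 hd0.le)
    have h2 := Nat.lt_floor_add_one (x / d)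
    rw [le_div_iff₀ hd0] at h1
    rw [div_lt_iff₀ hd0] at h2
    refine ⟨⌊x / d⌋₊, ?_, ?_, ?_⟩
    · have h3 : x / d ≤ (numTests c : ℝ) - 1 := by
        rw [div_le_iff₀ hd0, hd, mul_div_cancel₀ _ hN1.ne']; exact hxc
      have h4 : (⌊x / d⌋₊ : ℝ) < numTests c :=
        (Nat.floor_le (div_nonneg hx.1 hd0.le)).trans_lt (by linarith)
      exact_mod_cast h4
    · rw [hl]; exact h1
    · rw [testRight, hl]; linarith
  · have hcast : ((numTests c - 1 : ℕ) : ℝ) = (numTests c : ℝ) - 1 := by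
      rw [Nat.cast_sub (by omega), Nat.cast_one]
    have hl : testLeft c (numTests c - 1) = 1 - c := by
      rw [testLeft, hcast, div_self hN1.ne', one_mul]
    refine ⟨numTests c - 1, by omega, ?_, ?_⟩
    · rw [hl]; exact hxc.le
    · rw [testRight, hl]; linarith [hx.2]

/-- The estimate averages the blocks that cover `x`, and there is at least one, so its error is an
average of their errors and hence at most the sum. -/
theorem abs_estimate_sub_le_sum (hc0 : 0 < c) (hc1 : c < 1) {n : ℕ} (M : ℕ) (X : Fin n → Outcome)
    {x : ℝ} (hx : x ∈ Icc (0 : ℝ) 1) :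
    |estimate c M X x - v x| ≤ ∑ i ∈ Finset.range (numTests c),
      (Icc (testLeft c i) (testRight c i)).indicator
        (fun x => |blockEstimate c M X i x - v x|) x := by
  classical
  set F := (Finset.range (numTests c)).filter fun i =>
    x ∈ Icc (testLeft c i) (testRight c i) with hF
  have hcount : coverCount c x = F.card := by
    rw [coverCount, hF]
  have hpos : 1 ≤ F.card := by
    obtain ⟨i, hi, hxi⟩ := exists_mem_test hc0 hc1 hx
    exact Finset.card_pos.mpr ⟨i, Finset.mem_filter.mpr ⟨Finset.mem_range.mpr hi, hxi⟩⟩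
  have hpos' : (1 : ℝ) ≤ F.card := by exact_mod_cast hpos
  have h1 : ∑ i ∈ Finset.range (numTests c), blockEstimate c M X i x =
      ∑ i ∈ F, blockEstimate c M X i x := by
    rw [hF, Finset.sum_filter]
    refine Finset.sum_congr rfl fun i _ => ?_
    split_ifs with h
    · rfl
    · rw [blockEstimate, if_neg h]
  have h2 : estimate c M X x - v x =
      1 / (F.card : ℝ) * ∑ i ∈ F, (blockEstimate c M X i x - v x) := by
    rw [estimate, hcount, h1, Finset.sum_sub_distrib, Finset.sum_const, nsmul_eq_mul, mul_sub,
      one_div, inv_mul_cancel_left₀ (by linarith)]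
  have h3 : ∑ i ∈ Finset.range (numTests c), (Icc (testLeft c i) (testRight c i)).indicator
      (fun x => |blockEstimate c M X i x - v x|) x =
      ∑ i ∈ F, |blockEstimate c M X i x - v x| := by
    rw [hF, Finset.sum_filter]
    exact Finset.sum_congr rfl fun i _ => by rw [indicator_apply]
  rw [h2, h3, abs_mul, abs_of_nonneg (by positivity)]
  have h4 : 1 / (F.card : ℝ) ≤ 1 := (div_le_one (by linarith)).mpr hpos'
  exact (mul_le_of_le_one_left (abs_nonneg _) h4).trans (Finset.abs_sum_le_sum_abs _ _)

theorem measurable_blockEstimate_right {n : ℕ} (c : ℝ) (M i : ℕ) (X : Fin n → Outcome) :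
    Measurable fun x : ℝ => blockEstimate c M X i x :=
  (measurable_blockEstimate c M i).comp measurable_prodMk_left

theorem measurable_coverCount (c : ℝ) : Measurable fun x : ℝ => (coverCount c x : ℝ) := by
  classical
  have h : (fun x : ℝ => (coverCount c x : ℝ)) = fun x => ∑ i ∈ Finset.range (numTests c),
      (Icc (testLeft c i) (testRight c i)).indicator (fun _ => (1 : ℝ)) x := by
    ext x
    rw [coverCount, Finset.card_filter, Nat.cast_sum]
    refine Finset.sum_congr rfl fun i _ => ?_
    rw [indicator_apply]
    split_ifs <;> simp
  rw [h]
  exact Finset.measurable_fun_sum _ fun i _ => measurable_const.indicator measurableSet_Icc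

theorem measurable_estimate {n : ℕ} (c : ℝ) (M : ℕ) (X : Fin n → Outcome) :
    Measurable fun x : ℝ => estimate c M X x :=
  ((measurable_coverCount c).const_div 1).mul
    (Finset.measurable_fun_sum _ fun i _ => measurable_blockEstimate_right c M i X)

theorem lintegral_estimate_sub_le (hc0 : 0 < c) (hc1 : c < 1) (hv : IsRegular lo hi v) {n : ℕ}
    (M : ℕ) (X : Fin n → Outcome) :
    ∫⁻ x : unitInterval, ENNReal.ofReal |estimate c M X x - v x| ≤
      ∑ i ∈ Finset.range (numTests c), ∫⁻ x in Icc (testLeft c i) (testRight c i),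
        ENNReal.ofReal |blockEstimate c M X i x - v x| := by
  have hmeas : ∀ i, Measurable fun x : unitInterval =>
      (Icc (testLeft c i) (testRight c i)).indicator
        (fun x => ENNReal.ofReal |blockEstimate c M X i x - v x|) (x : ℝ) := fun i => by
    have h1 : (fun x : unitInterval => (Icc (testLeft c i) (testRight c i)).indicator
        (fun x => ENNReal.ofReal |blockEstimate c M X i x - v x|) (x : ℝ)) =
        (Subtype.val ⁻¹' Icc (testLeft c i) (testRight c i)).indicator
        (fun x : unitInterval => ENNReal.ofReal |blockEstimate c M X i x - v x|) := by
      ext x; rfl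
    rw [h1]
    have h2 : Measurable fun x : unitInterval => blockEstimate c M X i x :=
      (measurable_blockEstimate_right c M i X).comp measurable_subtype_coe
    have h3 : Measurable fun x : unitInterval => |blockEstimate c M X i x - v x| :=
      measurable_norm.comp (h2.sub hv.measurable)
    exact h3.ennreal_ofReal.indicator (measurable_subtype_coe measurableSet_Icc)
  calc ∫⁻ x : unitInterval, ENNReal.ofReal |estimate c M X x - v x|
      ≤ ∫⁻ x : unitInterval, ∑ i ∈ Finset.range (numTests c),
          (Icc (testLeft c i) (testRight c i)).indicator
            (fun x => ENNReal.ofReal |blockEstimate c M X i x - v x|) (x : ℝ) := by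
        refine lintegral_mono fun x => ?_
        refine (ENNReal.ofReal_le_ofReal (abs_estimate_sub_le_sum hc0 hc1 M X x.2)).trans ?_
        rw [ENNReal.ofReal_sum_of_nonneg fun i _ => indicator_nonneg (fun _ _ => abs_nonneg _) _]
        refine Finset.sum_le_sum fun i _ => ?_
        rw [indicator_apply, indicator_apply]
        split_ifs <;> simp
    _ = ∑ i ∈ Finset.range (numTests c), ∫⁻ x : unitInterval,
          (Icc (testLeft c i) (testRight c i)).indicator
            (fun x => ENNReal.ofReal |blockEstimate c M X i x - v x|) (x : ℝ) :=
        lintegral_finsetSum _ fun i _ => hmeas i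
    _ ≤ _ := by
        refine Finset.sum_le_sum fun i _ => ?_
        rw [setLIntegral_unitInterval, lintegral_indicator measurableSet_Icc]
        exact lintegral_mono' (Measure.restrict_mono_measure Measure.restrict_le_self _) le_rfl

theorem card_block {M N i : ℕ} (hi : i < N) : (block M i : Finset (Fin (M * N))).card = M := by
  rcases Nat.eq_zero_or_pos M with rfl | hM
  · rw [Finset.card_eq_zero, Finset.eq_empty_iff_forall_notMem]
    intro s
    exact absurd s.2 (by simp)
  · have h1 : (block M i : Finset (Fin (M * N))).map Fin.valEmbedding =
        Finset.Ico (i * M) (i * M + M) := by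
      ext k
      simp only [block, Finset.mem_map, Finset.mem_filter, Finset.mem_univ, true_and,
        Fin.valEmbedding_apply, Finset.mem_Ico]
      have h2 : k / M = i ↔ i * M ≤ k ∧ k < i * M + M := by
        rw [Nat.div_eq_iff hM]
        constructor <;> rintro ⟨h, h'⟩ <;> constructor <;> omega
      constructor
      · rintro ⟨s, hs, rfl⟩
        exact h2.mp hs
      · intro h
        have h3 : k < M * N := by
          have : (i + 1) * M ≤ N * M := Nat.mul_le_mul_right M hi
          rw [mul_comm M N]
          linarith [h.2]
        exact ⟨⟨k, h3⟩, h2.mpr h, rfl⟩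
    rw [← Finset.card_map, h1, Nat.card_Ico]
    omega

end Coverage

/-! ### From estimation error to regret. -/

section Regret

variable {c lo hi C : ℝ} {v w : ℝ → ℝ}

/-- A function that is not integrable has integral 0, so integrability of the revenue gap never has
to be proved. -/
theorem integral_le_of_lintegral_le {Ω : Type*} [MeasurableSpace Ω] {μ : Measure Ω} {f : Ω → ℝ}
    {B : ℝ} (hf : ∀ x, 0 ≤ f x) (hB : 0 ≤ B)
    (h : ∫⁻ x, ENNReal.ofReal (f x) ∂μ ≤ ENNReal.ofReal B) : ∫ x, f x ∂μ ≤ B := by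
  by_cases hi : Integrable f μ
  · rwa [← ofReal_integral_eq_lintegral_ofReal hi (ae_of_all _ hf),
      ENNReal.ofReal_le_ofReal_iff hB] at h
  · rw [integral_undef hi]
    exact hB

theorem expected_gap_le_one (hw : IsMarginalRevenue w) (hv : IsRegular lo hi v) (π : Policy c)
    (t : ℕ) : ∫ h, ((⨆ S : Assortment c, revenue w v S.carrier) -
      revenue w v (π.act t h).carrier) ∂(historyLaw v π t) ≤ 1 := by
  have := isProbabilityMeasure_historyLaw hv π t
  refine integral_le_of_lintegral_le (fun h => hw.gap_nonneg hv _) zero_le_one ?_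
  calc _ ≤ ∫⁻ _h, ENNReal.ofReal 1 ∂(historyLaw v π t) :=
        lintegral_mono fun h => ENNReal.ofReal_le_ofReal (hw.gap_le_one hv _)
    _ = ENNReal.ofReal 1 := by simp

/-- The expected revenue loss in each exploitation period. -/
theorem exists_expected_gap_le (hc0 : 0 < c) (hc1 : c < 1) (hw : IsMarginalRevenue w)
    (hv : IsRegular lo hi v) (hC : IsStronglySmoothWith C v) :
    ∃ K, 0 ≤ K ∧ ∀ (T M : ℕ) (π : Policy c), 0 < M → IsKDEP w T M π →
      ∀ t, M * numTests c ≤ t → t < T →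
      ∫ h, ((⨆ S : Assortment c, revenue w v S.carrier) -
        revenue w v (π.act t h).carrier) ∂(historyLaw v π t) ≤
        K * Real.sqrt ((1 + Real.log M) / M) := by
  choose! K hK0 hK using fun i (hi : i < numTests c) =>
    exists_lintegral_blockEstimate_le hc0 hc1 hv hC hi
  have hsum : 0 ≤ ∑ i ∈ Finset.range (numTests c), K i :=
    Finset.sum_nonneg fun i hi => hK0 i (Finset.mem_range.mp hi)
  refine ⟨8 * ∑ i ∈ Finset.range (numTests c), K i, by positivity, ?_⟩
  rintro T M π hM ⟨hexplore, Sel, hSel, hact⟩ t ht htT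
  refine integral_le_of_lintegral_le (fun h => hw.gap_nonneg hv _) (by positivity) ?_
  set F : (Fin (M * numTests c) → Outcome) → ENNReal := fun X =>
    ∑ i ∈ Finset.range (numTests c), ∫⁻ x in Icc (testLeft c i) (testRight c i),
      ENNReal.ofReal |blockEstimate c M X i x - v x| with hF
  have hFi : ∀ i ∈ Finset.range (numTests c), Measurable fun X : Fin (M * numTests c) → Outcome =>
      ∫⁻ x in Icc (testLeft c i) (testRight c i),
        ENNReal.ofReal |blockEstimate c M X i x - v x| := fun i hi =>
    measurable_lintegral_blockEstimate_sub hv c M i (testLeft_nonneg hc0 hc1 i)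
      (testRight_le_one hc0 hc1 (Finset.mem_range.mp hi))
  have hFm : Measurable F := Finset.measurable_fun_sum _ hFi
  have hpt : ∀ h : History c t, ENNReal.ofReal ((⨆ S : Assortment c, revenue w v S.carrier) -
      revenue w v (π.act t h).carrier) ≤ 8 * F (outcomes ht h) := fun h => by
    have hsel : π.act t h = Sel (outcomes ht h) := hact t ht htT h
    rw [hsel]
    refine (hw.ofReal_gap_le hv ((measurable_estimate c M (outcomes ht h)).comp
      measurable_subtype_coe) _ (hSel (outcomes ht h))).trans ?_
    gcongr
    exact lintegral_estimate_sub_le hc0 hc1 hv M _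
  have hprob : ∀ S, IsProbabilityMeasure (choiceLaw v S) := hv.isProbabilityMeasure_choiceLaw
  calc ∫⁻ h, ENNReal.ofReal ((⨆ S : Assortment c, revenue w v S.carrier) -
        revenue w v (π.act t h).carrier) ∂(historyLaw v π t)
      ≤ ∫⁻ h, 8 * F (outcomes ht h) ∂(historyLaw v π t) := lintegral_mono hpt
    _ = 8 * ∫⁻ h, F (outcomes ht h) ∂(historyLaw v π t) :=
        lintegral_const_mul _ (hFm.comp (measurable_outcomes ht))
    _ = 8 * ∫⁻ X, F X ∂(Measure.pi fun s : Fin (M * numTests c) =>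
          choiceLaw v (testSet c (s / M))) := by
        rw [lintegral_outcomes hv π (S := fun t => testSet c (t / M)) hexplore ht hFm]
    _ = 8 * ∑ i ∈ Finset.range (numTests c),
          ∫⁻ X : Fin (M * numTests c) → Outcome,
            (∫⁻ x in Icc (testLeft c i) (testRight c i),
              ENNReal.ofReal |blockEstimate c M X i x - v x|)
          ∂(Measure.pi fun s : Fin (M * numTests c) => choiceLaw v (testSet c (s / M))) := by
        rw [hF, lintegral_finsetSum _ hFi]
    _ ≤ 8 * ∑ i ∈ Finset.range (numTests c),
          ENNReal.ofReal (K i * Real.sqrt ((1 + Real.log M) / M)) := by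
        gcongr with i hi
        have hi' := Finset.mem_range.mp hi
        refine hK i hi' M hM _ _ (fun s => hprob _) (fun s hs => ?_) (card_block hi')
        have : s.1 / M = i := by simpa [block] using hs
        rw [this]
    _ = ENNReal.ofReal (8 * (∑ i ∈ Finset.range (numTests c), K i) *
          Real.sqrt ((1 + Real.log M) / M)) := by
        rw [← ENNReal.ofReal_sum_of_nonneg fun i hi =>
            mul_nonneg (hK0 i (Finset.mem_range.mp hi)) (Real.sqrt_nonneg _),
          ← Finset.sum_mul, ← ENNReal.ofReal_ofNat, ← ENNReal.ofReal_mul (by norm_num), mul_assoc]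

theorem regret_le_card (hw : IsMarginalRevenue w) (hv : IsRegular lo hi v) (π : Policy c)
    (T : ℕ) : regret w v π T ≤ T := by
  calc regret w v π T ≤ ∑ _t ∈ Finset.range T, (1 : ℝ) :=
        Finset.sum_le_sum fun t _ => expected_gap_le_one hw hv π t
    _ = T := by simp

theorem regret_le_of_gap_le (hw : IsMarginalRevenue w) (hv : IsRegular lo hi v) (π : Policy c)
    {T n : ℕ} {B : ℝ} (hB : 0 ≤ B)
    (h : ∀ t, n ≤ t → t < T → ∫ h, ((⨆ S : Assortment c, revenue w v S.carrier) -
        revenue w v (π.act t h).carrier) ∂(historyLaw v π t) ≤ B) :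
    regret w v π T ≤ n + T * B := by
  classical
  calc regret w v π T ≤ ∑ t ∈ Finset.range T, ((if t < n then 1 else 0) + B) := by
        refine Finset.sum_le_sum fun t ht => ?_
        split_ifs with htn
        · linarith [expected_gap_le_one hw hv π t]
        · rw [zero_add]
          exact h t (not_lt.mp htn) (Finset.mem_range.mp ht)
    _ = ((Finset.range T).filter (· < n)).card + T * B := by
        rw [Finset.sum_add_distrib, Finset.sum_const, Finset.card_range, nsmul_eq_mul,
          Finset.sum_boole]
    _ ≤ n + T * B := by
        have h1 : ((Finset.range T).filter (· < n)).card ≤ n := by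
          calc _ ≤ (Finset.range n).card := Finset.card_le_card fun t ht =>
                Finset.mem_range.mpr (Finset.mem_filter.mp ht).2
            _ = n := Finset.card_range n
        have h2 : (((Finset.range T).filter (· < n)).card : ℝ) ≤ n := by exact_mod_cast h1
        linarith

/-- The values at 0 and 1 are unrestricted, but these two points form a finite measurable set. -/
theorem measurable_of_continuousOn_Ioo (hv : ContinuousOn v (Ioo 0 1)) :
    Measurable fun x : unitInterval => v x := by
  have h0 : MeasurableSet ({0, 1} : Set unitInterval) := (Set.toFinite _).measurableSet
  refine measurable_of_restrict_of_restrict_compl h0 ?_ ?_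
  · exact measurable_of_finite _
  · refine Continuous.measurable (continuous_iff_continuousAt.mpr fun x => ?_)
    have hx : ((x : unitInterval) : ℝ) ∈ Ioo (0 : ℝ) 1 := by
      have hx' := x.2
      simp only [mem_compl_iff, mem_insert_iff, mem_singleton_iff, not_or] at hx'
      exact ⟨unitInterval.pos_iff_ne_zero.mpr hx'.1, unitInterval.lt_one_iff_ne_one.mpr hx'.2⟩
    have h1 : ContinuousAt v ((x : unitInterval) : ℝ) := hv.continuousAt (Ioo_mem_nhds hx.1 hx.2)
    exact ContinuousAt.comp (g := v) (f := fun y : ({0, 1}ᶜ : Set unitInterval) =>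
      ((y : unitInterval) : ℝ)) h1 (by fun_prop)

theorem one_add_log_le {T : ℕ} (hT : 2 ≤ T) : 1 + Real.log T ≤ 4 * Real.log T := by
  have h1 : Real.log 2 ≤ Real.log T := Real.log_le_log two_pos (by exact_mod_cast hT)
  linarith [Real.log_two_gt_d9]

/-- With `y = T^(2/3)` one has `T² = y³`, and one factor `y` is cancelled by `y ≤ 2 N M`. The
constant is `8 N = 4 · 2 N`, where 4 comes from `one_add_log_le`. -/
theorem horizon_mul_sqrt_le {T M : ℕ} {N : ℝ} (hT : 2 ≤ T) (hM : 0 < M) (hMT : (M : ℝ) ≤ T)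
    (hN : 0 < N) (hNM : (T : ℝ) ^ (2 / 3 : ℝ) ≤ 2 * N * M) :
    (T : ℝ) * Real.sqrt ((1 + Real.log M) / M) ≤
      Real.sqrt (8 * N) * (T : ℝ) ^ (2 / 3 : ℝ) * Real.log T ^ (1 / 2 : ℝ) := by
  have hT0 : (0 : ℝ) < T := by positivity
  have hM0 : (0 : ℝ) < M := by exact_mod_cast hM
  set y := (T : ℝ) ^ (2 / 3 : ℝ) with hy
  have hy0 : 0 < y := Real.rpow_pos_of_pos hT0 _
  have hy3 : y ^ 3 = (T : ℝ) ^ 2 := by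
    rw [hy, ← Real.rpow_natCast, ← Real.rpow_mul hT0.le, ← Real.rpow_natCast]
    norm_num
  have hlog : 0 ≤ Real.log T := Real.log_natCast_nonneg T
  have hlM : Real.log M ≤ Real.log T := Real.log_le_log hM0 hMT
  rw [← Real.sqrt_eq_rpow, mul_right_comm, ← Real.sqrt_mul (by positivity), mul_comm _ y]
  refine Real.le_sqrt_of_sq_le ?_ |>.trans (?_ : Real.sqrt (y ^ 2 * (8 * N * Real.log T)) ≤ _)
  · rw [mul_pow, Real.sq_sqrt (div_nonneg (by linarith [Real.log_natCast_nonneg M]) hM0.le),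
      ← hy3]
    have h1 : (1 + Real.log M) / M ≤ 4 * Real.log T / M := by
      gcongr
      linarith [one_add_log_le hT]
    have h2 : y ^ 3 * (4 * Real.log T / M) ≤ y ^ 2 * (8 * N * Real.log T) := by
      rw [← mul_div_assoc, div_le_iff₀ hM0]
      have : 0 ≤ y ^ 2 * (4 * Real.log T) := by positivity
      nlinarith
    exact (mul_le_mul_of_nonneg_left h1 (by positivity)).trans h2
  · rw [Real.sqrt_mul (by positivity), Real.sqrt_sq hy0.le]

end Regret

end ContAssort

theorem theorem5 (c : ℝ) (hc0 : 0 < c) (hc1 : c < 1)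
    (w : ℝ → ℝ) (hw : ContAssort.IsMarginalRevenue w)
    (V : Set (ℝ → ℝ)) (hV : ContAssort.IsPreferenceClass w V)
    (π : ℕ → ContAssort.Policy c)
    (hπ : ∀ T : ℕ, 2 ≤ T →
      ContAssort.IsKDEP w T ⌊(T : ℝ) ^ (2 / 3 : ℝ) / (ContAssort.numTests c : ℝ)⌋₊ (π T)) :
    ∀ v ∈ V, ContAssort.IsStronglySmooth v →
      ∃ C : ℝ, 0 < C ∧ ∀ T : ℕ, 2 ≤ T →
        ContAssort.regret w v (π T) T
          ≤ C * (T : ℝ) ^ (2 / 3 : ℝ) * (Real.log (T : ℝ)) ^ (1 / 2 : ℝ) := by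
  rintro v hvV ⟨hsmooth, C, hC0, hC⟩
  obtain ⟨lo, hi, hlo, -, -, hbd⟩ := hV.bounded
  have hv : ContAssort.IsRegular lo hi v :=
    ⟨hlo, ContAssort.measurable_of_continuousOn_Ioo (hV.differentiableOn v hvV).continuousOn,
      fun y hy => (hbd v hvV y hy).1, fun y hy => (hbd v hvV y hy).2⟩
  obtain ⟨K, hK0, hK⟩ := ContAssort.exists_expected_gap_le hc0 hc1 hw hv ⟨hC0, hsmooth, hC⟩
  have hN2 : (2 : ℝ) ≤ ContAssort.numTests c := by
    exact_mod_cast ContAssort.two_le_numTests hc0 hc1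
  set N : ℝ := (ContAssort.numTests c : ℝ) with hN
  -- The second summand pays for exploitation. The first pays for exploration and for the small
  -- horizons with `M = 0`, where the trivial bound is `N y ≤ 2 N y (log T)^(1/2)`.
  refine ⟨2 * N + K * Real.sqrt (8 * N), by positivity, fun T hT => ?_⟩
  have hT2 : (2 : ℝ) ≤ T := by exact_mod_cast hT
  have hT0 : (0 : ℝ) < T := by linarith
  have hπT := hπ T hT
  set y := (T : ℝ) ^ (2 / 3 : ℝ) with hy
  set M := ⌊y / N⌋₊ with hM
  have hy0 : 0 < y := Real.rpow_pos_of_pos hT0 _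
  have hyT : y ≤ T := by
    calc y ≤ (T : ℝ) ^ (1 : ℝ) :=
          Real.rpow_le_rpow_of_exponent_le (by linarith) (by norm_num)
      _ = T := Real.rpow_one _
  have hMN : M * N ≤ y := by
    rw [← le_div_iff₀ (by linarith)]
    exact Nat.floor_le (by positivity)
  have hMlt : y < (M + 1) * N := by
    rw [← div_lt_iff₀ (by linarith)]
    exact Nat.lt_floor_add_one _
  have hlog2 : Real.log 2 ≤ Real.log T := Real.log_le_log two_pos hT2
  have hlog : 1 / 2 ≤ Real.log T ^ (1 / 2 : ℝ) := by
    rw [← Real.sqrt_eq_rpow]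
    refine Real.le_sqrt_of_sq_le ?_
    linarith [Real.log_two_gt_d9]
  have hyl : y ≤ 2 * (y * Real.log T ^ (1 / 2 : ℝ)) := by nlinarith
  have hKs : 0 ≤ K * Real.sqrt (8 * N) := by positivity
  have hyl0 : 0 ≤ y * Real.log T ^ (1 / 2 : ℝ) := by linarith
  -- If `M = 0` there is no exploration and the estimate carries no information. But then `y < N`,
  -- so `T² = y³ ≤ N² y²`, and the trivial bound `T ≤ N y` suffices.
  rcases Nat.eq_zero_or_pos M with hM0 | hMpos
  · have h1 : y < N := by simpa [hM0] using hMlt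
    have hy3 : y ^ 3 = (T : ℝ) ^ 2 := by
      rw [hy, ← Real.rpow_natCast, ← Real.rpow_mul hT0.le, ← Real.rpow_natCast]
      norm_num
    have h2 : (T : ℝ) ≤ N * y := by
      refine le_of_sq_le_sq ?_ (by positivity)
      rw [← hy3]
      have h3 : y ≤ N * N := by nlinarith
      nlinarith [mul_le_mul_of_nonneg_left h3 (sq_nonneg y)]
    have h3 := ContAssort.regret_le_card hw hv (π T) T
    have h4 : N * y ≤ N * (2 * (y * Real.log T ^ (1 / 2 : ℝ))) :=
      mul_le_mul_of_nonneg_left hyl (by linarith)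
    have h5 : 0 ≤ K * Real.sqrt (8 * N) * (y * Real.log T ^ (1 / 2 : ℝ)) := by positivity
    linarith
  · have hM1 : (1 : ℝ) ≤ M := by exact_mod_cast hMpos
    have hMT : (M : ℝ) ≤ T := by nlinarith
    have h1 := ContAssort.regret_le_of_gap_le hw hv (π T)
      (T := T) (n := M * ContAssort.numTests c) (by positivity)
      (fun t ht htT => hK T M (π T) hMpos hπT t ht htT)
    have h2 := ContAssort.horizon_mul_sqrt_le hT hMpos hMT (by linarith : (0 : ℝ) < N)
      -- For `M ≥ 1` the floor costs at most a factor 2: `y < (M + 1) N ≤ 2 N M`.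
      (by nlinarith)
    have h3 := mul_le_mul_of_nonneg_left h2 hK0
    push_cast at h1
    nlinarith
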